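/- **Setting.** Let $S\subset\mathbb R^3$ be the sphere of centre $(0,0,\tfrac12)$ and radius $\tfrac12$, with north pole $N=(0,0,1)$, and let $T:\mathbb R^2\to S\setminus\{N\}$, $T(x)=\left(\frac{x_1}{1+|x|^2},\frac{x_2}{1+|x|^2},\frac{|x|^2}{1+|x|^2}\right)$. For $V:\mathbb R^2\to\mathbb R$ define $\mathcal V:S\to(-\infty,+\infty]$ by $\mathcal V(T(x))=V(x)-\log(1+|x|^2)$ and $\mathcal V(N)=\liminf_{|x|\to\infty}\{V(x)-\log(1+|x|^2)\}$. The equilibrium measure $\mu_V$ (resp. $\mu_{\mathcal V}$) is the minimizer of $\mu\mapsto\iint\left(\frac{V(x)}2+\frac{V(y)}2-\log|x-y|\right)d\mu(x)d\mu(y)$ among probability measures on $\mathbb R^2$ (resp. of the same expression with $\mathcal V$ among probability measures on $S$). Assume that $V$ is admissible, i.e. $V$ is of class $C^3$, $\liminf_{|x|\to\infty}\{V(x)-\log(1+|x|^2)\}>-\infty$, and $d\mu_{\mathcal V}=m_{\mathcal V}\mathbf 1_{\Sigma_{\mathcal V}}d\sigma$, where $\sigma$ is the surface measure of $S$, $m_{\mathcal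 V}$ is a $C^1$ function on $S$ bounded above and below by positive constants, and $\Sigma_{\mathcal V}\subset S$ is compact with $C^1$ boundary. Let $X$ be a Polish space with a continuous action $(\lambda,u)\mapsto\theta_\lambda u$ of the additive group $\mathbb R^2$ (for instance $\theta_\lambda u=u(\cdot+\lambda)$ on a space of functions). Let $\mathcal E\subset(0,\infty)$ be the set of values of the parameter $\varepsilon$ (for instance $(0,\infty)$, or the values of a sequence), and let $f_\varepsilon$ ($\varepsilon\in\mathcal E$) and $f$ be measurable functions from $\mathbb R^2\times X$ to $[-\infty,+\infty]$. Assume that there is a continuous $\mu_V$-integrable function $h:\mathbb R^2\to\mathbb R$ (for instance a constant) with $f_\varepsilon(x,u)\ge -h(x)$ for all $\varepsilon\in\mathcal E$, $x\in\mathbb R^2$, $u\in X$. Assume moreover that for every sequence $\varepsilon_k\to0$ in $\mathcal E$, every convergent sequence $x_k\to x$ in $\mathbb R^2$ and every sequence $(v_k)$ in $X$ such that for all $R>0$ $$\limsup_{k\to\infty}\int_{B_R}f_{\varepsilon_k}(x_k+\varepsilon_k\lambda,\theta_\lambda v_k)\,d\lambda<+\infty,$$ the following hold, where $B_R$ is the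 closed ball of radius $R$ centred at $0$: (i) (coercivity) $(v_k)$ has a convergent subsequence; (ii) ($\Gamma$-liminf) if $v_k\to v$, then $\liminf_{k\to\infty}f_{\varepsilon_k}(x_k,v_k)\ge f(x,v)$. **Theorem.** Put $F_\varepsilon(u)=\int_{\mathbb R^2}f_\varepsilon(x,\theta_{x/\varepsilon}u)\,d\mu_V(x)$. Let $u_\varepsilon\in X$ and $C\in\mathbb R$ be such that $F_\varepsilon(u_\varepsilon)\le C$ for all $\varepsilon\in\mathcal E$, and let $P_\varepsilon$ be the image of $\mu_V$ under $x\mapsto(x,\theta_{x/\varepsilon}u_\varepsilon)$. 1. For every sequence $\varepsilon_k\to0$ in $\mathcal E$, the sequence $(P_{\varepsilon_k})_k$ is tight, and a subsequence of it converges weakly to a probability measure $P$ on $\mathbb R^2\times X$. If $\varepsilon_k\to0$ is a sequence in $\mathcal E$ along which $P_{\varepsilon_k}$ converges weakly to a probability measure $P$, then: 2. the first marginal of $P$ is $\mu_V$; 3. $P$ is $T_{\lambda(x)}$-invariant, that is, for every $C^1$ map $\lambda:\mathbb R^2\to\mathbb R^2$, $P$ is invariant under $(x,u)\mapsto(x,\theta_{\lambda(x)}u)$;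 4. for $P$-a.e. $(x,u)$ there are $y_k\in\mathbb R^2$ with $(x,u)=\lim_{k\to\infty}(y_k,\theta_{y_k/\varepsilon_k}u_{\varepsilon_k})$; 5. $\displaystyle\liminf_{k\to\infty}F_{\varepsilon_k}(u_{\varepsilon_k})\ge\int_{\mathbb R^2\times X}f\,dP$; 6. for $P$-a.e. $(x,u)$ the limit of $\frac1{|B_R|}\int_{B_R}f(x,\theta_\lambda u)\,d\lambda$ as $R\to+\infty$ exists in $[-\infty,+\infty]$, and $$\int_{\mathbb R^2\times X}f(x,u)\,dP(x,u)=\int_{\mathbb R^2\times X}\left(\lim_{R\to+\infty}\frac1{|B_R|}\int_{B_R}f(x,\theta_\lambda u)\,d\lambda\right)dP(x,u).$$ (All integrals are extended-valued, $\int g=\int g^+-\int g^-$.) -/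

import Mathlib

open MeasureTheory Filter Topology Set

noncomputable section

/-- The Euclidean plane. -/
abbrev Plane : Type := EuclideanSpace ℝ (Fin 2)

/-- Euclidean three-space. -/
abbrev Space3 : Type := EuclideanSpace ℝ (Fin 3)

/-- The integral of an extended-real-valued function, `∫ g⁺ - ∫ g⁻`. It is meaningful as soon as
one of the two terms is finite. -/
def eintegral {α : Type*} [MeasurableSpace α] (μ : Measure α) (g : α → EReal) : EReal :=
  ((∫⁻ a, (g a).toENNReal ∂μ : ENNReal) : EReal) - ((∫⁻ a, (-g a).toENNReal ∂μ : ENNReal) : EReal)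

/-- The average of an extended-real-valued function over a set. -/
def eaverage {α : Type*} [MeasurableSpace α] (μ : Measure α) (s : Set α) (g : α → EReal) : EReal :=
  eintegral ((μ s)⁻¹ • μ.restrict s) g

/-! ### Weighted logarithmic energy and equilibrium measures -/

/-- The weighted logarithmic energy
`∬ (W(x)/2 + W(y)/2 - log |x - y|) dμ(x) dμ(y)`, where `- log 0 = +∞`. -/
def logEnergy {M : Type*} [MetricSpace M] [MeasurableSpace M] (W : M → EReal)
    (μ : ProbabilityMeasure M) : EReal :=
  eintegral ((μ : Measure M).prod (μ : Measure M))
    (fun p => W p.1 / 2 + W p.2 / 2 - ENNReal.log (edist p.1 p.2))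

/-- `μ` minimizes the weighted logarithmic energy among all probability measures. -/
def IsEquilibriumMeasure {M : Type*} [MetricSpace M] [MeasurableSpace M] (W : M → EReal)
    (μ : ProbabilityMeasure M) : Prop :=
  ∀ ν : ProbabilityMeasure M, logEnergy W μ ≤ logEnergy W ν

/-! ### The sphere and the inverse stereographic projection -/

/-- The centre `(0, 0, 1/2)` of the sphere. -/
def sphereCenter : Space3 := !₂[0, 0, 1 / 2]

/-- The sphere with centre `(0, 0, 1/2)` and radius `1/2`. -/
abbrev StereoSphere : Type := Metric.sphere sphereCenter (1 / 2 : ℝ)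

/-- The formula of the inverse stereographic projection. -/
def stereoVec (x : Plane) : Space3 :=
  !₂[x 0 / (1 + ‖x‖ ^ 2), x 1 / (1 + ‖x‖ ^ 2), ‖x‖ ^ 2 / (1 + ‖x‖ ^ 2)]

theorem stereoVec_mem (x : Plane) : stereoVec x ∈ Metric.sphere sphereCenter (1 / 2 : ℝ) := by
  have hx : ‖x‖ ^ 2 = x 0 ^ 2 + x 1 ^ 2 := by
    rw [EuclideanSpace.norm_sq_eq]; simp [Fin.sum_univ_two]
  have hpos : (1 + ‖x‖ ^ 2) ≠ 0 := by positivity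
  rw [mem_sphere_iff_norm, ← sq_eq_sq₀ (norm_nonneg _) (by norm_num), EuclideanSpace.norm_sq_eq]
  simp only [Fin.sum_univ_three, stereoVec, sphereCenter, Real.norm_eq_abs, sq_abs]
  simp only [PiLp.sub_apply, Matrix.cons_val_zero, Matrix.cons_val_one,
    Matrix.cons_val]
  field_simp
  rw [hx]
  ring

/-- The inverse stereographic projection from the plane to the sphere; it is a bijection onto the
sphere without its north pole `(0, 0, 1)`. -/
def stereo (x : Plane) : StereoSphere := ⟨stereoVec x, stereoVec_mem x⟩

theorem stereo_injective : Function.Injective stereo := by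
  intro x y h
  have hv : stereoVec x = stereoVec y := congrArg Subtype.val h
  have hx : (1 + ‖x‖ ^ 2) ≠ 0 := by positivity
  have hy : (1 + ‖y‖ ^ 2) ≠ 0 := by positivity
  have h0 : stereoVec x 0 = stereoVec y 0 := by rw [hv]
  have h1 : stereoVec x 1 = stereoVec y 1 := by rw [hv]
  have h2 : stereoVec x 2 = stereoVec y 2 := by rw [hv]
  simp only [stereoVec, PiLp.toLp_apply, Matrix.cons_val_zero, Matrix.cons_val_one,
    Matrix.cons_val] at h0 h1 h2
  have hn : ‖x‖ ^ 2 = ‖y‖ ^ 2 := by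
    rw [div_eq_div_iff hx hy] at h2
    linarith
  rw [hn] at h0 h1
  ext i
  fin_cases i
  · simpa [div_left_inj' hy] using h0
  · simpa [div_left_inj' hy] using h1

/-- The surface measure of the sphere, in the parametrization by the plane (which misses one
point): the area element is `√(det (DTᵀ DT)) dx`. -/
def sphereArea : Measure StereoSphere :=
  Measure.map stereo ((volume : Measure Plane).withDensity fun x =>
    ENNReal.ofReal (Real.sqrt
      (((fderiv ℝ stereoVec x).adjoint ∘L (fderiv ℝ stereoVec x)).det)))

/-- `x ↦ V(x) - log (1 + |x|²)`. -/
def reducedPotential (V : Plane → ℝ) (x : Plane) : EReal :=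
  ((V x - Real.log (1 + ‖x‖ ^ 2) : ℝ) : EReal)

/-- The potential transported to the sphere: at `T(x)` it is `V(x) - log (1 + |x|²)`, and at the
remaining point, the north pole, it is the lower limit of this expression as `|x| → ∞`. -/
def spherePotential (V : Plane → ℝ) : StereoSphere → EReal :=
  Function.extend stereo (reducedPotential V)
    (fun _ => liminf (reducedPotential V) (cocompact Plane))

/-- A subset of the sphere has `C¹` boundary: near each of its points, the boundary is the zero set
of a `C¹` function whose differential at that point does not vanish on the tangent plane. -/
def HasC1Boundary (S : Set StereoSphere) : Prop :=
  ∀ p ∈ frontier S, ∃ (U : Set Space3) (ρ : Space3 → ℝ) (v : Space3),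
    IsOpen U ∧ (p : Space3) ∈ U ∧ ContDiff ℝ 1 ρ ∧
    inner ℝ v ((p : Space3) - sphereCenter) = 0 ∧ fderiv ℝ ρ (p : Space3) v ≠ 0 ∧
    ∀ q : StereoSphere, (q : Space3) ∈ U → (q ∈ frontier S ↔ ρ (q : Space3) = 0)

/-- The measure is `m 1_Σ` times the surface measure, with `m` of class `C¹` on the sphere and
between two positive constants, and `Σ` compact with `C¹` boundary. -/
def HasRegularDensity (ν : Measure StereoSphere) : Prop :=
  ∃ (m : Space3 → ℝ) (S : Set StereoSphere) (a b : ℝ),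
    ContDiff ℝ 1 m ∧ 0 < a ∧ (∀ p : StereoSphere, a ≤ m p ∧ m p ≤ b) ∧
    IsCompact S ∧ HasC1Boundary S ∧
    ν = (sphereArea.restrict S).withDensity (fun p => ENNReal.ofReal (m p))

/-- Admissible potentials. -/
structure IsAdmissible (V : Plane → ℝ) : Prop where
  contDiff : ContDiff ℝ 3 V
  weak_growth : ⊥ < liminf (reducedPotential V) (cocompact Plane)
  regular : ∀ ν : ProbabilityMeasure StereoSphere,
    IsEquilibriumMeasure (spherePotential V) ν → HasRegularDensity (ν : Measure StereoSphere)

/-! ### The ergodic setting -/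

section Ergodic

variable {X : Type*} [TopologicalSpace X] [PolishSpace X] [MeasurableSpace X] [BorelSpace X]
  [AddAction Plane X] [ContinuousVAdd Plane X]

/-- Coercivity and lower-limit inequality. The parameter `ε` ranges over the set `E` and tends
to `0`; the translation `θ_ℓ u` is written `ℓ +ᵥ u`. -/
def IsCoerciveGammaLiminf (E : Set ℝ) (f : ℝ → Plane → X → EReal) (f₀ : Plane → X → EReal) :
    Prop :=
  ∀ (ε : ℕ → ℝ) (x : ℕ → Plane) (v : ℕ → X) (x₀ : Plane),
    (∀ k, ε k ∈ E) → Tendsto ε atTop (𝓝 0) → Tendsto x atTop (𝓝 x₀) →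
    (∀ R : ℝ, 0 < R →
      limsup (fun k => eintegral (volume.restrict (Metric.closedBall (0 : Plane) R))
        (fun l => f (ε k) (x k + ε k • l) (l +ᵥ v k))) atTop < ⊤) →
    (∃ (φ : ℕ → ℕ) (v₀ : X), StrictMono φ ∧ Tendsto (v ∘ φ) atTop (𝓝 v₀)) ∧
    (∀ v₀ : X, Tendsto v atTop (𝓝 v₀) →
      f₀ x₀ v₀ ≤ liminf (fun k => f (ε k) (x k) (v k)) atTop)

/-- `F_ε(u) = ∫ f_ε(x, θ_{x/ε} u) dμ(x)`. -/
def rescaledFunctional (μ : ProbabilityMeasure Plane) (f : ℝ → Plane → X → EReal) (ε : ℝ)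
    (u : X) : EReal :=
  eintegral (μ : Measure Plane) (fun x => f ε x ((ε⁻¹ • x) +ᵥ u))

/-- The image of `μ` under `x ↦ (x, θ_{x/ε} u)`. -/
def blowUpLaw (μ : ProbabilityMeasure Plane) (ε : ℝ) (u : X) : ProbabilityMeasure (Plane × X) :=
  μ.map (f := fun x => (x, (ε⁻¹ • x) +ᵥ u))
    (Continuous.aemeasurable (by fun_prop))

/-- Invariance under `(x, u) ↦ (x, θ_{ℓ(x)} u)` for every `C¹` map `ℓ`. -/
def IsTranslationInvariant (P : Measure (Plane × X)) : Prop :=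
  ∀ l : Plane → Plane, ContDiff ℝ 1 l →
    Measure.map (fun p : Plane × X => (p.1, l p.1 +ᵥ p.2)) P = P

end Ergodic

end

/-! The argument is abstract once `μ` is known to live on an open set `U` with a continuous, bounded
density that is positive on `U`. This comes from the sphere. The chordal distance satisfies |T(x) −
T(y)|² = |x − y|² / ((1 + |x|²)(1 + |y|²)), so the planar and spherical energies agree, and a
measure charging the pole has infinite energy. Hence `μ` is carried to an equilibrium measure on the
sphere, whose density is regular. The boundary of its support pulls back to a null set, so the
support may be replaced by its interior.

Compactness rests on a penalization: an exhaustion function `χ` of `U` plus a convergent series of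
local energies of `u` in balls of radius comparable to ε. By Fubini and translation invariance of
Lebesgue measure its `μ`-integral is controlled by the energy (`lintegral_penalty_le`). A bound on
the penalization at x keeps x in a compact subset of `U`, where the density is bounded below, and
therefore gives exactly the local bounds required by coercivity. Markov's inequality then yields
tightness. For the lower bound, η times the penalization is added to the energy, so that the
Γ-liminf hypothesis applies along bounded sequences. Portmanteau on open sets, the layer cake
formula and Fatou pass to the limit (`lintegral_le_liminf_lintegral_of_forall_seq`), and then η → 0.

Translating the blow-up at x by a gives the blow-up at x + εa. A change of variables puts the shift
εa on the density, where it disappears by continuity of translations in L¹. Limits are thus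
invariant under constant translations, and under x-dependent ones by approximation with simple
functions.

The last claim is Wiener's ergodic theorem for the action on the second coordinate, proved here from
a Vitali covering, transference and a mean ergodic theorem. The limit energy has integrable positive
part, but its negative part need not be integrable, so the theorem is needed for nonnegative
functions of possibly infinite integral (`exists_tendsto_ballAverage`). -/

noncomputable section

/-! ### Ball averages along measure-preserving flows -/

section Flow

open scoped ENNReal

set_option linter.unusedSectionVars false

variable {E : Type*} [NormedAddCommGroup E] [NormedSpace ℝ E] [FiniteDimensional ℝ E]
  [MeasureSpace E] [BorelSpace E] [(volume : Measure E).IsAddHaarMeasure]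
  {Y : Type*} [MeasurableSpace Y]

/-- A weak-type bound: if on each ball of a family centred at the points of `S` the mean of `g`
is at least `t`, then `t |S|` is controlled by the integral of `g`. -/
theorem mul_volume_le_lintegral_of_closedBall {g : E → ℝ≥0∞} {S W : Set E} {r : E → ℝ} {R : ℝ}
    {t : ℝ≥0∞} (hr : ∀ b ∈ S, 0 < r b ∧ r b ≤ R)
    (hg : ∀ b ∈ S, t * volume (Metric.closedBall b (r b)) ≤ ∫⁻ x in Metric.closedBall b (r b), g x)
    (hW : ∀ b ∈ S, Metric.closedBall b (r b) ⊆ W) :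
    t * volume S ≤ ENNReal.ofReal (4 ^ Module.finrank ℝ E) * ∫⁻ x in W, g x := by
  -- The Vitali selection works for any enlargement factor above 3. The choice 4 is the origin of
  -- the constant 4^d in all the maximal inequalities below.
  obtain ⟨u, huS, hdisj, hcov⟩ := Vitali.exists_disjoint_subfamily_covering_enlargement_closedBall
    S (fun b => b) r R (fun b hb => (hr b hb).2) 4 (by norm_num)
  have hcount : u.Countable := hdisj.countable_of_nonempty_interior fun b hb =>
    ⟨b, Metric.ball_subset_interior_closedBall (Metric.mem_ball_self (hr b (huS hb)).1)⟩
  have hsub : S ⊆ ⋃ b ∈ u, Metric.closedBall b (4 * r b) := by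
    intro a ha
    obtain ⟨b, hb, hab⟩ := hcov a ha
    exact mem_biUnion hb (hab (Metric.mem_closedBall_self (hr a ha).1.le))
  calc t * volume S
      ≤ t * ∑' b : u, volume (Metric.closedBall (b : E) (4 * r b)) := by
        gcongr
        exact (measure_mono hsub).trans (measure_biUnion_le _ hcount _)
    _ = ENNReal.ofReal (4 ^ Module.finrank ℝ E) *
          ∑' b : u, t * volume (Metric.closedBall (b : E) (r b)) := by
        rw [← ENNReal.tsum_mul_left, ← ENNReal.tsum_mul_left]
        congr 1
        ext b
        rw [Measure.addHaar_closedBall_mul_of_pos _ _ (by norm_num : (0 : ℝ) < 4),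
          Measure.addHaar_closedBall_center volume (b : E)]
        ring
    _ ≤ ENNReal.ofReal (4 ^ Module.finrank ℝ E) *
          ∑' b : u, ∫⁻ x in Metric.closedBall (b : E) (r b), g x := by
        gcongr with b
        exact hg b (huS b.2)
    _ = ENNReal.ofReal (4 ^ Module.finrank ℝ E) *
          ∫⁻ x in ⋃ b ∈ u, Metric.closedBall b (r b), g x := by
        rw [lintegral_biUnion hcount (fun b _ => Metric.isClosed_closedBall.measurableSet) hdisj]
    _ ≤ _ := by
        gcongr
        exact iUnion₂_subset fun b hb => hW b (huS hb)

/-- A jointly measurable action of a vector space by measure-preserving maps. -/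
structure IsMeasurePreservingFlow (T : E → Y → Y) (P : Measure Y) : Prop where
  measurable : Measurable (Function.uncurry T)
  map_add : ∀ a b y, T (a + b) y = T a (T b y)
  measurePreserving : ∀ a, MeasurePreserving (T a) P P

/-- The average of a nonnegative function over the image of a ball under a flow. -/
def ballAverage (T : E → Y → Y) (r : ℝ) (φ : Y → ℝ≥0∞) (y : Y) : ℝ≥0∞ :=
  (volume (Metric.closedBall (0 : E) r))⁻¹ * ∫⁻ l in Metric.closedBall (0 : E) r, φ (T l y)

variable {T : E → Y → Y} {P : Measure Y} {φ ψ : Y → ℝ≥0∞} {r : ℝ}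

theorem volume_closedBall_ne_zero' (hr : 0 < r) : volume (Metric.closedBall (0 : E) r) ≠ 0 :=
  (Metric.measure_closedBall_pos _ _ hr).ne'

theorem volume_closedBall_ne_top' : volume (Metric.closedBall (0 : E) r) ≠ ∞ :=
  haveI := FiniteDimensional.proper ℝ E
  (isCompact_closedBall _ _).measure_ne_top

theorem measurable_ballAverage (hT : IsMeasurePreservingFlow T P) (hφ : Measurable φ) :
    Measurable (ballAverage T r φ) := by
  refine Measurable.const_mul ?_ _
  exact Measurable.lintegral_prod_left (f := fun l y => φ (T l y)) (hφ.comp hT.measurable)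

theorem lintegral_closedBall_flow (hT : IsMeasurePreservingFlow T P) [SFinite P]
    (hφ : Measurable φ) (s : Set E) :
    ∫⁻ y, (∫⁻ l in s, φ (T l y)) ∂P = volume s * ∫⁻ y, φ y ∂P := by
  rw [lintegral_lintegral_swap]
  · simp_rw [fun l => (hT.measurePreserving l).lintegral_comp hφ]
    simp [mul_comm]
  · exact ((hφ.comp hT.measurable).comp measurable_swap).aemeasurable

theorem lintegral_ballAverage (hT : IsMeasurePreservingFlow T P) [SFinite P]
    (hφ : Measurable φ) (hr : 0 < r) : ∫⁻ y, ballAverage T r φ y ∂P = ∫⁻ y, φ y ∂P := by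
  unfold ballAverage
  rw [lintegral_const_mul, lintegral_closedBall_flow hT hφ, ← mul_assoc,
    ENNReal.inv_mul_cancel (volume_closedBall_ne_zero' hr) volume_closedBall_ne_top', one_mul]
  exact Measurable.lintegral_prod_left (f := fun l y => φ (T l y)) (hφ.comp hT.measurable)

theorem ballAverage_mono (h : ∀ y, φ y ≤ ψ y) (y : Y) :
    ballAverage T r φ y ≤ ballAverage T r ψ y := by
  unfold ballAverage
  gcongr
  exact h _

theorem ballAverage_add (hT : IsMeasurePreservingFlow T P) (hφ : Measurable φ) (y : Y) :
    ballAverage T r (fun y => φ y + ψ y) y = ballAverage T r φ y + ballAverage T r ψ y := by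
  unfold ballAverage
  rw [← mul_add, lintegral_add_left]
  exact hφ.comp (hT.measurable.comp (measurable_id.prodMk measurable_const))

theorem lintegral_flow_closedBall (hT : IsMeasurePreservingFlow T P)  (b : E) (y : Y) :
    ∫⁻ l in Metric.closedBall (0 : E) r, φ (T l (T b y)) =
      ∫⁻ l in Metric.closedBall b r, φ (T l y) := by
  have : Metric.closedBall (0 : E) r = (fun l => l + b) ⁻¹' Metric.closedBall b r := by
    ext l; simp
  simp_rw [← hT.map_add]
  rw [this, ← (measurePreserving_add_right (volume : Measure E) b).setLIntegral_comp_preimage_emb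
    (measurableEmbedding_addRight b) (fun l => φ (T l y))]

/-- The truncated maximal inequality, by transference to the space acting. -/
theorem mul_measure_exists_lt_ballAverage_le (hT : IsMeasurePreservingFlow T P)
    [IsFiniteMeasure P] (hφ : Measurable φ) (t : ℝ≥0∞) (N : ℕ) (M : ℝ) :
    t * P {y | ∃ n < N, t < ballAverage T (n + 1) φ y} * volume (Metric.closedBall (0 : E) M) ≤
      ENNReal.ofReal (4 ^ Module.finrank ℝ E) *
        (volume (Metric.closedBall (0 : E) (M + N)) * ∫⁻ y, φ y ∂P) := by
  set S := {y | ∃ n < N, t < ballAverage T (n + 1) φ y} with hS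
  have hSm : MeasurableSet S := by
    have : S = ⋃ n ∈ Finset.range N, {y | t < ballAverage T (n + 1) φ y} := by
      ext y; simp [hS]
    rw [this]
    exact Finset.measurableSet_biUnion _ fun n _ =>
      measurableSet_lt measurable_const (measurable_ballAverage hT hφ)
  -- Transference: along the orbit of a fixed y, each time in the ball of radius `M` at which the
  -- orbit visits `S` is the centre of a ball of radius at most `N` on which the mean exceeds t.
  -- These balls stay in the ball of radius `M + N`. Integration in y then uses invariance on both
  -- sides.
  have key : ∀ y, t * ∫⁻ l in Metric.closedBall (0 : E) M, S.indicator 1 (T l y) ≤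
      ENNReal.ofReal (4 ^ Module.finrank ℝ E) *
        ∫⁻ l in Metric.closedBall (0 : E) (M + N), φ (T l y) := by
    intro y
    have hm : Measurable fun l => T l y := hT.measurable.comp (measurable_id.prodMk measurable_const)
    have h1 : ∫⁻ l in Metric.closedBall (0 : E) M, S.indicator 1 (T l y) =
        volume (Metric.closedBall (0 : E) M ∩ (fun l => T l y) ⁻¹' S) := by
      have : (fun l => S.indicator (1 : Y → ℝ≥0∞) (T l y)) =
          ((fun l => T l y) ⁻¹' S).indicator 1 := by ext l; simp [indicator]
      rw [this, lintegral_indicator_one (hm hSm), Measure.restrict_apply (hm hSm), inter_comm]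
    rw [h1]
    have hch : ∀ b : E, ∃ ρ : ℝ, b ∈ (fun l => T l y) ⁻¹' S → 0 < ρ ∧ ρ ≤ N ∧
        t * volume (Metric.closedBall b ρ) ≤ ∫⁻ x in Metric.closedBall b ρ, φ (T x y) := by
      intro b
      by_cases hb : b ∈ (fun l => T l y) ⁻¹' S
      · obtain ⟨n, hn, hlt⟩ := hb
        have hn1 : (0 : ℝ) < n + 1 := by positivity
        refine ⟨n + 1, fun _ => ⟨hn1, by exact_mod_cast hn, ?_⟩⟩
        rw [← lintegral_flow_closedBall hT, Measure.addHaar_closedBall_center]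
        unfold ballAverage at hlt
        rw [mul_comm, ← div_eq_mul_inv, ENNReal.lt_div_iff_mul_lt
          (Or.inl (volume_closedBall_ne_zero' hn1)) (Or.inl volume_closedBall_ne_top')] at hlt
        exact hlt.le
      · exact ⟨0, fun h => absurd h hb⟩
    choose ρ hρ using hch
    refine mul_volume_le_lintegral_of_closedBall (r := ρ) (R := N)
      (fun b hb => ⟨(hρ b hb.2).1, (hρ b hb.2).2.1⟩) (fun b hb => (hρ b hb.2).2.2) ?_
    intro b hb
    refine Metric.closedBall_subset_closedBall' ?_
    have := Metric.mem_closedBall.1 hb.1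
    have := (hρ b hb.2).2.1
    linarith
  calc t * P S * volume (Metric.closedBall (0 : E) M)
      = t * (volume (Metric.closedBall (0 : E) M) * ∫⁻ y, S.indicator 1 y ∂P) := by
        rw [lintegral_indicator_one hSm]; ring
    _ = ∫⁻ y, t * (∫⁻ l in Metric.closedBall (0 : E) M, S.indicator 1 (T l y)) ∂P := by
        rw [← lintegral_closedBall_flow hT (measurable_one.indicator hSm), lintegral_const_mul]
        exact Measurable.lintegral_prod_left (f := fun l y => S.indicator 1 (T l y))
          ((measurable_one.indicator hSm).comp hT.measurable)
    _ ≤ ∫⁻ y, ENNReal.ofReal (4 ^ Module.finrank ℝ E) *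
        (∫⁻ l in Metric.closedBall (0 : E) (M + N), φ (T l y)) ∂P := lintegral_mono key
    _ = _ := by
        rw [lintegral_const_mul, lintegral_closedBall_flow hT hφ]
        exact Measurable.lintegral_prod_left (f := fun l y => φ (T l y)) (hφ.comp hT.measurable)

/-- **Wiener's maximal inequality** for averages over balls of integer radius. -/
theorem mul_measure_exists_lt_ballAverage (hT : IsMeasurePreservingFlow T P)
    [IsFiniteMeasure P] (hφ : Measurable φ) (t : ℝ≥0∞) :
    t * P {y | ∃ n : ℕ, t < ballAverage T (n + 1) φ y} ≤
      ENNReal.ofReal (4 ^ Module.finrank ℝ E) * ∫⁻ y, φ y ∂P := by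
  set d := Module.finrank ℝ E
  have hN : ∀ N : ℕ, t * P {y | ∃ n < N, t < ballAverage T (n + 1) φ y} ≤
      ENNReal.ofReal (4 ^ d) * ∫⁻ y, φ y ∂P := by
    intro N
    -- With `M = k + 1` the loss is the volume ratio (1 + N/(k+1))^d, which tends to 1 for fixed
    -- `N`.
    have hb : ∀ k : ℕ, t * P {y | ∃ n < N, t < ballAverage T (n + 1) φ y} ≤
        ENNReal.ofReal ((1 + (N : ℝ) / (k + 1)) ^ d) *
          (ENNReal.ofReal (4 ^ d) * ∫⁻ y, φ y ∂P) := by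
      intro k
      have hk : (0 : ℝ) < k + 1 := by positivity
      have h := mul_measure_exists_lt_ballAverage_le hT hφ t N (k + 1)
      have hv : volume (Metric.closedBall (0 : E) ((k + 1 : ℝ) + N)) =
          ENNReal.ofReal ((1 + (N : ℝ) / (k + 1)) ^ d) *
            volume (Metric.closedBall (0 : E) (k + 1)) := by
        rw [← Measure.addHaar_closedBall_mul_of_pos _ (0 : E) (by positivity)]
        congr 2
        field_simp
      rw [hv] at h
      rw [← ENNReal.mul_le_mul_iff_left (volume_closedBall_ne_zero' (E := E) hk)
        volume_closedBall_ne_top']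
      refine h.trans (le_of_eq ?_)
      ring
    have hlim : Tendsto (fun k : ℕ => ENNReal.ofReal ((1 + (N : ℝ) / (k + 1)) ^ d) *
          (ENNReal.ofReal (4 ^ d) * ∫⁻ y, φ y ∂P)) atTop
        (𝓝 (1 * (ENNReal.ofReal (4 ^ d) * ∫⁻ y, φ y ∂P))) := by
      refine ENNReal.Tendsto.mul_const ?_ (Or.inl one_ne_zero)
      rw [← ENNReal.ofReal_one]
      refine (ENNReal.continuous_ofReal.tendsto _).comp ?_
      have : Tendsto (fun k : ℕ => (N : ℝ) / (k + 1)) atTop (𝓝 0) := by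
        have := tendsto_one_div_add_atTop_nhds_zero_nat (𝕜 := ℝ)
        simpa [div_eq_mul_inv] using this.const_mul (N : ℝ)
      simpa using (this.const_add 1).pow d
    rw [one_mul] at hlim
    exact ge_of_tendsto' hlim hb
  have hU : {y | ∃ n : ℕ, t < ballAverage T (n + 1) φ y} =
      ⋃ N : ℕ, {y | ∃ n < N, t < ballAverage T (n + 1) φ y} := by
    ext y
    simp only [mem_ofPred_eq, mem_iUnion]
    exact ⟨fun ⟨n, hn⟩ => ⟨n + 1, n, n.lt_succ_self, hn⟩, fun ⟨_, n, _, hn⟩ => ⟨n, hn⟩⟩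
  have hmono : Monotone fun N : ℕ => {y | ∃ n < N, t < ballAverage T (n + 1) φ y} :=
    fun a b hab y ⟨n, hn, h⟩ => ⟨n, hn.trans_le hab, h⟩
  rw [hU, hmono.measure_iUnion, ENNReal.mul_iSup]
  exact iSup_le hN

/-! ### Mean ergodic theorem -/

/-- Isometries fixing the origin and preserving a convex set have a common fixed point in its
closure: the point of least norm. -/
theorem exists_mem_closure_forall_fixed {H : Type*} [NormedAddCommGroup H] [InnerProductSpace ℝ H]
    [CompleteSpace H] {C : Set H} (hC : Convex ℝ C) (hne : C.Nonempty) {ι : Type*}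
    {U : ι → H → H} (hcont : ∀ i, Continuous (U i)) (hnorm : ∀ i x, ‖U i x‖ = ‖x‖)
    (hmap : ∀ i, MapsTo (U i) C C) : ∃ v ∈ closure C, ∀ i, U i v = v := by
  obtain ⟨v, hv, hmin⟩ := exists_norm_eq_iInf_of_complete_convex hne.closure
    isClosed_closure.isComplete hC.closure 0
  refine ⟨v, hv, fun i => ?_⟩
  have hw : U i v ∈ closure C := (hmap i).closure (hcont i) hv
  -- Both v and `U i v` are projections of 0 onto the closed convex set. Their two variational
  -- inequalities add up to ‖U v − v‖² ≤ 0.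
  have h1 := (norm_eq_iInf_iff_real_inner_le_zero hC.closure hv).1 hmin _ hw
  have hmin' : ‖0 - U i v‖ = ⨅ w : closure C, ‖0 - (w : H)‖ := by
    rw [← hmin, zero_sub, zero_sub, norm_neg, norm_neg, hnorm]
  have h2 := (norm_eq_iInf_iff_real_inner_le_zero hC.closure hw).1 hmin' _ hv
  rw [← sub_eq_zero, ← inner_self_eq_zero (𝕜 := ℝ)]
  refine le_antisymm ?_ real_inner_self_nonneg
  have h3 := real_inner_comm v (U i v)
  simp only [zero_sub, inner_neg_left, inner_sub_right, inner_sub_left] at *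
  linarith

/-- Both balls contain the ball of radius r − ‖a‖ about the origin. What remains of each is a
fraction 1 − (1 − ‖a‖/r)^d of its volume, on which |g| ≤ B. -/
theorem abs_setAverage_sub_setAverage_le {g : E → ℝ} (hg : Measurable g) {B : ℝ}
    (hB : ∀ x, |g x| ≤ B) (a : E) {r : ℝ} (hr : ‖a‖ < r) :
    |(⨍ x in Metric.closedBall a r, g x) - ⨍ x in Metric.closedBall (0 : E) r, g x| ≤
      2 * B * (1 - (1 - ‖a‖ / r) ^ Module.finrank ℝ E) := by
  have hr0 : 0 < r := (norm_nonneg a).trans_lt hr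
  have := FiniteDimensional.proper ℝ E
  have hB0 : 0 ≤ B := (abs_nonneg _).trans (hB 0)
  set s := Metric.closedBall (0 : E) (r - ‖a‖)
  set v := volume.real (Metric.closedBall (0 : E) r) with hv
  have hvpos : 0 < v := ENNReal.toReal_pos (volume_closedBall_ne_zero' hr0) volume_closedBall_ne_top'
  have hint : ∀ (b : E) (ρ : ℝ), IntegrableOn g (Metric.closedBall b ρ) := fun b ρ =>
    Measure.integrableOn_of_bounded (M := B) (isCompact_closedBall _ _).measure_ne_top
      hg.aestronglyMeasurable (Eventually.of_forall fun x => by simpa using hB x)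
  have hs : volume.real s = (1 - ‖a‖ / r) ^ Module.finrank ℝ E * v := by
    have h1 : 0 < 1 - ‖a‖ / r := by rw [sub_pos, div_lt_one hr0]; exact hr
    have h2 : r - ‖a‖ = (1 - ‖a‖ / r) * r := by field_simp
    simp only [s, hv, h2, measureReal_def]
    rw [Measure.addHaar_closedBall_mul_of_pos _ _ h1, ENNReal.toReal_mul,
      ENNReal.toReal_ofReal (by positivity)]
  have hdiff : ∀ b : E, ‖b‖ ≤ ‖a‖ →
      |(∫ x in Metric.closedBall b r, g x) - ∫ x in s, g x| ≤ B * (v - volume.real s) := by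
    intro b hb
    have hsub : s ⊆ Metric.closedBall b r := by
      refine Metric.closedBall_subset_closedBall' ?_
      rw [dist_zero_left]
      linarith
    rw [← setIntegral_sdiff Metric.isClosed_closedBall.measurableSet (hint b r) hsub]
    have hfin : volume (Metric.closedBall b r \ s) < ∞ :=
      (measure_mono sdiff_subset).trans_lt (isCompact_closedBall b r).measure_lt_top
    refine (norm_setIntegral_le_of_norm_le_const (C := B) hfin fun x _ => (Real.norm_eq_abs _).trans_le (hB x)).trans
      (le_of_eq ?_)
    rw [measureReal_sdiff hsub Metric.isClosed_closedBall.measurableSet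
      (isCompact_closedBall _ _).measure_ne_top]
    rw [hv, measureReal_def, Measure.addHaar_closedBall_center volume b, ← measureReal_def]
  have h1 := hdiff a le_rfl
  have h2 := hdiff 0 (by simp)
  rw [setAverage_eq, setAverage_eq, measureReal_def, Measure.addHaar_closedBall_center volume a,
    ← measureReal_def, ← hv, ← smul_sub, smul_eq_mul, abs_mul, abs_of_pos (inv_pos.2 hvpos),
    inv_mul_le_iff₀ hvpos]
  calc _ = |((∫ x in Metric.closedBall a r, g x) - ∫ x in s, g x) -
        ((∫ x in Metric.closedBall (0 : E) r, g x) - ∫ x in s, g x)| := by congr 1; ring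
    _ ≤ _ := (abs_sub _ _).trans (add_le_add h1 h2)
    _ = _ := by rw [hs]; ring

theorem tendsto_setAverage_sub_setAverage {g : E → ℝ} (hg : Measurable g) {B : ℝ}
    (hB : ∀ x, |g x| ≤ B) (a : E) :
    Tendsto (fun n : ℕ => (⨍ x in Metric.closedBall a ((n : ℝ) + 1), g x) -
      ⨍ x in Metric.closedBall (0 : E) ((n : ℝ) + 1), g x) atTop (𝓝 0) := by
  have hlim : Tendsto (fun n : ℕ => 2 * B * (1 - (1 - ‖a‖ / ((n : ℝ) + 1)) ^ Module.finrank ℝ E))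
      atTop (𝓝 0) := by
    have h0 : Tendsto (fun n : ℕ => ‖a‖ / ((n : ℝ) + 1)) atTop (𝓝 0) := by
      have := tendsto_one_div_add_atTop_nhds_zero_nat (𝕜 := ℝ)
      simpa [div_eq_mul_inv] using this.const_mul ‖a‖
    simpa using (((h0.const_sub 1).pow (Module.finrank ℝ E)).const_sub 1).const_mul (2 * B)
  refine squeeze_zero_norm' ?_ hlim
  have hev : ∀ᶠ n : ℕ in atTop, ‖a‖ < (n : ℝ) + 1 := by
    filter_upwards [tendsto_natCast_atTop_atTop.eventually_gt_atTop ‖a‖] with n hn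
    linarith
  filter_upwards [hev] with n hn
  exact abs_setAverage_sub_setAverage_le hg hB a hn

theorem setAverage_flow_closedBall (hT : IsMeasurePreservingFlow T P) (f : Y → ℝ) (b : E) (y : Y) :
    ⨍ l in Metric.closedBall (0 : E) r, f (T l (T b y)) =
      ⨍ l in Metric.closedBall b r, f (T l y) := by
  have h : Metric.closedBall (0 : E) r = (fun l => l + b) ⁻¹' Metric.closedBall b r := by
    ext l; simp
  simp_rw [← hT.map_add]
  rw [setAverage_eq, setAverage_eq, measureReal_def, measureReal_def,
    Measure.addHaar_closedBall_center volume b]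
  congr 1
  rw [h, (measurePreserving_add_right (volume : Measure E) b).setIntegral_preimage_emb
    (measurableEmbedding_addRight b) (fun l => f (T l y))]

theorem IsMeasurePreservingFlow.measurable_orbit (hT : IsMeasurePreservingFlow T P) (y : Y) :
    Measurable fun l => T l y := hT.measurable.comp (measurable_id.prodMk measurable_const)

theorem integrableOn_closedBall_of_bounded {g : E → ℝ} (hg : Measurable g) {B : ℝ}
    (hB : ∀ x, |g x| ≤ B) (a : E) (r : ℝ) : IntegrableOn g (Metric.closedBall a r) :=
  have := FiniteDimensional.proper ℝ E
  Measure.integrableOn_of_bounded (M := B) (isCompact_closedBall _ _).measure_ne_top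
    hg.aestronglyMeasurable (Eventually.of_forall fun x => by simpa using hB x)

/-- A mean ergodic theorem for bounded functions: there is an invariant function which can be
approximated in mean by bounded functions with asymptotically the same averages. -/
theorem exists_invariant_approx (hT : IsMeasurePreservingFlow T P) [IsProbabilityMeasure P]
    {f : Y → ℝ} (hf : Measurable f) {B : ℝ} (hB : ∀ y, |f y| ≤ B) :
    ∃ g : Y → ℝ, Measurable g ∧ (∀ a, g ∘ T a =ᵐ[P] g) ∧ ∀ δ : ℝ≥0∞, δ ≠ 0 →
      ∃ ψ : Y → ℝ, Measurable ψ ∧ (∃ B', ∀ y, |ψ y| ≤ B') ∧ ∫⁻ y, ‖ψ y - g y‖ₑ ∂P ≤ δ ∧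
        ∀ y, Tendsto (fun n : ℕ => (⨍ l in Metric.closedBall (0 : E) ((n : ℝ) + 1), ψ (T l y)) -
          ⨍ l in Metric.closedBall (0 : E) ((n : ℝ) + 1), f (T l y)) atTop (𝓝 0) := by
  -- The classes of bounded functions whose ball averages are asymptotic to those of `f` at every
  -- point. This set is convex, and it is stable under composition with `T a` because a bounded
  -- shift of large balls does not affect averages. Its element of least norm in the closure is the
  -- invariant limit.
  set C : Set (Lp ℝ 2 P) := {w | ∃ ψ : Y → ℝ, Measurable ψ ∧ (∃ B', ∀ y, |ψ y| ≤ B') ∧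
    w =ᵐ[P] ψ ∧
        ∀ y, Tendsto (fun n : ℕ => (⨍ l in Metric.closedBall (0 : E) ((n : ℝ) + 1), ψ (T l y)) -
          ⨍ l in Metric.closedBall (0 : E) ((n : ℝ) + 1), f (T l y)) atTop (𝓝 0)} with hCdef
  have hconv : Convex ℝ C := by
    rintro w₁ ⟨ψ₁, hm₁, ⟨B₁, hB₁⟩, he₁, ht₁⟩ w₂ ⟨ψ₂, hm₂, ⟨B₂, hB₂⟩, he₂, ht₂⟩ a b ha hb hab
    refine ⟨fun y => a * ψ₁ y + b * ψ₂ y, by fun_prop, ⟨a * B₁ + b * B₂, fun y => ?_⟩, ?_, ?_⟩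
    · refine (abs_add_le _ _).trans ?_
      rw [abs_mul, abs_mul, abs_of_nonneg ha, abs_of_nonneg hb]
      gcongr
      exacts [hB₁ y, hB₂ y]
    · filter_upwards [Lp.coeFn_add (a • w₁) (b • w₂), Lp.coeFn_smul a w₁, Lp.coeFn_smul b w₂,
        he₁, he₂] with y h1 h2 h3 h4 h5
      rw [h1, Pi.add_apply, h2, h3, Pi.smul_apply, Pi.smul_apply, h4, h5, smul_eq_mul, smul_eq_mul]
    · intro y
      have := ((ht₁ y).const_mul a).add ((ht₂ y).const_mul b)
      simp only [mul_zero, add_zero] at this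
      refine this.congr fun n => ?_
      have hi₁ := integrableOn_closedBall_of_bounded (hm₁.comp (hT.measurable_orbit y))
        (fun l => hB₁ (T l y)) 0 ((n : ℝ) + 1)
      have hi₂ := integrableOn_closedBall_of_bounded (hm₂.comp (hT.measurable_orbit y))
        (fun l => hB₂ (T l y)) 0 ((n : ℝ) + 1)
      have hadd : ⨍ l in Metric.closedBall (0 : E) ((n : ℝ) + 1), (a * ψ₁ (T l y) + b * ψ₂ (T l y))
          = a * (⨍ l in Metric.closedBall (0 : E) ((n : ℝ) + 1), ψ₁ (T l y)) +
            b * ⨍ l in Metric.closedBall (0 : E) ((n : ℝ) + 1), ψ₂ (T l y) := by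
        simp only [setAverage_eq, smul_eq_mul]
        rw [integral_add, integral_const_mul, integral_const_mul]
        · ring
        · exact hi₁.const_mul a
        · exact hi₂.const_mul b
      rw [hadd]
      have : b = 1 - a := by linarith
      subst this
      ring
  have hmem : MemLp f 2 P := MemLp.of_bound hf.aestronglyMeasurable B
    (Eventually.of_forall fun y => by simpa using hB y)
  have hne : C.Nonempty :=
    ⟨hmem.toLp f, f, hf, ⟨B, hB⟩, hmem.coeFn_toLp, fun y => by simp⟩
  have hmaps : ∀ a : E, MapsTo (Lp.compMeasurePreserving (E := ℝ) (p := 2) (T a)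
      (hT.measurePreserving a)) C C := by
    rintro a w ⟨ψ, hm, ⟨B', hB'⟩, he, ht⟩
    refine ⟨ψ ∘ T a, hm.comp (hT.measurePreserving a).measurable, ⟨B', fun y => hB' _⟩, ?_, ?_⟩
    · exact (Lp.coeFn_compMeasurePreserving w (hT.measurePreserving a)).trans
        ((hT.measurePreserving a).quasiMeasurePreserving.ae_eq he)
    · intro y
      have h1 := tendsto_setAverage_sub_setAverage (hm.comp (hT.measurable_orbit y))
        (fun l => hB' (T l y)) a
      have h2 := h1.add (ht y)
      rw [add_zero] at h2
      refine h2.congr fun n => ?_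
      have h3 := setAverage_flow_closedBall (r := (n : ℝ) + 1) hT ψ a y
      have hcomm : ∀ l, T a (T l y) = T l (T a y) := fun l => by
        rw [← hT.map_add, ← hT.map_add, add_comm]
      simp only [Function.comp_apply] at *
      have h4 : ∀ l, ψ (T a (T l y)) = ψ (T l (T a y)) := fun l => by rw [hcomm]
      simp_rw [h4, h3]
      ring
  obtain ⟨v, hv, hfix⟩ := exists_mem_closure_forall_fixed hconv hne
    (fun a => (Lp.isometry_compMeasurePreserving (E := ℝ) (p := 2)
      (hT.measurePreserving a)).continuous)
    (fun a x => Lp.norm_compMeasurePreserving x (hT.measurePreserving a)) hmaps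
  refine ⟨v, (Lp.stronglyMeasurable v).measurable, fun a => ?_, fun δ hδ => ?_⟩
  · have := Lp.coeFn_compMeasurePreserving v (hT.measurePreserving a)
    rw [hfix a] at this
    exact this.symm
  · obtain ⟨w, ⟨ψ, hm, hb, he, ht⟩, hw⟩ := EMetric.mem_closure_iff.1 hv δ (pos_iff_ne_zero.2 hδ)
    refine ⟨ψ, hm, hb, ?_, ht⟩
    have h1 : ∫⁻ y, ‖ψ y - v y‖ₑ ∂P = eLpNorm (fun y => ψ y - v y) 1 P := by
      rw [eLpNorm_one_eq_lintegral_enorm]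
    rw [h1]
    refine (eLpNorm_le_eLpNorm_of_exponent_le one_le_two
      (hm.aestronglyMeasurable.sub (Lp.stronglyMeasurable v).aestronglyMeasurable)).trans ?_
    rw [edist_comm, Lp.edist_def] at hw
    refine le_trans (le_of_eq (eLpNorm_congr_ae ?_)) hw.le
    filter_upwards [he] with y hy
    simp [hy]

/-- Fubini exchanges the quantifiers. The exceptional null set of y no longer depends on the time,
and a null set of times is invisible in ball averages. -/
theorem ae_ae_flow_eq (hT : IsMeasurePreservingFlow T P) [SFinite P] {Z : Type*}
    [MeasurableSpace Z] [MeasurableEq Z] {g : Y → Z}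
    (hg : Measurable g) (hinv : ∀ a, g ∘ T a =ᵐ[P] g) : ∀ᵐ y ∂P, ∀ᵐ l : E, g (T l y) = g y := by
  have hm : MeasurableSet {p : Y × E | g (T p.2 p.1) = g p.1} :=
    measurableSet_eq_fun (hg.comp (hT.measurable.comp measurable_swap)) (hg.comp measurable_fst)
  rw [Measure.ae_ae_comm hm]
  exact Eventually.of_forall hinv

theorem ae_of_forall_measure_compl_le {s : Set Y} {c : ℝ≥0∞} (hc : c ≠ ∞)
    (h : ∀ δ : ℝ≥0∞, δ ≠ 0 → P sᶜ ≤ c * δ) : ∀ᵐ y ∂P, y ∈ s := by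
  rw [ae_iff]
  refine le_antisymm (ENNReal.le_of_forall_pos_le_add fun ε hε _ => ?_) zero_le
  rw [zero_add]
  have hc1 : c + 1 ≠ 0 := by simp
  refine (h (ε / (c + 1)) ?_).trans ?_
  · simpa using ⟨hε.ne', hc⟩
  · rw [← mul_div_assoc, mul_comm, mul_div_assoc]
    refine mul_le_of_le_one_right zero_le (ENNReal.div_le_of_le_mul ?_)
    rw [one_mul]
    exact le_self_add

/-! ### Pointwise ergodic theorem -/

/-- **Wiener's ergodic theorem** for bounded real functions. -/
theorem exists_tendsto_setAverage (hT : IsMeasurePreservingFlow T P) [IsProbabilityMeasure P]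
    {f : Y → ℝ} (hf : Measurable f) {B : ℝ} (hB : ∀ y, |f y| ≤ B) :
    ∃ g : Y → ℝ, Measurable g ∧ (∀ a, g ∘ T a =ᵐ[P] g) ∧ ∀ᵐ y ∂P,
      Tendsto (fun n : ℕ => ⨍ l in Metric.closedBall (0 : E) ((n : ℝ) + 1), f (T l y)) atTop
        (𝓝 (g y)) := by
  obtain ⟨g, hg, hinv, happ⟩ := exists_invariant_approx hT hf hB
  refine ⟨g, hg, hinv, ?_⟩
  have hFub := ae_ae_flow_eq hT hg hinv
  -- Since `g` is constant along almost every orbit, at almost every time, `g y` can be moved inside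
  -- the average.
  have hdiff : ∀ ψ : Y → ℝ, Measurable ψ → (∃ B', ∀ y, |ψ y| ≤ B') → ∀ᵐ y ∂P, ∀ n : ℕ,
      ‖(⨍ l in Metric.closedBall (0 : E) ((n : ℝ) + 1), ψ (T l y)) - g y‖ₑ ≤
        ballAverage T ((n : ℝ) + 1) (fun y => ‖ψ y - g y‖ₑ) y := by
    rintro ψ hm ⟨B', hB'⟩
    filter_upwards [hFub] with y hy n
    set s := Metric.closedBall (0 : E) ((n : ℝ) + 1) with hs
    have hn : (0 : ℝ) < n + 1 := by positivity
    have hv0 : volume s ≠ 0 := volume_closedBall_ne_zero' hn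
    have hvt : volume s ≠ ∞ := volume_closedBall_ne_top'
    have h1 : (⨍ l in s, ψ (T l y)) - g y = ⨍ l in s, (ψ (T l y) - g y) := by
      have hi : IntegrableOn (fun l => ψ (T l y)) s := integrableOn_closedBall_of_bounded (hm.comp (hT.measurable_orbit y))
        (fun l => hB' (T l y)) 0 ((n : ℝ) + 1)
      have hr : volume.real s ≠ 0 := (ENNReal.toReal_pos hv0 hvt).ne'
      rw [setAverage_eq, setAverage_eq, integral_sub hi (integrableOn_const hvt)]
      simp only [integral_const, smul_eq_mul, measureReal_restrict_apply_univ]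
      field_simp
    rw [h1, setAverage_eq, enorm_smul]
    unfold ballAverage
    gcongr
    · rw [Real.enorm_eq_ofReal (by positivity), measureReal_def, ENNReal.ofReal_inv_of_pos
        (ENNReal.toReal_pos hv0 hvt), ENNReal.ofReal_toReal hvt]
    · refine (enorm_integral_le_lintegral_enorm _).trans (le_of_eq ?_)
      refine lintegral_congr_ae (ae_restrict_of_ae ?_)
      filter_upwards [hy] with l hl
      rw [hl]
  -- Banach's principle: one 1/(m+1) pays for replacing the averages of `f` by those of ψ, the other
  -- for the maximal function of |ψ − g|. By the maximal inequality the latter exceeds its share on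
  -- a set of measure at most a constant times δ, with δ arbitrary.
  have hstep : ∀ m : ℕ, ∀ᵐ y ∂P, ∀ᶠ n : ℕ in atTop,
      |(⨍ l in Metric.closedBall (0 : E) ((n : ℝ) + 1), f (T l y)) - g y| ≤ 2 / ((m : ℝ) + 1) := by
    intro m
    set t : ℝ≥0∞ := ENNReal.ofReal (1 / ((m : ℝ) + 1))
    have ht0 : t ≠ 0 := by simp only [t, ne_eq, ENNReal.ofReal_eq_zero, not_le]; positivity
    have htt : t ≠ ∞ := ENNReal.ofReal_ne_top
    refine ae_of_forall_measure_compl_le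
      (c := t⁻¹ * ENNReal.ofReal (4 ^ Module.finrank ℝ E)) (by finiteness) fun δ hδ => ?_
    obtain ⟨ψ, hm, hb, hint, hlim⟩ := happ δ hδ
    have hme : Measurable fun y => ‖ψ y - g y‖ₑ := (hm.sub hg).enorm
    have hmax := mul_measure_exists_lt_ballAverage hT hme t
    have hle : P {y | ∀ᶠ n : ℕ in atTop, |(⨍ l in Metric.closedBall (0 : E) ((n : ℝ) + 1),
        f (T l y)) - g y| ≤ 2 / ((m : ℝ) + 1)}ᶜ ≤
        P {y | ∃ n : ℕ, t < ballAverage T ((n : ℝ) + 1) (fun y => ‖ψ y - g y‖ₑ) y} := by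
      refine measure_mono_ae ?_
      filter_upwards [hdiff ψ hm hb] with y hy hbad
      by_contra hnot
      refine hbad ?_
      change ¬ ∃ n : ℕ, t < ballAverage T ((n : ℝ) + 1) (fun y => ‖ψ y - g y‖ₑ) y at hnot
      push Not at hnot
      have hpos : (0 : ℝ) < 1 / ((m : ℝ) + 1) := by positivity
      have hev := (Metric.tendsto_nhds.1 (hlim y)) _ hpos
      change ∀ᶠ n : ℕ in atTop, _
      filter_upwards [hev] with n hn
      have h1 := (hy n).trans (hnot n)
      rw [Real.enorm_eq_ofReal_abs, ENNReal.ofReal_le_ofReal_iff hpos.le] at h1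
      rw [Real.dist_eq, sub_zero, abs_sub_comm] at hn
      calc _ ≤ _ := abs_sub_le _ (⨍ l in Metric.closedBall (0 : E) ((n : ℝ) + 1), ψ (T l y)) _
        _ ≤ _ := add_le_add hn.le h1
        _ = _ := by ring
    refine hle.trans ?_
    rw [mul_assoc, ← ENNReal.mul_le_iff_le_inv ht0 htt]
    refine hmax.trans ?_
    gcongr
  filter_upwards [ae_all_iff.2 hstep] with y hy
  rw [Metric.tendsto_nhds]
  intro ε hε
  obtain ⟨m, hm⟩ := exists_nat_one_div_lt (half_pos hε)
  filter_upwards [hy m] with n hn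
  rw [Real.dist_eq]
  refine hn.trans_lt ?_
  rw [show (2 : ℝ) / (m + 1) = 2 * (1 / (m + 1)) by ring]
  linarith

/-- **Wiener's ergodic theorem** for bounded nonnegative functions. -/
theorem exists_tendsto_ballAverage_of_bounded (hT : IsMeasurePreservingFlow T P)
    [IsProbabilityMeasure P] (hφ : Measurable φ) {N : ℝ≥0∞} (hNt : N ≠ ∞) (hN : ∀ y, φ y ≤ N) :
    ∃ g : Y → ℝ≥0∞, Measurable g ∧ (∀ a, g ∘ T a =ᵐ[P] g) ∧ ∀ᵐ y ∂P,
      Tendsto (fun n : ℕ => ballAverage T ((n : ℝ) + 1) φ y) atTop (𝓝 (g y)) := by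
  have hB : ∀ y, |(φ y).toReal| ≤ N.toReal := fun y => by
    rw [abs_of_nonneg ENNReal.toReal_nonneg]
    exact ENNReal.toReal_mono hNt (hN y)
  obtain ⟨g, hg, hinv, hlim⟩ := exists_tendsto_setAverage hT hφ.ennreal_toReal hB
  refine ⟨fun y => ENNReal.ofReal (g y), hg.ennreal_ofReal, fun a => ?_, ?_⟩
  · filter_upwards [hinv a] with y hy
    simp only [Function.comp_apply] at hy ⊢
    rw [hy]
  · filter_upwards [hlim] with y hy
    refine ((ENNReal.continuous_ofReal.tendsto _).comp hy).congr fun n => ?_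
    set s := Metric.closedBall (0 : E) ((n : ℝ) + 1) with hs
    have hn : (0 : ℝ) < n + 1 := by positivity
    have hv0 : volume s ≠ 0 := volume_closedBall_ne_zero' hn
    have hvt : volume s ≠ ∞ := volume_closedBall_ne_top'
    have hi : IntegrableOn (fun l => (φ (T l y)).toReal) s := integrableOn_closedBall_of_bounded
      (hφ.ennreal_toReal.comp (hT.measurable_orbit y)) (fun l => hB (T l y)) 0 ((n : ℝ) + 1)
    simp only [Function.comp_apply]
    rw [setAverage_eq, smul_eq_mul, ENNReal.ofReal_mul (by positivity),
      measureReal_def, ENNReal.ofReal_inv_of_pos (ENNReal.toReal_pos hv0 hvt),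
      ENNReal.ofReal_toReal hvt, ofReal_integral_eq_lintegral_ofReal hi
        (Eventually.of_forall fun l => ENNReal.toReal_nonneg)]
    unfold ballAverage
    congr 1
    refine lintegral_congr fun l => ?_
    rw [ENNReal.ofReal_toReal ((hN _).trans_lt hNt.lt_top).ne]

theorem lintegral_eq_of_tendsto_ballAverage (hT : IsMeasurePreservingFlow T P)
    [IsProbabilityMeasure P] (hφ : Measurable φ) {N : ℝ≥0∞} (hNt : N ≠ ∞) (hN : ∀ y, φ y ≤ N)
    {g : Y → ℝ≥0∞}
    (hlim : ∀ᵐ y ∂P, Tendsto (fun n : ℕ => ballAverage T ((n : ℝ) + 1) φ y) atTop (𝓝 (g y))) :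
    ∫⁻ y, g y ∂P = ∫⁻ y, φ y ∂P := by
  have h := tendsto_lintegral_of_dominated_convergence (μ := P) (fun _ => N)
    (fun n : ℕ => measurable_ballAverage (r := (n : ℝ) + 1) hT hφ)
    (fun n => Eventually.of_forall fun y => ?_) (by simpa using hNt) hlim
  · simp_rw [fun n : ℕ => lintegral_ballAverage hT hφ (by positivity : (0 : ℝ) < n + 1)] at h
    exact tendsto_nhds_unique h tendsto_const_nhds |>.symm ▸ rfl
  · unfold ballAverage
    have hn : (0 : ℝ) < n + 1 := by positivity
    calc _ ≤ (volume (Metric.closedBall (0 : E) ((n : ℝ) + 1)))⁻¹ *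
          ∫⁻ l in Metric.closedBall (0 : E) ((n : ℝ) + 1), N := by gcongr; exact hN _
      _ = N := by
        rw [setLIntegral_const, mul_comm N, ← mul_assoc, ENNReal.inv_mul_cancel
          (volume_closedBall_ne_zero' hn) volume_closedBall_ne_top', one_mul]

theorem ballAverage_congr_of_ae {y : Y} (h : ∀ᵐ l : E, φ (T l y) = ψ (T l y)) :
    ballAverage T r φ y = ballAverage T r ψ y := by
  unfold ballAverage
  rw [lintegral_congr_ae (ae_restrict_of_ae h)]

/-- **Wiener's ergodic theorem** for nonnegative, possibly non-integrable functions, along integer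
radii. -/
theorem exists_tendsto_ballAverage_nat (hT : IsMeasurePreservingFlow T P)
    [IsProbabilityMeasure P] (hφ : Measurable φ) :
    ∃ g : Y → ℝ≥0∞, Measurable g ∧ ∫⁻ y, g y ∂P = ∫⁻ y, φ y ∂P ∧ ∀ᵐ y ∂P,
      Tendsto (fun n : ℕ => ballAverage T ((n : ℝ) + 1) φ y) atTop (𝓝 (g y)) := by
  -- The candidate limit is the supremum of the limits for the truncations. It is at once a lower
  -- bound for the averages; only the upper bound has to be proved, and only where the supremum is
  -- finite.
  set φN : ℕ → Y → ℝ≥0∞ := fun N y => min (φ y) N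
  have hφN : ∀ N, Measurable (φN N) := fun N => hφ.min measurable_const
  have hφNle : ∀ N y, φN N y ≤ N := fun N y => min_le_right _ _
  have hφNmono : ∀ y, Monotone fun N => φN N y := fun y a b hab =>
    min_le_min le_rfl (by exact_mod_cast hab)
  have hφsup : ∀ y, ⨆ N, φN N y = φ y := fun y => by
    simp only [φN]
    rw [← inf_iSup_eq, ENNReal.iSup_natCast, inf_top_eq]
  choose gN hgN hginv hgtend using fun N : ℕ =>
    exists_tendsto_ballAverage_of_bounded hT (hφN N) (ENNReal.natCast_ne_top N) (hφNle N)
  set g : Y → ℝ≥0∞ := fun y => ⨆ N, gN N y with hg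
  have hgm : Measurable g := Measurable.iSup hgN
  have htend := ae_all_iff.2 hgtend
  have hgmono : ∀ᵐ y ∂P, Monotone fun N => gN N y := by
    filter_upwards [htend] with y hy a b hab
    exact le_of_tendsto_of_tendsto' (hy a) (hy b) fun n =>
      ballAverage_mono (fun y => hφNmono y hab) y
  have hinv : ∀ a, g ∘ T a =ᵐ[P] g := fun a => by
    filter_upwards [ae_all_iff.2 fun N => hginv N a] with y hy
    simp only [Function.comp_apply, hg] at hy ⊢
    simp_rw [hy]
  have hFub := ae_ae_flow_eq hT hgm hinv
  have hgint : ∫⁻ y, g y ∂P = ∫⁻ y, φ y ∂P := by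
    rw [hg, lintegral_iSup' (fun N => (hgN N).aemeasurable) hgmono]
    simp_rw [← hφsup]
    rw [lintegral_iSup hφN (fun a b hab y => hφNmono y hab)]
    exact iSup_congr fun N => lintegral_eq_of_tendsto_ballAverage hT (hφN N)
      (ENNReal.natCast_ne_top N) (hφNle N) (hgtend N)
  refine ⟨g, hgm, hgint, ?_⟩
  -- the upper bound on the invariant sets where the limit is bounded
  have hupper : ∀ M m : ℕ, ∀ᵐ y ∂P, g y ≤ M → ∀ᶠ n : ℕ in atTop,
      ballAverage T ((n : ℝ) + 1) φ y ≤ g y + 2 * (1 / ((m : ℝ≥0∞) + 1)) := by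
    intro M m
    set I : Set Y := {y | g y ≤ M} with hI
    have hIm : MeasurableSet I := measurableSet_le hgm measurable_const
    set t : ℝ≥0∞ := 1 / ((m : ℝ≥0∞) + 1) with ht
    have ht0 : t ≠ 0 := by
      rw [ht, one_div]
      exact ENNReal.inv_ne_zero.2 (by finiteness)
    have htt : t ≠ ∞ := by
      rw [ht, one_div]
      exact ENNReal.inv_ne_top.2 (by simp)
    have horb : ∀ᵐ y ∂P, ∀ᵐ l : E, T l y ∈ I ↔ y ∈ I := by
      filter_upwards [hFub] with y hy
      filter_upwards [hy] with l hl
      simp only [hI, mem_ofPred_eq, hl]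
    -- `I` is invariant along almost every orbit, so averages of `φN N` restricted to `I` converge
    -- to `gN N` restricted to `I`. Equality of integrals and monotone convergence then make φ
    -- integrable on `I`, although it need not be so on `Y`.
    have hIint : ∀ N, ∫⁻ y, I.indicator (gN N) y ∂P = ∫⁻ y, I.indicator (φN N) y ∂P := by
      intro N
      refine lintegral_eq_of_tendsto_ballAverage hT ((hφN N).indicator hIm)
        (ENNReal.natCast_ne_top N)
        (fun y => (indicator_le_self' (fun _ _ => zero_le) y).trans (hφNle N y)) ?_
      filter_upwards [hgtend N, horb] with y hy hor
      by_cases hyI : y ∈ I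
      · rw [indicator_of_mem hyI]
        refine hy.congr fun n => ballAverage_congr_of_ae ?_
        filter_upwards [hor] with l hl
        rw [indicator_of_mem (hl.2 hyI)]
      · rw [indicator_of_notMem hyI]
        refine tendsto_const_nhds.congr fun n => ?_
        rw [ballAverage_congr_of_ae (ψ := fun _ => 0)]
        · simp [ballAverage]
        · filter_upwards [hor] with l hl
          rw [indicator_of_notMem fun h => hyI (hl.1 h)]
    have hbound : ∫⁻ y, I.indicator φ y ∂P ≤ M := by
      have h1 : ∀ y, I.indicator φ y = ⨆ N, I.indicator (φN N) y := fun y => by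
        by_cases hy : y ∈ I
        · simp only [indicator_of_mem hy, hφsup]
        · simp [indicator_of_notMem hy]
      simp_rw [h1]
      rw [lintegral_iSup (fun N => (hφN N).indicator hIm)
        (fun a b hab => indicator_mono fun y => hφNmono y hab)]
      refine iSup_le fun N => ?_
      rw [← hIint]
      calc _ ≤ ∫⁻ y, (M : ℝ≥0∞) ∂P := by
            refine lintegral_mono fun y => ?_
            by_cases hy : y ∈ I
            · rw [indicator_of_mem hy]
              exact (le_iSup (fun N => gN N y) N).trans hy
            · rw [indicator_of_notMem hy]
              exact zero_le
        _ = M := by simp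
    have hlimint : Tendsto (fun N => ∫⁻ y, I.indicator (fun y => φ y - φN N y) y ∂P) atTop
        (𝓝 0) := by
      have hmeas : ∀ N, Measurable (I.indicator (fun y => φ y - φN N y)) := fun N =>
        (hφ.sub (hφN N)).indicator hIm
      have := tendsto_lintegral_of_dominated_convergence (μ := P) (f := fun _ => 0)
        (I.indicator φ) hmeas (fun N => Eventually.of_forall fun y => ?_)
        (hbound.trans_lt (ENNReal.natCast_lt_top M)).ne ?_
      · simpa using this
      · exact indicator_le_indicator tsub_le_self
      · filter_upwards [ae_lt_top (hφ.indicator hIm)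
          (hbound.trans_lt (ENNReal.natCast_lt_top M)).ne] with y hy
        by_cases hyI : y ∈ I
        · simp only [indicator_of_mem hyI] at hy ⊢
          refine tendsto_const_nhds.congr' ?_
          obtain ⟨N₀, hN₀⟩ := ENNReal.exists_nat_gt hy.ne
          filter_upwards [eventually_ge_atTop N₀] with N hN
          have : φN N y = φ y := min_eq_left (hN₀.le.trans (by exact_mod_cast hN))
          rw [this, tsub_self]
        · simp [indicator_of_notMem hyI]
    refine ae_of_forall_measure_compl_le
      (c := t⁻¹ * ENNReal.ofReal (4 ^ Module.finrank ℝ E)) (by finiteness) fun δ hδ => ?_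
    -- On `I` the excess of φ over its truncation has integral at most δ for large `N`, so the
    -- maximal inequality makes its averages at most t off a small set. The truncated part
    -- contributes at most g + t eventually, whence the 2t.
    obtain ⟨N, hN⟩ := (hlimint.eventually (ge_mem_nhds (pos_iff_ne_zero.2 hδ))).exists
    set ρ : Y → ℝ≥0∞ := I.indicator (fun y => φ y - φN N y) with hρ
    have hρm : Measurable ρ := (hφ.sub (hφN N)).indicator hIm
    have hmax := mul_measure_exists_lt_ballAverage hT hρm t
    refine le_trans (measure_mono_ae
      (t := {y | ∃ n : ℕ, t < ballAverage T ((n : ℝ) + 1) ρ y}) ?_) ?_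
    · filter_upwards [hgtend N, horb] with y hy hor hbad
      by_contra hnot
      refine hbad fun hyI => ?_
      change ¬ ∃ n : ℕ, t < ballAverage T ((n : ℝ) + 1) ρ y at hnot
      push Not at hnot
      have hle : gN N y ≤ g y := le_iSup (fun N => gN N y) N
      have hfin : gN N y ≠ ∞ := ((hle.trans hyI).trans_lt (ENNReal.natCast_lt_top M)).ne
      have hev : ∀ᶠ n : ℕ in atTop, ballAverage T ((n : ℝ) + 1) (φN N) y < gN N y + t :=
        hy.eventually (gt_mem_nhds (ENNReal.lt_add_right hfin ht0))
      filter_upwards [hev] with n hn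
      have hsplit : ballAverage T ((n : ℝ) + 1) φ y =
          ballAverage T ((n : ℝ) + 1) (φN N) y + ballAverage T ((n : ℝ) + 1) ρ y := by
        rw [← ballAverage_add hT (hφN N)]
        refine ballAverage_congr_of_ae ?_
        filter_upwards [hor] with l hl
        rw [hρ, indicator_of_mem (hl.2 hyI), add_tsub_cancel_of_le (min_le_left _ _)]
      rw [hsplit, two_mul, ← add_assoc]
      exact add_le_add (hn.le.trans (by gcongr)) (hnot n)
    · rw [mul_assoc, ← ENNReal.mul_le_iff_le_inv ht0 htt]
      refine hmax.trans ?_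
      gcongr
  filter_upwards [htend, ae_all_iff.2 fun M => ae_all_iff.2 fun m => hupper M m] with y hy hup
  refine tendsto_order.2 ⟨fun a ha => ?_, fun a ha => ?_⟩
  · obtain ⟨N, hN⟩ := lt_iSup_iff.1 ha
    filter_upwards [(hy N).eventually (lt_mem_nhds hN)] with n hn
    exact hn.trans_le (ballAverage_mono (fun y => min_le_left _ _) y)
  · have hfin : g y ≠ ∞ := ha.ne_top
    obtain ⟨M, hM⟩ := ENNReal.exists_nat_gt hfin
    have hlim : Tendsto (fun m : ℕ => g y + 2 * (1 / ((m : ℝ≥0∞) + 1))) atTop (𝓝 (g y)) := by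
      have h0 : Tendsto (fun m : ℕ => (1 / ((m : ℝ≥0∞) + 1))) atTop (𝓝 0) := by
        have := (tendsto_add_atTop_iff_nat 1).2 ENNReal.tendsto_inv_nat_nhds_zero
        simpa using this
      have := (ENNReal.Tendsto.const_mul h0 (Or.inr (ENNReal.ofNat_ne_top : (2 : ℝ≥0∞) ≠ ∞))).const_add (g y)
      simpa using this
    obtain ⟨m, hm⟩ := (hlim.eventually (gt_mem_nhds ha)).exists
    filter_upwards [hup M m hM.le] with n hn
    exact hn.trans_lt hm

/-- By positivity the integral over the smaller ball is the smaller one; only the normalizations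
differ. As the ratio of consecutive integer radii tends to 1, this extends convergence from integer
to real radii. -/
theorem ballAverage_le_of_le (hs : 0 < r) {R : ℝ} (hrR : r ≤ R) (y : Y) :
    ballAverage T r φ y ≤
      ENNReal.ofReal ((R / r) ^ Module.finrank ℝ E) * ballAverage T R φ y := by
  have hR : 0 < R := hs.trans_le hrR
  have hv : volume (Metric.closedBall (0 : E) R) =
      ENNReal.ofReal ((R / r) ^ Module.finrank ℝ E) * volume (Metric.closedBall (0 : E) r) := by
    rw [← Measure.addHaar_closedBall_mul_of_pos _ (0 : E) (by positivity)]
    congr 2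
    field_simp
  have hq0 : ENNReal.ofReal ((R / r) ^ Module.finrank ℝ E) ≠ 0 := by
    rw [ne_eq, ENNReal.ofReal_eq_zero, not_le]
    positivity
  unfold ballAverage
  rw [hv, ENNReal.mul_inv (Or.inl hq0) (Or.inl ENNReal.ofReal_ne_top), ← mul_assoc, ← mul_assoc,
    ENNReal.mul_inv_cancel hq0 ENNReal.ofReal_ne_top, one_mul]
  gcongr

/-- **Wiener's ergodic theorem** for nonnegative, possibly non-integrable functions. -/
theorem exists_tendsto_ballAverage (hT : IsMeasurePreservingFlow T P)
    [IsProbabilityMeasure P] (hφ : Measurable φ) :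
    ∃ g : Y → ℝ≥0∞, Measurable g ∧ ∫⁻ y, g y ∂P = ∫⁻ y, φ y ∂P ∧ ∀ᵐ y ∂P,
      Tendsto (fun R : ℝ => ballAverage T R φ y) atTop (𝓝 (g y)) := by
  obtain ⟨g, hg, hint, hlim⟩ := exists_tendsto_ballAverage_nat hT hφ
  refine ⟨g, hg, hint, ?_⟩
  set d := Module.finrank ℝ E
  have hq : Tendsto (fun n : ℕ => ENNReal.ofReal ((((n : ℝ) + 1 + 1) / (n + 1)) ^ d)) atTop
      (𝓝 1) := by
    rw [← ENNReal.ofReal_one]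
    refine (ENNReal.continuous_ofReal.tendsto _).comp ?_
    have h1 : Tendsto (fun n : ℕ => ((n : ℝ) + 1 + 1) / (n + 1)) atTop (𝓝 1) := by
      have := (tendsto_one_div_add_atTop_nhds_zero_nat (𝕜 := ℝ)).const_add 1
      rw [add_zero] at this
      refine this.congr fun n => ?_
      field_simp
    simpa using h1.pow d
  -- With n = ⌊R − 1⌋ one has n + 1 ≤ R < n + 2, and the known convergence is along the radii n + 1.
  have hfloor : Tendsto (fun R : ℝ => ⌊R - 1⌋₊) atTop atTop :=
    tendsto_nat_floor_atTop.comp (tendsto_atTop_add_const_right _ (-1) tendsto_id)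
  filter_upwards [hlim] with y hy
  have hup : Tendsto (fun n : ℕ => ENNReal.ofReal ((((n : ℝ) + 1 + 1) / (n + 1)) ^ d) *
      ballAverage T (((n + 1 : ℕ) : ℝ) + 1) φ y) atTop (𝓝 (g y)) := by
    have := ENNReal.Tendsto.mul hq (Or.inl one_ne_zero) ((tendsto_add_atTop_iff_nat 1).2 hy)
      (Or.inr ENNReal.one_ne_top)
    rwa [one_mul] at this
  have hlow : Tendsto (fun n : ℕ => (ENNReal.ofReal ((((n : ℝ) + 1 + 1) / (n + 1)) ^ d))⁻¹ *
      ballAverage T ((n : ℝ) + 1) φ y) atTop (𝓝 (g y)) := by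
    have := ENNReal.Tendsto.mul (tendsto_inv_iff.2 hq) (by simp) hy (by simp)
    rwa [inv_one, one_mul] at this
  have hmono : ∀ {a b : ℝ} (n : ℕ), (n : ℝ) + 1 ≤ a → a ≤ b → b ≤ n + 1 + 1 →
      ballAverage T a φ y ≤ ENNReal.ofReal ((((n : ℝ) + 1 + 1) / (n + 1)) ^ d) *
        ballAverage T b φ y := by
    intro a b n ha hab hb
    have hn : (0 : ℝ) < n + 1 := by positivity
    have ha0 : 0 < a := hn.trans_le ha
    refine (ballAverage_le_of_le ha0 hab y).trans ?_
    have hb0 : 0 < b := ha0.trans_le hab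
    gcongr
  refine tendsto_of_tendsto_of_tendsto_of_le_of_le' (hlow.comp hfloor) (hup.comp hfloor) ?_ ?_
  · filter_upwards [eventually_ge_atTop 1] with R hR
    have h1 := Nat.floor_le (sub_nonneg.2 hR)
    have h2 := Nat.lt_floor_add_one (R - 1)
    have hpos : ENNReal.ofReal ((((⌊R - 1⌋₊ : ℝ) + 1 + 1) / (⌊R - 1⌋₊ + 1)) ^ d) ≠ 0 := by
      rw [ne_eq, ENNReal.ofReal_eq_zero, not_le]
      positivity
    rw [Function.comp_apply, mul_comm, ← div_eq_mul_inv]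
    refine ENNReal.div_le_of_le_mul ?_
    rw [mul_comm]
    exact hmono _ le_rfl (by linarith) (by linarith)
  · filter_upwards [eventually_ge_atTop 1] with R hR
    have h1 := Nat.floor_le (sub_nonneg.2 hR)
    have h2 := Nat.lt_floor_add_one (R - 1)
    simp only [Function.comp_apply]
    push_cast
    exact hmono _ (by linarith) (by linarith) le_rfl

end Flow

/-! ### The stereographic projection -/

/-- The one computation behind both uses of the sphere: its logarithm transports the energy, and its
infinitesimal form gives the conformal factor of the projection. -/
theorem norm_stereoVec_sub_sq (x y : Plane) :
    ‖stereoVec x - stereoVec y‖ ^ 2 = ‖x - y‖ ^ 2 / ((1 + ‖x‖ ^ 2) * (1 + ‖y‖ ^ 2)) := by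
  have hn : ∀ z : Plane, ‖z‖ ^ 2 = z 0 ^ 2 + z 1 ^ 2 := fun z => by
    rw [EuclideanSpace.norm_sq_eq]; simp [Fin.sum_univ_two]
  have hx : (1 + (x 0 ^ 2 + x 1 ^ 2)) ≠ 0 := by positivity
  have hy : (1 + (y 0 ^ 2 + y 1 ^ 2)) ≠ 0 := by positivity
  rw [EuclideanSpace.norm_sq_eq]
  simp only [Fin.sum_univ_three, stereoVec, Real.norm_eq_abs, sq_abs, hn, PiLp.sub_apply,
    Matrix.cons_val_zero, Matrix.cons_val_one, Matrix.cons_val]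
  field_simp
  ring

theorem norm_stereoVec_sub (x y : Plane) :
    ‖stereoVec x - stereoVec y‖ =
      ‖x - y‖ / (Real.sqrt (1 + ‖x‖ ^ 2) * Real.sqrt (1 + ‖y‖ ^ 2)) := by
  rw [← Real.sqrt_sq (norm_nonneg (stereoVec x - stereoVec y)), norm_stereoVec_sub_sq,
    Real.sqrt_div (by positivity), Real.sqrt_sq (norm_nonneg _), Real.sqrt_mul (by positivity)]

theorem contDiff_stereoVec : ContDiff ℝ 1 stereoVec := by
  rw [contDiff_euclidean]
  have hx : ∀ x : Plane, 1 + ‖x‖ ^ 2 ≠ 0 := fun x => by positivity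
  have hd : ContDiff ℝ 1 fun x : Plane => 1 + ‖x‖ ^ 2 := contDiff_const.add (contDiff_norm_sq ℝ)
  have hc : ∀ i : Fin 2, ContDiff ℝ 1 fun x : Plane => x i := fun i => by fun_prop
  intro i
  fin_cases i
  · exact (hc 0).div hd hx
  · exact (hc 1).div hd hx
  · exact (contDiff_norm_sq ℝ).div hd hx

theorem continuous_stereo : Continuous stereo :=
  Continuous.subtype_mk contDiff_stereoVec.continuous _

theorem measurableEmbedding_stereo : MeasurableEmbedding stereo :=
  continuous_stereo.measurableEmbedding stereo_injective

theorem differentiableAt_stereoVec (x : Plane) : DifferentiableAt ℝ stereoVec x :=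
  contDiff_stereoVec.differentiable one_ne_zero x

/-- Obtained by letting t → 0 in the chordal distance between the images of x + tv and x.
Polarization then gives the inner products, and with them the area element. -/
theorem norm_fderiv_stereoVec (x v : Plane) :
    ‖fderiv ℝ stereoVec x v‖ = ‖v‖ / (1 + ‖x‖ ^ 2) := by
  have h1 : HasDerivAt (fun t : ℝ => stereoVec (x + t • v)) (fderiv ℝ stereoVec x v) 0 := by
    have hl : HasDerivAt (fun t : ℝ => x + t • v) v 0 := by
      simpa using ((hasDerivAt_id (0 : ℝ)).smul_const v).const_add x
    have hf : HasFDerivAt stereoVec (fderiv ℝ stereoVec x) (x + (0 : ℝ) • v) := by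
      simpa using (differentiableAt_stereoVec x).hasFDerivAt
    exact hf.comp_hasDerivAt (0 : ℝ) hl
  have h2 := h1.tendsto_slope_zero.norm
  have h3 : Tendsto (fun t : ℝ => ‖v‖ / (Real.sqrt (1 + ‖x + t • v‖ ^ 2) *
      Real.sqrt (1 + ‖x‖ ^ 2))) (𝓝[≠] 0) (𝓝 (‖v‖ / (1 + ‖x‖ ^ 2))) := by
    have hcont : Continuous fun t : ℝ => ‖v‖ / (Real.sqrt (1 + ‖x + t • v‖ ^ 2) *
        Real.sqrt (1 + ‖x‖ ^ 2)) := by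
      refine continuous_const.div (by fun_prop) fun t => ?_
      positivity
    have := (hcont.tendsto 0).mono_left (nhdsWithin_le_nhds (s := {0}ᶜ))
    simpa [Real.mul_self_sqrt (by positivity : (0 : ℝ) ≤ 1 + ‖x‖ ^ 2)] using this
  refine tendsto_nhds_unique h2 (h3.congr' ?_)
  filter_upwards [self_mem_nhdsWithin] with t ht
  have ht' : |t| ≠ 0 := abs_ne_zero.2 ht
  simp only [zero_add, zero_smul, add_zero]
  rw [norm_smul, norm_stereoVec_sub, add_sub_cancel_left, norm_smul, norm_inv, Real.norm_eq_abs]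
  field_simp

theorem inner_fderiv_stereoVec (x v w : Plane) :
    inner ℝ (fderiv ℝ stereoVec x v) (fderiv ℝ stereoVec x w) =
      inner ℝ v w / (1 + ‖x‖ ^ 2) ^ 2 := by
  rw [real_inner_eq_norm_add_mul_self_sub_norm_mul_self_sub_norm_mul_self_div_two, ← map_add,
    norm_fderiv_stereoVec, norm_fderiv_stereoVec, norm_fderiv_stereoVec,
    real_inner_eq_norm_add_mul_self_sub_norm_mul_self_sub_norm_mul_self_div_two v w]
  field_simp

theorem sqrt_det_fderiv_stereoVec (x : Plane) :
    Real.sqrt (((fderiv ℝ stereoVec x).adjoint ∘L (fderiv ℝ stereoVec x)).det) =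
      1 / (1 + ‖x‖ ^ 2) ^ 2 := by
  have h : (fderiv ℝ stereoVec x).adjoint ∘L (fderiv ℝ stereoVec x) =
      (1 / (1 + ‖x‖ ^ 2) ^ 2 : ℝ) • ContinuousLinearMap.id ℝ Plane := by
    ext1 v
    refine ext_inner_right ℝ fun w => ?_
    rw [ContinuousLinearMap.comp_apply, ContinuousLinearMap.adjoint_inner_left,
      inner_fderiv_stereoVec]
    simp [real_inner_smul_left, div_eq_inv_mul]
  rw [h, ContinuousLinearMap.det, ContinuousLinearMap.toLinearMap_smul, LinearMap.det_smul]
  simp only [finrank_euclideanSpace, Fintype.card_fin]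
  rw [show ((ContinuousLinearMap.id ℝ Plane : Plane →L[ℝ] Plane) : Plane →ₗ[ℝ] Plane) =
    LinearMap.id from rfl, LinearMap.det_id, mul_one, Real.sqrt_sq (by positivity)]

/-- The differential maps into the tangent plane because |T − centre|² is constant, and it is
injective because it is conformal. Both spaces have dimension 2, so every tangent vector is
attained. -/
theorem exists_fderiv_stereoVec_eq (x : Plane) {v : Space3}
    (hv : inner ℝ v (stereoVec x - sphereCenter) = 0) :
    ∃ w, fderiv ℝ stereoVec x w = v := by
  set L : Plane →ₗ[ℝ] Space3 := (fderiv ℝ stereoVec x).toLinearMap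
  set q := stereoVec x - sphereCenter with hq
  have hq0 : q ≠ 0 := by
    have := stereoVec_mem x
    rw [mem_sphere_iff_norm] at this
    rw [← norm_ne_zero_iff, hq, this]
    norm_num
  have hle : LinearMap.range L ≤ (ℝ ∙ q)ᗮ := by
    rintro _ ⟨w, rfl⟩
    rw [Submodule.mem_orthogonal_singleton_iff_inner_right]
    have h1 : HasFDerivAt (fun y => stereoVec y - sphereCenter) (fderiv ℝ stereoVec x) x :=
      (differentiableAt_stereoVec x).hasFDerivAt.sub_const _
    have h2 := (h1.norm_sq)
    have h3 : (fun y => ‖stereoVec y - sphereCenter‖ ^ 2) = fun _ => (1 / 2 : ℝ) ^ 2 := by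
      ext y
      have := stereoVec_mem y
      rw [mem_sphere_iff_norm] at this
      rw [this]
    rw [h3] at h2
    have h4 := h2.unique (hasFDerivAt_const _ _)
    have h5 := congrArg (fun A : Plane →L[ℝ] ℝ => A w) h4
    have h6 : 2 * inner ℝ q (L w) = (0 : ℝ) := by simpa [inner_sub_left, hq, L] using h5
    linarith
  have hinj : Function.Injective L := by
    rw [← LinearMap.ker_eq_bot, LinearMap.ker_eq_bot']
    intro w hw
    have h1 := norm_fderiv_stereoVec x w
    have h2 : fderiv ℝ stereoVec x w = 0 := hw
    rw [h2, norm_zero, eq_comm, div_eq_zero_iff] at h1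
    rcases h1 with h1 | h1
    · exact norm_eq_zero.1 h1
    · exact absurd h1 (by positivity)
  have hfact : Fact (Module.finrank ℝ Space3 = 2 + 1) := ⟨finrank_euclideanSpace_fin⟩
  have heq : LinearMap.range L = (ℝ ∙ q)ᗮ := by
    refine Submodule.eq_of_le_of_finrank_eq hle ?_
    rw [LinearMap.finrank_range_of_inj hinj, Submodule.finrank_orthogonal_span_singleton (n := 2) hq0]
    simp
  have hmem : v ∈ LinearMap.range L := by
    rw [heq, Submodule.mem_orthogonal_singleton_iff_inner_left]
    exact hv
  exact hmem

/-- A regular level set is locally of measure zero. -/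
theorem exists_mem_nhds_volume_inter_zero_eq_zero {F : Type*} [NormedAddCommGroup F]
    [NormedSpace ℝ F] [FiniteDimensional ℝ F] [MeasureSpace F] [BorelSpace F]
    [(volume : Measure F).IsAddHaarMeasure] {g : F → ℝ} (hg : ContDiff ℝ 1 g) {x v : F}
    (hv : fderiv ℝ g x v ≠ 0) : ∃ O ∈ 𝓝 x, volume (O ∩ {y | g y = 0}) = 0 := by
  have hcomplete : CompleteSpace F := FiniteDimensional.complete ℝ F
  set ℓ := fderiv ℝ g x with hℓ
  set w := (ℓ v)⁻¹ • v with hw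
  have hlw : ℓ w = 1 := by rw [hw, map_smul, smul_eq_mul, inv_mul_cancel₀ hv]
  -- As ℓ(w) = 1, this map satisfies ℓ ∘ Φ = g and has the identity as differential at x. It
  -- straightens the zero set of g into the null hyperplane ker ℓ, and its differentiable local
  -- inverse preserves null sets.
  set Φ : F → F := fun y => y + (g y - ℓ y) • w with hΦ
  have hΦc : ContDiff ℝ 1 Φ := contDiff_id.add ((hg.sub ℓ.contDiff).smul contDiff_const)
  have hΦd : HasFDerivAt Φ ((ContinuousLinearEquiv.refl ℝ F : F ≃L[ℝ] F) : F →L[ℝ] F) x := by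
    have h1 : HasFDerivAt g ℓ x := (hg.differentiable one_ne_zero x).hasFDerivAt
    have h2 := (hasFDerivAt_id x).add ((h1.sub ℓ.hasFDerivAt).smul_const w)
    refine h2.congr_fderiv ?_
    ext z
    simp
  have hstrict : HasStrictFDerivAt Φ
      ((ContinuousLinearEquiv.refl ℝ F : F ≃L[ℝ] F) : F →L[ℝ] F) x :=
    hΦc.contDiffAt.hasStrictFDerivAt' hΦd one_ne_zero
  set e := hstrict.toOpenPartialHomeomorph Φ with he
  have hxs : x ∈ e.source := hstrict.mem_toOpenPartialHomeomorph_source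
  have hcoe : ∀ y, e y = Φ y := fun y => rfl
  have hinv : ContDiffAt ℝ 1 e.symm (e x) := by
    refine e.contDiffAt_symm (f₀' := ContinuousLinearEquiv.refl ℝ F) (e.map_source hxs) ?_ ?_
    · rw [e.left_inv hxs]; exact hΦd
    · rw [e.left_inv hxs]; exact hΦc.contDiffAt
  have hev : ∀ᶠ z in 𝓝 (e x), DifferentiableAt ℝ e.symm z :=
    (hinv.eventually (by simp)).mono fun z hz => hz.differentiableAt one_ne_zero
  have hev' : ∀ᶠ y in 𝓝 x, DifferentiableAt ℝ e.symm (e y) :=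
    (e.continuousAt hxs).eventually hev
  refine ⟨{y | y ∈ e.source ∧ DifferentiableAt ℝ e.symm (e y)},
    (e.open_source.mem_nhds hxs |> eventually_mem_set.2).and hev', ?_⟩
  set K : Set F := (LinearMap.ker (ℓ : F →ₗ[ℝ] ℝ) : Set F)
  have hK : volume K = 0 := by
    refine Measure.addHaar_submodule _ _ fun h => ?_
    have : w ∈ LinearMap.ker (ℓ : F →ₗ[ℝ] ℝ) := h ▸ Submodule.mem_top
    rw [LinearMap.mem_ker] at this
    exact one_ne_zero (hlw.symm.trans this)
  set s : Set F := K ∩ {z | DifferentiableAt ℝ e.symm z}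
  have hs : volume (e.symm '' s) = 0 :=
    addHaar_image_eq_zero_of_differentiableOn_of_addHaar_eq_zero _
      (fun z hz => hz.2.differentiableWithinAt) (measure_mono_null inter_subset_left hK)
  refine measure_mono_null ?_ hs
  rintro y ⟨⟨hys, hyd⟩, hy0⟩
  refine ⟨e y, ⟨?_, hyd⟩, e.left_inv hys⟩
  change ℓ (Φ y) = 0
  simp only [hΦ, map_add, map_smul, hlw, smul_eq_mul]
  rw [show g y = 0 from hy0]
  ring

/-- The tangent vector along which the defining function has nonzero derivative lifts to the plane.
The preimage is therefore locally contained in a regular level set, and locally null sets are null.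
-/
theorem volume_preimage_frontier_eq_zero {S : Set StereoSphere} (hS : HasC1Boundary S) :
    volume (stereo ⁻¹' frontier S) = 0 := by
  refine measure_null_of_locally_null _ fun x hx => ?_
  obtain ⟨U, ρ, v, hU, hpU, hρ, hv, hne, hiff⟩ := hS _ hx
  obtain ⟨w, hw⟩ := exists_fderiv_stereoVec_eq x hv
  have hd : fderiv ℝ (ρ ∘ stereoVec) x w ≠ 0 := by
    rw [fderiv_comp x (hρ.differentiable one_ne_zero _) (differentiableAt_stereoVec x),
      ContinuousLinearMap.comp_apply, hw]
    exact hne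
  obtain ⟨O, hO, h0⟩ := exists_mem_nhds_volume_inter_zero_eq_zero (hρ.comp contDiff_stereoVec) hd
  refine ⟨stereo ⁻¹' frontier S ∩ (O ∩ stereoVec ⁻¹' U), ?_, measure_mono_null ?_ h0⟩
  · exact inter_mem_nhdsWithin _ (inter_mem hO
      (contDiff_stereoVec.continuous.continuousAt.preimage_mem_nhds (hU.mem_nhds hpU)))
  · rintro y ⟨hyf, hyO, hyU⟩
    exact ⟨hyO, (hiff (stereo y) hyU).1 hyf⟩

/-! ### Equilibrium measures in the plane and on the sphere -/

theorem spherePotential_stereo (V : Plane → ℝ) (x : Plane) :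
    spherePotential V (stereo x) = reducedPotential V x :=
  stereo_injective.extend_apply _ _ x

theorem ENNReal.log_edist_of_ne {M : Type*} [MetricSpace M] {x y : M} (h : x ≠ y) :
    ENNReal.log (edist x y) = (Real.log (dist x y) : EReal) := by
  rw [edist_dist, ENNReal.log_ofReal_of_pos (dist_pos.2 h)]

/-- The factors √(1 + |x|²) and √(1 + |y|²) of the chordal distance contribute exactly the terms ½
log(1 + |·|²) subtracted from the potential. On the diagonal both sides are +∞. -/
theorem energy_integrand_stereo (V : Plane → ℝ) (x y : Plane) :
    spherePotential V (stereo x) / 2 + spherePotential V (stereo y) / 2 -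
        ENNReal.log (edist (stereo x) (stereo y)) =
      (V x : EReal) / 2 + (V y : EReal) / 2 - ENNReal.log (edist x y) := by
  have h2 : (2 : EReal) = ((2 : ℝ) : EReal) := rfl
  rw [spherePotential_stereo, spherePotential_stereo]
  unfold reducedPotential
  rw [h2]
  simp only [← EReal.coe_div, ← EReal.coe_add]
  by_cases hxy : x = y
  · subst hxy
    rw [edist_self, edist_self, ENNReal.log_zero, EReal.sub_bot (EReal.coe_ne_bot _),
      EReal.sub_bot (EReal.coe_ne_bot _)]
  · rw [ENNReal.log_edist_of_ne hxy, ENNReal.log_edist_of_ne (stereo_injective.ne hxy)]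
    have hd : dist (stereo x) (stereo y) =
        dist x y / (Real.sqrt (1 + ‖x‖ ^ 2) * Real.sqrt (1 + ‖y‖ ^ 2)) := by
      rw [Subtype.dist_eq, dist_eq_norm, dist_eq_norm]
      exact norm_stereoVec_sub x y
    have hx : 0 < Real.sqrt (1 + ‖x‖ ^ 2) := Real.sqrt_pos.2 (by positivity)
    have hy : 0 < Real.sqrt (1 + ‖y‖ ^ 2) := Real.sqrt_pos.2 (by positivity)
    rw [hd, Real.log_div (dist_pos.2 hxy).ne' (by positivity), Real.log_mul hx.ne' hy.ne',
      Real.log_sqrt (by positivity), Real.log_sqrt (by positivity)]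
    norm_cast
    ring

theorem eintegral_map_of_measurableEmbedding {α β : Type*} [MeasurableSpace α]
    [MeasurableSpace β] {φ : α → β} (hφ : MeasurableEmbedding φ) (μ : Measure α) (g : β → EReal) :
    eintegral (μ.map φ) g = eintegral μ (fun a => g (φ a)) := by
  unfold eintegral
  rw [hφ.lintegral_map, hφ.lintegral_map]

theorem logEnergy_map_stereo (V : Plane → ℝ) (μ : ProbabilityMeasure Plane)
    (ν : ProbabilityMeasure StereoSphere) (h : (ν : Measure StereoSphere) = (μ : Measure Plane).map
      stereo) : logEnergy (spherePotential V) ν = logEnergy (fun x => (V x : EReal)) μ := by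
  unfold logEnergy
  rw [h, Measure.map_prod_map _ _ continuous_stereo.measurable continuous_stereo.measurable,
    eintegral_map_of_measurableEmbedding
      (measurableEmbedding_stereo.prodMap measurableEmbedding_stereo)]
  congr 1
  ext p
  exact energy_integrand_stereo V p.1 p.2

theorem exists_forall_le_reducedPotential {V : Plane → ℝ} (hV : Continuous V)
    (hg : ⊥ < liminf (reducedPotential V) (cocompact Plane)) :
    ∃ a : ℝ, (∀ x, (a : EReal) ≤ reducedPotential V x) ∧
      (a : EReal) ≤ liminf (reducedPotential V) (cocompact Plane) := by
  obtain ⟨b, hb0, hb⟩ := EReal.lt_iff_exists_real_btwn.1 hg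
  have hev := eventually_lt_of_lt_liminf hb
  obtain ⟨K, hK, hKs⟩ := mem_cocompact.1 hev
  have hcont : Continuous fun x : Plane => V x - Real.log (1 + ‖x‖ ^ 2) := by
    refine hV.sub (Continuous.log (by fun_prop) fun x => ?_)
    positivity
  obtain ⟨c, hc⟩ := (hK.image hcont).bddBelow
  refine ⟨min b c, fun x => ?_, ?_⟩
  · by_cases hx : x ∈ K
    · have : c ≤ V x - Real.log (1 + ‖x‖ ^ 2) := hc (mem_image_of_mem _ hx)
      exact EReal.coe_le_coe_iff.2 ((min_le_right _ _).trans this)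
    · exact (EReal.coe_le_coe_iff.2 (min_le_left _ _)).trans (hKs hx).le
  · exact (EReal.coe_le_coe_iff.2 (min_le_left _ _)).trans hb.le

theorem le_spherePotential {V : Plane → ℝ} {a : ℝ} (h1 : ∀ x, (a : EReal) ≤ reducedPotential V x)
    (h2 : (a : EReal) ≤ liminf (reducedPotential V) (cocompact Plane)) (p : StereoSphere) :
    (a : EReal) ≤ spherePotential V p := by
  by_cases hp : ∃ x, stereo x = p
  · obtain ⟨x, rfl⟩ := hp
    rw [spherePotential_stereo]
    exact h1 x
  · unfold spherePotential
    rwa [Function.extend_apply' _ _ _ hp]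

theorem exists_compl_range_stereo_subset : ∃ N : StereoSphere, (range stereo)ᶜ ⊆ {N} := by
  have hN : (!₂[0, 0, 1] : Space3) ∈ Metric.sphere sphereCenter (1 / 2 : ℝ) := by
    rw [mem_sphere_iff_norm, ← sq_eq_sq₀ (norm_nonneg _) (by norm_num), EuclideanSpace.norm_sq_eq]
    simp only [Fin.sum_univ_three, sphereCenter, Real.norm_eq_abs, sq_abs, PiLp.sub_apply,
      Matrix.cons_val_zero, Matrix.cons_val_one, Matrix.cons_val]
    norm_num
  refine ⟨⟨_, hN⟩, fun p hp => ?_⟩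
  obtain ⟨p, hps⟩ := p
  have h : p 0 ^ 2 + p 1 ^ 2 + (p 2 - 1 / 2) ^ 2 = (1 / 2) ^ 2 := by
    have h1 := hps
    rw [mem_sphere_iff_norm, ← sq_eq_sq₀ (norm_nonneg _) (by norm_num),
      EuclideanSpace.norm_sq_eq] at h1
    simpa only [Fin.sum_univ_three, sphereCenter, Real.norm_eq_abs, sq_abs, PiLp.sub_apply,
      Matrix.cons_val_zero, Matrix.cons_val_one, Matrix.cons_val, sub_zero] using h1
  by_contra hne
  have hp2 : p 2 ≠ 1 := by
    intro h2
    refine hne ?_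
    rw [h2] at h
    have h0 : p 0 = 0 := by nlinarith [sq_nonneg (p 0), sq_nonneg (p 1)]
    have h1 : p 1 = 0 := by nlinarith [sq_nonneg (p 0), sq_nonneg (p 1)]
    rw [mem_singleton_iff, Subtype.mk.injEq]
    ext i
    fin_cases i <;> simp [h0, h1, h2]
  -- The stereographic projection itself, from the pole. The equation of the sphere gives its
  -- squared norm p₂/(1 − p₂).
  refine hp ⟨!₂[p 0 / (1 - p 2), p 1 / (1 - p 2)], ?_⟩
  have hd : 1 - p 2 ≠ 0 := sub_ne_zero.2 hp2.symm
  have hn : ‖(!₂[p 0 / (1 - p 2), p 1 / (1 - p 2)] : Plane)‖ ^ 2 = p 2 / (1 - p 2) := by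
    rw [EuclideanSpace.norm_sq_eq]
    simp only [Fin.sum_univ_two, Real.norm_eq_abs, sq_abs, Matrix.cons_val_zero,
      Matrix.cons_val_one]
    field_simp
    linarith
  have hs : 1 + p 2 / (1 - p 2) = 1 / (1 - p 2) := by
    field_simp
    ring
  refine Subtype.ext ?_
  change stereoVec _ = p
  unfold stereoVec
  rw [hn, hs]
  ext i
  fin_cases i <;> simp [hd]

/-- An atom gives the diagonal point (N, N) positive mass, where the integrand is +∞. Elsewhere
nothing can compensate: the sphere has diameter 1, so −log of the distance is nonnegative and the
integrand is bounded below. -/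
theorem logEnergy_spherePotential_eq_top {V : Plane → ℝ} (hV : Continuous V)
    (hg : ⊥ < liminf (reducedPotential V) (cocompact Plane))
    {ν : ProbabilityMeasure StereoSphere} {N : StereoSphere}
    (hN : (ν : Measure StereoSphere) {N} ≠ 0) : logEnergy (spherePotential V) ν = ⊤ := by
  obtain ⟨a, h1, h2⟩ := exists_forall_le_reducedPotential hV hg
  have hW := le_spherePotential h1 h2
  set g : StereoSphere × StereoSphere → EReal := fun p => spherePotential V p.1 / 2 +
    spherePotential V p.2 / 2 - ENNReal.log (edist p.1 p.2) with hgdef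
  have htwo : (2 : EReal) = ((2 : ℝ) : EReal) := rfl
  have hhalf : ∀ p, ((a / 2 : ℝ) : EReal) ≤ spherePotential V p / 2 := fun p => by
    rw [EReal.coe_div, ← htwo]
    exact EReal.div_le_div_right_of_nonneg (by norm_num) (hW p)
  have hge : ∀ p, (a : EReal) ≤ g p := by
    intro p
    have hlog : ENNReal.log (edist p.1 p.2) ≤ 0 := by
      rw [ENNReal.log_le_zero_iff, edist_dist, ENNReal.ofReal_le_one, Subtype.dist_eq]
      refine (dist_triangle_right _ _ sphereCenter).trans ?_
      rw [Metric.mem_sphere.1 p.1.2, Metric.mem_sphere.1 p.2.2]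
      norm_num
    have h3 : (a : EReal) = ((a / 2 : ℝ) : EReal) + ((a / 2 : ℝ) : EReal) := by
      rw [← EReal.coe_add]; norm_num
    calc (a : EReal) = a - 0 := by simp
      _ ≤ g p := EReal.sub_le_sub (h3 ▸ add_le_add (hhalf _) (hhalf _)) hlog
  have hNN : g (N, N) = ⊤ := by
    simp only [hgdef, edist_self, ENNReal.log_zero]
    refine EReal.sub_bot ?_
    have : (⊥ : EReal) < spherePotential V N / 2 := (EReal.bot_lt_coe _).trans_le (hhalf N)
    exact (EReal.bot_lt_add_iff.2 ⟨this, this⟩).ne'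
  have hpos : ∫⁻ p, (g p).toENNReal ∂((ν : Measure StereoSphere).prod ν) = ⊤ := by
    refine top_unique ?_
    calc (⊤ : ENNReal) = ⊤ * ((ν : Measure StereoSphere).prod ν) {(N, N)} := by
          rw [← singleton_prod_singleton, Measure.prod_prod, ENNReal.top_mul (mul_ne_zero hN hN)]
      _ = ∫⁻ p in {(N, N)}, (g p).toENNReal ∂((ν : Measure StereoSphere).prod ν) := by
          rw [lintegral_singleton, hNN, EReal.toENNReal_top]
      _ ≤ _ := setLIntegral_le_lintegral _ _
  have hneg : ∫⁻ p, (-g p).toENNReal ∂((ν : Measure StereoSphere).prod ν) ≠ ⊤ := by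
    have : ∫⁻ p, (-g p).toENNReal ∂((ν : Measure StereoSphere).prod ν) ≤ ENNReal.ofReal (-a) := by
      calc _ ≤ ∫⁻ _, ENNReal.ofReal (-a) ∂((ν : Measure StereoSphere).prod ν) := by
            refine lintegral_mono fun p => ?_
            have hcoe : ((-a : ℝ) : EReal).toENNReal = ENNReal.ofReal (-a) := by
              rw [EReal.toENNReal_of_ne_top (EReal.coe_ne_top _), EReal.toReal_coe]
            rw [← hcoe]
            refine EReal.toENNReal_le_toENNReal ?_
            rw [EReal.coe_neg, EReal.neg_le_neg_iff]
            exact hge p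
        _ = _ := by simp
    exact (this.trans_lt ENNReal.ofReal_lt_top).ne
  unfold logEnergy eintegral
  change ((∫⁻ p, (g p).toENNReal ∂((ν : Measure StereoSphere).prod ν) : ENNReal) : EReal) -
    ((∫⁻ p, (-g p).toENNReal ∂((ν : Measure StereoSphere).prod ν) : ENNReal) : EReal) = ⊤
  rw [hpos, EReal.coe_ennreal_top]
  lift (∫⁻ p, (-g p).toENNReal ∂((ν : Measure StereoSphere).prod ν)) to NNReal using hneg with c
  rfl

/-- The image of an equilibrium measure under the inverse stereographic projection is an
equilibrium measure on the sphere. -/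
theorem IsEquilibriumMeasure.map_stereo {V : Plane → ℝ} (hV : Continuous V)
    (hg : ⊥ < liminf (reducedPotential V) (cocompact Plane)) {μ : ProbabilityMeasure Plane}
    (hμ : IsEquilibriumMeasure (fun x => (V x : EReal)) μ) :
    IsEquilibriumMeasure (spherePotential V)
      (μ.map (f := stereo) continuous_stereo.measurable.aemeasurable) := by
  intro ν
  rw [logEnergy_map_stereo V μ _ rfl]
  obtain ⟨N, hN⟩ := exists_compl_range_stereo_subset
  -- A competitor without mass at the pole is the image of a planar measure of the same energy; any
  -- other has infinite energy.
  by_cases h0 : (ν : Measure StereoSphere) {N} = 0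
  · have hr : (ν : Measure StereoSphere) (range stereo)ᶜ = 0 := measure_mono_null hN h0
    have hmap : ((ν : Measure StereoSphere).comap stereo).map stereo = ν := by
      rw [measurableEmbedding_stereo.map_comap, Measure.restrict_eq_self_of_ae_mem]
      exact hr
    have hprob : IsProbabilityMeasure ((ν : Measure StereoSphere).comap stereo) := by
      constructor
      rw [← preimage_univ (f := stereo), ← Measure.map_apply continuous_stereo.measurable
        MeasurableSet.univ, hmap, measure_univ]
    rw [logEnergy_map_stereo V ⟨_, hprob⟩ ν hmap.symm]
    exact hμ _
  · rw [logEnergy_spherePotential_eq_top hV hg h0]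
    exact le_top

/-- The equilibrium measure of an admissible potential has, on an open set of full measure, a
continuous, positive and bounded density. -/
theorem IsAdmissible.exists_density {V : Plane → ℝ} (hV : IsAdmissible V)
    {μ : ProbabilityMeasure Plane} (hμ : IsEquilibriumMeasure (fun x => (V x : EReal)) μ) :
    ∃ (U : Set Plane) (w : Plane → ℝ) (b : ℝ), IsOpen U ∧ Continuous w ∧ (∀ x, 0 < w x) ∧
      (∀ x, w x ≤ b) ∧ (μ : Measure Plane) =
        (volume.restrict U).withDensity (fun x => ENNReal.ofReal (w x)) := by
  obtain ⟨m, S, a, b, hm, ha, hab, hS, hbd, hν⟩ :=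
    hV.regular _ (hμ.map_stereo hV.contDiff.continuous hV.weak_growth)
  have hmeas : Measurable stereo := continuous_stereo.measurable
  set c : Plane → ℝ := fun x => 1 / (1 + ‖x‖ ^ 2) ^ 2 with hc
  have hcc : Continuous c := by
    refine continuous_const.div (by fun_prop) fun x => ?_
    positivity
  have hc0 : ∀ x, 0 < c x := fun x => by positivity
  have hc1 : ∀ x, c x ≤ 1 := fun x => by
    rw [hc]
    refine (div_le_one (by positivity)).2 ?_
    exact one_le_pow₀ (by linarith [sq_nonneg ‖x‖])
  have hmc : Continuous m := hm.continuous
  have hm0 : ∀ x, 0 < m (stereoVec x) := fun x => ha.trans_le (hab (stereo x)).1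
  have hmb : ∀ x, m (stereoVec x) ≤ b := fun x => (hab (stereo x)).2
  set A := stereo ⁻¹' S with hA
  have hAc : IsClosed A := hS.isClosed.preimage continuous_stereo
  -- This allows the closed set `A` to be replaced by its interior. Openness is what later bounds
  -- the density below on whole neighbourhoods of limit points.
  have hfr : volume (frontier A) = 0 :=
    measure_mono_null (continuous_stereo.frontier_preimage_subset S)
      (volume_preimage_frontier_eq_zero hbd)
  refine ⟨interior A, fun x => c x * m (stereoVec x), b, isOpen_interior,
    hcc.mul (hmc.comp contDiff_stereoVec.continuous), fun x => mul_pos (hc0 x) (hm0 x),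
    fun x => ?_, ?_⟩
  · calc c x * m (stereoVec x) ≤ 1 * m (stereoVec x) := by gcongr; exacts [(hm0 x).le, hc1 x]
      _ ≤ b := by rw [one_mul]; exact hmb x
  · have hint : (volume : Measure Plane).restrict (interior A) = volume.restrict A := by
      refine Measure.restrict_congr_set ?_
      exact interior_ae_eq_of_null_frontier hfr
    rw [hint]
    set wd : Plane → ENNReal := fun x => ENNReal.ofReal (c x * m (stereoVec x)) with hwd
    have hmapeq : ((volume.restrict A).withDensity wd).map stereo =
        (μ : Measure Plane).map stereo := by
      refine Eq.trans ?_ hν.symm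
      ext s hs
      have hmm : Measurable fun p : StereoSphere => ENNReal.ofReal (m p) :=
        (hmc.measurable.comp measurable_subtype_coe).ennreal_ofReal
      have hSm : MeasurableSet S := hS.measurableSet
      rw [Measure.map_apply hmeas hs, withDensity_apply _ (hmeas hs), withDensity_apply _ hs,
        Measure.restrict_restrict hs, Measure.restrict_restrict (hmeas hs)]
      unfold sphereArea
      rw [setLIntegral_map (hs.inter hSm) hmm hmeas, restrict_withDensity
        (hmeas (hs.inter hSm)), lintegral_withDensity_eq_lintegral_mul _ ?_
        (g := fun x => ENNReal.ofReal (m (stereo x))) (hmm.comp hmeas)]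
      · refine lintegral_congr fun x => ?_
        rw [Pi.mul_apply, sqrt_det_fderiv_stereoVec]
        exact ENNReal.ofReal_mul (hc0 x).le
      · simp_rw [sqrt_det_fderiv_stereoVec]
        exact hcc.measurable.ennreal_ofReal
    have h1 := congrArg (Measure.comap stereo) hmapeq
    rw [measurableEmbedding_stereo.comap_map, measurableEmbedding_stereo.comap_map] at h1
    exact h1.symm

/-! ### Extended-real integrals -/

section EIntegral

open scoped ENNReal

variable {α : Type*} [MeasurableSpace α] {μ : Measure α}

theorem eintegral_mono {g₁ g₂ : α → EReal} (h : ∀ a, g₁ a ≤ g₂ a) :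
    eintegral μ g₁ ≤ eintegral μ g₂ := by
  refine EReal.sub_le_sub (EReal.coe_ennreal_le_coe_ennreal_iff.2 ?_)
    (EReal.coe_ennreal_le_coe_ennreal_iff.2 ?_)
  · exact lintegral_mono fun a => EReal.toENNReal_le_toENNReal (h a)
  · exact lintegral_mono fun a => EReal.toENNReal_le_toENNReal (EReal.neg_le_neg_iff.2 (h a))

theorem eintegral_le_lintegral (g : α → EReal) :
    eintegral μ g ≤ ((∫⁻ a, (g a).toENNReal ∂μ : ℝ≥0∞) : EReal) := by
  unfold eintegral
  refine (EReal.sub_le_sub le_rfl (EReal.coe_ennreal_nonneg _)).trans ?_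
  simp

theorem EReal.coe_sub_coe_eq_of_add_eq {a b c d : ℝ≥0∞} (hb : b ≠ ∞) (hd : d ≠ ∞)
    (h : a + d = c + b) : (a : EReal) - b = c - d := by
  lift b to NNReal using hb
  lift d to NNReal using hd
  induction a with
  | top =>
    have : c = ∞ := by
      by_contra hc
      rw [top_add] at h
      exact absurd h.symm (ENNReal.add_ne_top.2 ⟨hc, ENNReal.coe_ne_top⟩)
    subst this
    rfl
  | coe a =>
    have hc : c ≠ ∞ := by
      rintro rfl
      rw [top_add] at h
      exact absurd h (ENNReal.add_ne_top.2 ⟨ENNReal.coe_ne_top, ENNReal.coe_ne_top⟩)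
    lift c to NNReal using hc
    have h' : (a : ℝ) + d = c + b := by exact_mod_cast h
    change ((a : ℝ) : EReal) - ((b : ℝ) : EReal) = ((c : ℝ) : EReal) - ((d : ℝ) : EReal)
    norm_cast
    linarith

theorem ENNReal.ofReal_add_ofReal_comm {p q r s : ℝ}
    (h : max p 0 + max q 0 = max r 0 + max s 0) :
    ENNReal.ofReal p + ENNReal.ofReal q = ENNReal.ofReal r + ENNReal.ofReal s := by
  have hm : ∀ x : ℝ, ENNReal.ofReal x = ENNReal.ofReal (max x 0) := fun x => by
    rcases le_total x 0 with hx | hx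
    · rw [max_eq_right hx, ENNReal.ofReal_zero, ENNReal.ofReal_of_nonpos hx]
    · rw [max_eq_left hx]
  rw [hm p, hm q, hm r, hm s, ← ENNReal.ofReal_add (le_max_right _ _) (le_max_right _ _),
    ← ENNReal.ofReal_add (le_max_right _ _) (le_max_right _ _), h]

/-- This is g⁺ + h⁺ = (g + h) + g⁻ + h⁻, arranged without subtraction so that it can be integrated
term by term in [0, ∞]. -/
theorem EReal.toENNReal_add_ofReal {g : EReal} {h : ℝ} (hg : ((-h : ℝ) : EReal) ≤ g) :
    g.toENNReal + ENNReal.ofReal h =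
      (g + h).toENNReal + ((-g).toENNReal + ENNReal.ofReal (-h)) := by
  induction g with
  | bot => exact absurd hg (by simp)
  | top => simp
  | coe g =>
    have hg' : 0 ≤ g + h := by
      have := EReal.coe_le_coe_iff.1 hg
      linarith
    rw [← EReal.coe_add, ← EReal.coe_neg, EReal.real_coe_toENNReal, EReal.real_coe_toENNReal,
      EReal.real_coe_toENNReal,
      show ENNReal.ofReal (-g) + ENNReal.ofReal (-h) = ENNReal.ofReal (max (-g) 0 + max (-h) 0) by
        rw [ENNReal.ofReal_add (le_max_right _ _) (le_max_right _ _)]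
        congr 1 <;> simp]
    refine ENNReal.ofReal_add_ofReal_comm ?_
    rcases le_total g 0 with h1 | h1 <;> rcases le_total h 0 with h2 | h2 <;>
      simp only [max_eq_left, max_eq_right, h1, h2, hg', neg_nonneg, neg_nonpos] <;>
      first | linarith | (rw [max_eq_left (by linarith)]; linarith)

theorem EReal.coe_sub_coe_sub_coe (e : ℝ≥0∞) {c d : ℝ≥0∞} (hc : c ≠ ∞) (hd : d ≠ ∞) :
    (e : EReal) - (c - d) = ((e + d : ℝ≥0∞) : EReal) - c := by
  lift c to NNReal using hc
  lift d to NNReal using hd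
  induction e with
  | top => rfl
  | coe e =>
    change ((e : ℝ) : EReal) - (((c : ℝ) : EReal) - ((d : ℝ) : EReal)) =
      (((e + d : NNReal) : ℝ) : EReal) - ((c : ℝ) : EReal)
    rw [NNReal.coe_add, ← EReal.coe_sub, ← EReal.coe_sub, ← EReal.coe_sub]
    congr 1
    ring

theorem eintegral_eq_lintegral_add_sub {g : α → EReal} {h : α → ℝ} (hg : Measurable g)
    (hh : Integrable h μ) (hgh : ∀ a, ((-h a : ℝ) : EReal) ≤ g a) :
    eintegral μ g =
      ((∫⁻ a, (g a + (h a : EReal)).toENNReal ∂μ : ℝ≥0∞) : EReal) - ((∫ a, h a ∂μ : ℝ) : EReal) := by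
  have hp : ∫⁻ a, ENNReal.ofReal (h a) ∂μ ≠ ∞ := hh.lintegral_lt_top.ne
  have hn : ∫⁻ a, ENNReal.ofReal (-h a) ∂μ ≠ ∞ := hh.neg.lintegral_lt_top.ne
  have hgn : ∫⁻ a, (-g a).toENNReal ∂μ ≠ ∞ := by
    refine ne_top_of_le_ne_top hp (lintegral_mono fun a => ?_)
    rw [← EReal.real_coe_toENNReal]
    refine EReal.toENNReal_le_toENNReal ?_
    rw [EReal.neg_le]
    simpa using hgh a
  have hsum : ∫⁻ a, (g a).toENNReal ∂μ + ∫⁻ a, ENNReal.ofReal (h a) ∂μ =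
      ∫⁻ a, (g a + (h a : EReal)).toENNReal ∂μ + (∫⁻ a, (-g a).toENNReal ∂μ +
        ∫⁻ a, ENNReal.ofReal (-h a) ∂μ) := by
    have h1 : AEMeasurable (fun a => (-g a).toENNReal) μ := hg.neg.ereal_toENNReal.aemeasurable
    have h2 : AEMeasurable (fun a => ENNReal.ofReal (-h a)) μ := hh.neg.aemeasurable.ennreal_ofReal
    rw [← lintegral_add_left hg.ereal_toENNReal, ← lintegral_add_left' h1,
      ← lintegral_add_right' (μ := μ) (g := fun a => (-g a).toENNReal + ENNReal.ofReal (-h a)) _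
        (h1.add h2)]
    exact lintegral_congr fun a => EReal.toENNReal_add_ofReal (hgh a)
  have hint : ((∫ a, h a ∂μ : ℝ) : EReal) = ((∫⁻ a, ENNReal.ofReal (h a) ∂μ : ℝ≥0∞) : EReal) -
      ((∫⁻ a, ENNReal.ofReal (-h a) ∂μ : ℝ≥0∞) : EReal) := by
    rw [integral_eq_lintegral_pos_part_sub_lintegral_neg_part hh, EReal.coe_sub,
      ← EReal.coe_ennreal_toReal hp, ← EReal.coe_ennreal_toReal hn]
  unfold eintegral
  rw [hint]
  set a := ∫⁻ a, (g a).toENNReal ∂μ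
  set b := ∫⁻ a, (-g a).toENNReal ∂μ
  set c := ∫⁻ a, ENNReal.ofReal (h a) ∂μ
  set d := ∫⁻ a, ENNReal.ofReal (-h a) ∂μ
  set e := ∫⁻ a, (g a + (h a : EReal)).toENNReal ∂μ
  have h1 := EReal.coe_sub_coe_sub_coe e hp hn
  rw [h1]
  refine EReal.coe_sub_coe_eq_of_add_eq hgn hp ?_
  rw [hsum]
  ring

/-- Replacing g by max(g, −h) can only increase its integral and leaves (g + h)⁺ unchanged. This
serves the limit integrand, for which no lower bound by −h is available. -/
theorem eintegral_le_lintegral_add_sub {g : α → EReal} {h : α → ℝ} (hg : Measurable g)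
    (hm : Measurable h) (hh : Integrable h μ) : eintegral μ g ≤
      ((∫⁻ a, (g a + (h a : EReal)).toENNReal ∂μ : ℝ≥0∞) : EReal) - ((∫ a, h a ∂μ : ℝ) : EReal) := by
  have hm' : Measurable fun a => ((-h a : ℝ) : EReal) := hm.neg.coe_real_ereal
  refine (eintegral_mono fun a => le_max_left (g a) ((-h a : ℝ) : EReal)).trans (le_of_eq ?_)
  rw [eintegral_eq_lintegral_add_sub (hg.max hm') hh fun a => le_max_right _ _]
  congr 2
  refine lintegral_congr fun a => ?_
  rcases le_total ((-h a : ℝ) : EReal) (g a) with hle | hle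
  · rw [max_eq_left hle]
  · rw [max_eq_right hle, ← EReal.coe_add, neg_add_cancel, EReal.coe_zero,
      EReal.toENNReal_of_nonpos le_rfl, EReal.toENNReal_of_nonpos]
    refine (add_le_add_left hle _).trans ?_
    rw [← EReal.coe_add, neg_add_cancel, EReal.coe_zero]

theorem EReal.toENNReal_le_add_ofReal_neg (g : EReal) (h : ℝ) :
    g.toENNReal ≤ (g + h).toENNReal + ENNReal.ofReal (-h) := by
  have h1 := EReal.toENNReal_add_le (x := g + h) (y := ((-h : ℝ) : EReal))
  rwa [EReal.coe_neg, ← sub_eq_add_neg, EReal.add_sub_cancel_right, ← EReal.coe_neg,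
    EReal.real_coe_toENNReal] at h1

theorem EReal.toENNReal_sub_add {a b : ℝ≥0∞} (ha : a ≠ ∞) :
    ((a : EReal) - b).toENNReal + b = (-((a : EReal) - b)).toENNReal + a := by
  lift a to NNReal using ha
  induction b with
  | top => simp
  | coe b =>
    change (((a : ℝ) : EReal) - ((b : ℝ) : EReal)).toENNReal + (b : ℝ≥0∞) =
      (-(((a : ℝ) : EReal) - ((b : ℝ) : EReal))).toENNReal + (a : ℝ≥0∞)
    rw [← EReal.coe_sub, ← EReal.coe_neg, EReal.real_coe_toENNReal, EReal.real_coe_toENNReal,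
      ← ENNReal.ofReal_coe_nnreal, ← ENNReal.ofReal_coe_nnreal]
    refine ENNReal.ofReal_add_ofReal_comm ?_
    have ha := a.2
    have hb := b.2
    rw [max_eq_left (a := (b : ℝ)) hb, max_eq_left (a := (a : ℝ)) ha]
    rcases le_total (a : ℝ) b with h | h
    · rw [max_eq_right (by linarith), max_eq_left (by linarith)]; linarith
    · rw [max_eq_left (by linarith), max_eq_right (by linarith)]; linarith

/-- Here a and b need not be the positive and negative parts of a − b, since both may be positive at
a point. The identity (a − b)⁺ + b = (a − b)⁻ + a is integrated instead. -/
theorem eintegral_coe_sub_coe {a b : α → ℝ≥0∞} (ha : Measurable a) (hb : Measurable b)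
    (hfin : ∫⁻ x, a x ∂μ ≠ ∞) : eintegral μ (fun x => (a x : EReal) - b x) =
      ((∫⁻ x, a x ∂μ : ℝ≥0∞) : EReal) - ((∫⁻ x, b x ∂μ : ℝ≥0∞) : EReal) := by
  have hm : Measurable fun x => (a x : EReal) - b x :=
    ha.coe_ereal_ennreal.sub hb.coe_ereal_ennreal
  have hsum : ∫⁻ x, ((a x : EReal) - b x).toENNReal ∂μ + ∫⁻ x, b x ∂μ =
      ∫⁻ x, (-((a x : EReal) - b x)).toENNReal ∂μ + ∫⁻ x, a x ∂μ := by
    rw [← lintegral_add_right _ hb, ← lintegral_add_right _ ha]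
    refine lintegral_congr_ae ?_
    filter_upwards [ae_lt_top ha hfin] with x hx
    exact EReal.toENNReal_sub_add hx.ne
  have hp : ∫⁻ x, ((a x : EReal) - b x).toENNReal ∂μ ≠ ∞ := by
    refine ne_top_of_le_ne_top hfin (lintegral_mono fun x => ?_)
    calc _ ≤ (a x : EReal).toENNReal := EReal.toENNReal_le_toENNReal
            ((EReal.sub_le_sub le_rfl (EReal.coe_ennreal_nonneg _)).trans (by simp))
      _ = a x := EReal.toENNReal_coe
  unfold eintegral
  set p := ∫⁻ x, ((a x : EReal) - b x).toENNReal ∂μ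
  set n := ∫⁻ x, (-((a x : EReal) - b x)).toENNReal ∂μ
  set A := ∫⁻ x, a x ∂μ
  by_cases hbt : ∫⁻ x, b x ∂μ = ∞
  · have hn : n = ∞ := by
      rw [hbt, add_top] at hsum
      by_contra hn
      exact absurd hsum.symm (ENNReal.add_ne_top.2 ⟨hn, hfin⟩)
    rw [hbt, hn, EReal.coe_ennreal_top, EReal.sub_top, EReal.sub_top]
  · have hn : n ≠ ∞ := by
      intro hn
      rw [hn, top_add] at hsum
      exact absurd hsum (ENNReal.add_ne_top.2 ⟨hp, hbt⟩)
    exact EReal.coe_sub_coe_eq_of_add_eq hn hbt (hsum.trans (add_comm _ _))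

theorem volume_Ioi_inter_ofReal_lt (a : ℝ≥0∞) :
    volume {t : ℝ | 0 < t ∧ ENNReal.ofReal t < a} = a := by
  induction a with
  | top =>
    have : {t : ℝ | 0 < t ∧ ENNReal.ofReal t < ∞} = Ioi 0 := by ext t; simp
    rw [this, Real.volume_Ioi]
  | coe a =>
    have : {t : ℝ | 0 < t ∧ ENNReal.ofReal t < a} = Ioo 0 (a : ℝ) := by
      ext t
      simp only [mem_ofPred_eq, mem_Ioo, and_congr_right_iff]
      intro ht
      rw [← ENNReal.ofReal_coe_nnreal, ENNReal.ofReal_lt_ofReal_iff_of_nonneg ht.le]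
    rw [this, Real.volume_Ioo, sub_zero, ENNReal.ofReal_coe_nnreal]

/-- The layer cake formula for functions with values in `[0, ∞]`. -/
theorem lintegral_eq_lintegral_measure_ofReal_lt [SFinite μ] {g : α → ℝ≥0∞} (hg : Measurable g) :
    ∫⁻ a, g a ∂μ = ∫⁻ t in Ioi (0 : ℝ), μ {a | ENNReal.ofReal t < g a} := by
  have hS : MeasurableSet {p : α × ℝ | ENNReal.ofReal p.2 < g p.1} :=
    measurableSet_lt measurable_snd.ennreal_ofReal (hg.comp measurable_fst)
  have h1 : ∀ a, g a = ∫⁻ t in Ioi (0 : ℝ),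
      {p : α × ℝ | ENNReal.ofReal p.2 < g p.1}.indicator 1 (a, t) := by
    intro a
    have hT : MeasurableSet {t : ℝ | ENNReal.ofReal t < g a} :=
      measurableSet_lt ENNReal.measurable_ofReal measurable_const
    have : (fun t : ℝ => {p : α × ℝ | ENNReal.ofReal p.2 < g p.1}.indicator
        (1 : α × ℝ → ℝ≥0∞) (a, t)) = {t : ℝ | ENNReal.ofReal t < g a}.indicator 1 := rfl
    rw [this, lintegral_indicator_one hT, Measure.restrict_apply hT]
    refine (volume_Ioi_inter_ofReal_lt (g a)).symm.trans (congrArg _ ?_)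
    ext t
    exact and_comm
  calc ∫⁻ a, g a ∂μ = ∫⁻ a, (∫⁻ t in Ioi (0 : ℝ),
      {p : α × ℝ | ENNReal.ofReal p.2 < g p.1}.indicator 1 (a, t)) ∂μ := lintegral_congr h1
    _ = ∫⁻ t in Ioi (0 : ℝ), (∫⁻ a, {p : α × ℝ | ENNReal.ofReal p.2 < g p.1}.indicator 1 (a, t)
        ∂μ) := lintegral_lintegral_swap (measurable_one.indicator hS).aemeasurable
    _ = _ := by
        refine lintegral_congr fun t => ?_
        have hT : MeasurableSet {a | ENNReal.ofReal t < g a} :=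
          measurableSet_lt measurable_const hg
        exact lintegral_indicator_one hT

end EIntegral

/-! ### Weak limits -/

section WeakLimits

open scoped ENNReal

theorem isCompact_closure_of_forall_seq {Z : Type*} [PseudoMetricSpace Z] {A : Set Z}
    (h : ∀ z : ℕ → Z, (∀ n, z n ∈ A) → ∃ (φ : ℕ → ℕ) (p : Z), StrictMono φ ∧
      Tendsto (z ∘ φ) atTop (𝓝 p)) : IsCompact (closure A) := by
  refine IsSeqCompact.isCompact fun z hz => ?_
  have hch : ∀ n : ℕ, ∃ y ∈ A, dist (z n) y < 1 / ((n : ℝ) + 1) := fun n =>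
    Metric.mem_closure_iff.1 (hz n) _ (by positivity)
  choose y hyA hy using hch
  obtain ⟨φ, p, hφ, hp⟩ := h y hyA
  refine ⟨p, mem_closure_of_tendsto hp (Eventually.of_forall fun n => hyA _), φ, hφ, ?_⟩
  refine hp.congr_dist ?_
  refine squeeze_zero (fun _ => dist_nonneg) (fun n => ?_)
    (tendsto_one_div_add_atTop_nhds_zero_nat.comp hφ.tendsto_atTop)
  rw [dist_comm]
  exact (hy (φ n)).le

/-- A lower semicontinuity theorem for integrals of varying functions with respect to the laws of
varying maps. -/
theorem lintegral_le_liminf_lintegral_of_forall_seq {Z α : Type*} [TopologicalSpace Z]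
    [TopologicalSpace.MetrizableSpace Z] [MeasurableSpace Z] [BorelSpace Z] [MeasurableSpace α]
    {μ : Measure α} [SFinite μ] {z : ℕ → α → Z} (hz : ∀ k, Measurable (z k))
    {Q : ℕ → ProbabilityMeasure Z} (hQ : ∀ k, (Q k : Measure Z) = μ.map (z k))
    {P : ProbabilityMeasure Z} (hP : Tendsto Q atTop (𝓝 P)) {g : ℕ → α → ℝ≥0∞}
    (hg : ∀ k, Measurable (g k)) {G : Z → ℝ≥0∞} (hG : Measurable G)
    (hlim : ∀ (k : ℕ → ℕ) (x : ℕ → α) (p : Z) (t : ℝ≥0∞), t ≠ ∞ → Tendsto k atTop atTop →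
      (∀ j, g (k j) (x j) ≤ t) → Tendsto (fun j => z (k j) (x j)) atTop (𝓝 p) → G p ≤ t) :
    ∫⁻ p, G p ∂(P : Measure Z) ≤ liminf (fun k => ∫⁻ a, g k a ∂μ) atTop := by
  let _ := TopologicalSpace.metrizableSpaceMetric Z
  -- The open set of points that stay away from all values of `z k`, k ≥ m, taken at energy at most
  -- t. A point outside every `O t m` is a limit of such values with k → ∞, so there G ≤ t.
  -- Conversely, for k ≥ m, `z k a` in `O t m` forces `g k a > t`, and portmanteau applies.
  set O : ℝ≥0∞ → ℕ → Set Z := fun t m => (closure (⋃ k ≥ m, z k '' {a | g k a ≤ t}))ᶜ with hO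
  have hOo : ∀ t m, IsOpen (O t m) := fun t m => isClosed_closure.isOpen_compl
  have hOmono : ∀ t, Monotone (O t) := fun t m n hmn => by
    refine compl_subset_compl.2 (closure_mono ?_)
    exact biUnion_subset_biUnion_left fun k hk => hmn.trans hk
  have hsub : ∀ t : ℝ≥0∞, t ≠ ∞ → {p | t < G p} ⊆ ⋃ m, O t m := by
    intro t ht p hp
    by_contra hnot
    simp only [mem_iUnion, not_exists, hO, mem_compl_iff, not_not] at hnot
    have hch : ∀ j : ℕ, ∃ (k : ℕ) (a : α), j ≤ k ∧ g k a ≤ t ∧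
        dist p (z k a) < 1 / ((j : ℝ) + 1) := fun j => by
      obtain ⟨q, hq, hd⟩ := Metric.mem_closure_iff.1 (hnot j) (1 / ((j : ℝ) + 1)) (by positivity)
      simp only [mem_iUnion] at hq
      obtain ⟨k, hk, a, ha, rfl⟩ := hq
      exact ⟨k, a, hk, ha, hd⟩
    choose k a hk ha hd using hch
    refine absurd hp (not_lt.2 (hlim k a p t ht (tendsto_atTop_mono hk tendsto_id) ha ?_))
    refine tendsto_iff_dist_tendsto_zero.2 (squeeze_zero (fun _ => dist_nonneg) (fun j => ?_)
      tendsto_one_div_add_atTop_nhds_zero_nat)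
    rw [dist_comm]
    exact (hd j).le
  have hmeas : ∀ t : ℝ≥0∞, t ≠ ∞ → (P : Measure Z) {p | t < G p} ≤
      liminf (fun k => μ {a | t < g k a}) atTop := by
    intro t ht
    refine (measure_mono (hsub t ht)).trans ?_
    rw [(hOmono t).measure_iUnion]
    refine iSup_le fun m => ?_
    refine (ProbabilityMeasure.le_liminf_measure_open_of_tendsto hP (hOo t m)).trans ?_
    refine liminf_le_liminf ?_
    filter_upwards [eventually_ge_atTop m] with k hk
    rw [hQ, Measure.map_apply (hz k) (hOo t m).measurableSet]
    refine measure_mono fun a ha => ?_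
    by_contra hle
    exact ha (subset_closure (mem_biUnion (show k ≥ m from hk) ⟨a, show g k a ≤ t from not_lt.1 hle, rfl⟩))
  calc ∫⁻ p, G p ∂(P : Measure Z)
      = ∫⁻ t in Ioi (0 : ℝ), (P : Measure Z) {p | ENNReal.ofReal t < G p} :=
        lintegral_eq_lintegral_measure_ofReal_lt hG
    _ ≤ ∫⁻ t in Ioi (0 : ℝ), liminf (fun k => μ {a | ENNReal.ofReal t < g k a}) atTop :=
        lintegral_mono fun t => hmeas _ ENNReal.ofReal_ne_top
    _ ≤ liminf (fun k => ∫⁻ t in Ioi (0 : ℝ), μ {a | ENNReal.ofReal t < g k a}) atTop := by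
        refine lintegral_liminf_le fun k => Antitone.measurable fun s t hst => ?_
        exact measure_mono fun a ha => (ENNReal.ofReal_le_ofReal hst).trans_lt ha
    _ = _ := by
        congr 1
        ext k
        exact (lintegral_eq_lintegral_measure_ofReal_lt (hg k)).symm

/-- Almost every point for a weak limit is a limit of values of the maps. -/
theorem ae_exists_tendsto_of_tendsto_map {Z α : Type*} [TopologicalSpace Z]
    [TopologicalSpace.MetrizableSpace Z] [SecondCountableTopology Z] [MeasurableSpace Z]
    [BorelSpace Z] [MeasurableSpace α] {μ : Measure α} {z : ℕ → α → Z}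
    (hz : ∀ k, Measurable (z k)) {Q : ℕ → ProbabilityMeasure Z}
    (hQ : ∀ k, (Q k : Measure Z) = μ.map (z k)) {P : ProbabilityMeasure Z}
    (hP : Tendsto Q atTop (𝓝 P)) :
    ∀ᵐ p ∂(P : Measure Z), ∃ a : ℕ → α, Tendsto (fun k => z k (a k)) atTop (𝓝 p) := by
  let _ := TopologicalSpace.metrizableSpaceMetric Z
  filter_upwards [Measure.support_mem_ae (μ := (P : Measure Z))] with p hp
  have hev : ∀ δ : ℝ, 0 < δ → ∀ᶠ k in atTop, ∃ a, dist (z k a) p < δ := by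
    intro δ hδ
    have hpos : 0 < (P : Measure Z) (Metric.ball p δ) :=
      (Measure.mem_support_iff_forall p).1 hp _ (Metric.ball_mem_nhds p hδ)
    have h1 := hpos.trans_le
      (ProbabilityMeasure.le_liminf_measure_open_of_tendsto hP Metric.isOpen_ball)
    filter_upwards [eventually_lt_of_lt_liminf h1] with k hk
    rw [hQ, Measure.map_apply (hz k) Metric.isOpen_ball.measurableSet] at hk
    obtain ⟨a, ha⟩ := nonempty_of_measure_ne_zero hk.ne'
    exact ⟨a, ha⟩
  have hne : Nonempty α := by
    obtain ⟨k, a, -⟩ := (hev 1 one_pos).exists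
    exact ⟨a⟩
  -- Near-minimizers of the distance give one sequence that works for all δ simultaneously.
  have hch : ∀ k, ∃ a, dist (z k a) p < (⨅ b, dist (z k b) p) + 1 / ((k : ℝ) + 1) := fun k =>
    exists_lt_of_ciInf_lt (lt_add_of_pos_right _ (by positivity))
  choose a ha using hch
  refine ⟨a, Metric.tendsto_nhds.2 fun δ hδ => ?_⟩
  have h2 := (tendsto_one_div_add_atTop_nhds_zero_nat (𝕜 := ℝ)).eventually
    (gt_mem_nhds (half_pos hδ))
  filter_upwards [hev (δ / 2) (half_pos hδ), h2] with k ⟨b, hb⟩ hk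
  have hinf : (⨅ b, dist (z k b) p) ≤ dist (z k b) p :=
    ciInf_le ⟨0, forall_mem_range.2 fun _ => dist_nonneg⟩ b
  linarith [ha k]

end WeakLimits

/-! ### The penalization -/

section Penalty

open scoped ENNReal

/-- A finite measure carried by an open set admits an integrable exhaustion function whose
sublevels are contained in compact subsets of the open set. -/
theorem exists_exhaustion {Z : Type*} [TopologicalSpace Z] [T2Space Z] [MeasurableSpace Z]
    [BorelSpace Z] {μ : Measure Z} [IsFiniteMeasure μ] [μ.InnerRegularCompactLTTop] {U : Set Z}
    (hU : MeasurableSet U) (hμU : μ Uᶜ = 0) :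
    ∃ χ : Z → ℝ≥0∞, Measurable χ ∧ ∫⁻ x, χ x ∂μ ≠ ∞ ∧
      ∀ M : ℝ≥0∞, M ≠ ∞ → ∃ K, IsCompact K ∧ K ⊆ U ∧ ∀ x, χ x ≤ M → x ∈ K := by
  -- The function χ counts the sets `K n` that miss x. The bounds 2⁻ⁿ make it integrable, and χ(x) ≤
  -- M < N forces x into one of the first N sets.
  have hch : ∀ n : ℕ, ∃ K ⊆ U, IsCompact K ∧ μ (U \ K) < (2⁻¹ : ℝ≥0∞) ^ n := fun n =>
    hU.exists_isCompact_sdiff_lt (measure_ne_top _ _) (pow_ne_zero _ (by simp))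
  choose K hKU hK hKμ using hch
  have hKm : ∀ n, MeasurableSet (K n)ᶜ := fun n => (hK n).measurableSet.compl
  refine ⟨fun x => ∑' n, (K n)ᶜ.indicator 1 x,
    Measurable.tsum fun n => measurable_one.indicator (hKm n), ?_, fun M hM => ?_⟩
  · rw [lintegral_tsum fun n => (measurable_one.indicator (hKm n)).aemeasurable]
    simp_rw [fun n => lintegral_indicator_one (μ := μ) (hKm n)]
    have hle : ∀ n, μ (K n)ᶜ ≤ (2⁻¹ : ℝ≥0∞) ^ n := fun n => by
      refine le_trans ?_ (hKμ n).le
      have : (K n)ᶜ ⊆ Uᶜ ∪ (U \ K n) := fun x hx => by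
        by_cases hxU : x ∈ U
        · exact Or.inr ⟨hxU, hx⟩
        · exact Or.inl hxU
      refine (measure_mono this).trans ((measure_union_le _ _).trans ?_)
      rw [hμU, zero_add]
    refine ne_top_of_le_ne_top ?_ (ENNReal.tsum_le_tsum hle)
    rw [ENNReal.tsum_geometric, ENNReal.one_sub_inv_two, inv_inv]
    exact ENNReal.ofNat_ne_top
  · obtain ⟨N, hN⟩ := ENNReal.exists_nat_gt hM
    refine ⟨⋃ n ∈ Finset.range N, K n, (Finset.range N).isCompact_biUnion fun n _ => hK n,
      iUnion₂_subset fun n _ => hKU n, fun x hx => ?_⟩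
    by_contra hnot
    simp only [mem_iUnion, not_exists] at hnot
    have h1 : (N : ℝ≥0∞) ≤ ∑' n, (K n)ᶜ.indicator 1 x := by
      refine le_trans ?_ (ENNReal.sum_le_tsum (Finset.range N))
      rw [Finset.sum_congr rfl (fun n hn => indicator_of_mem (show x ∈ (K n)ᶜ from hnot n hn) _)]
      simp
    exact absurd (h1.trans hx) (not_le.2 hN)

/-- The coefficients of the penalization. -/
def penaltyWeight (n : ℕ) : ℝ≥0∞ :=
  (2⁻¹ : ℝ≥0∞) ^ n * (volume (Metric.closedBall (0 : Plane) ((n : ℝ) + 1)))⁻¹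

theorem penaltyWeight_ne_zero (n : ℕ) : penaltyWeight n ≠ 0 :=
  mul_ne_zero (pow_ne_zero _ (by simp)) (ENNReal.inv_ne_zero.2 volume_closedBall_ne_top')

/-- The sum of an exhaustion function and of local energies at the scale `ε`. -/
def penalty (χ W : Plane → ℝ≥0∞) (ε : ℝ) (F : Plane → ℝ≥0∞) (x : Plane) : ℝ≥0∞ :=
  χ x + ∑' n : ℕ, penaltyWeight n *
    ∫⁻ l in Metric.closedBall (0 : Plane) ((n : ℝ) + 1), W (x + ε • l) * F (x + ε • l)

variable {χ W F : Plane → ℝ≥0∞} {ε : ℝ}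

theorem measurable_shift (hW : Measurable W) (hF : Measurable F) (ε : ℝ) :
    Measurable fun p : Plane × Plane => W (p.1 + ε • p.2) * F (p.1 + ε • p.2) := by
  have : Measurable fun p : Plane × Plane => p.1 + ε • p.2 := by fun_prop
  exact (hW.comp this).mul (hF.comp this)

theorem measurable_localEnergy (hW : Measurable W) (hF : Measurable F) (ε r : ℝ) :
    Measurable fun x => ∫⁻ l in Metric.closedBall (0 : Plane) r,
      W (x + ε • l) * F (x + ε • l) :=
  (measurable_shift hW hF ε).lintegral_prod_right'

theorem measurable_penalty (hχ : Measurable χ) (hW : Measurable W) (hF : Measurable F) (ε : ℝ) :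
    Measurable (penalty χ W ε F) :=
  hχ.add (Measurable.tsum fun _ => (measurable_localEnergy hW hF ε _).const_mul _)

/-- The outer density is bounded by b, and the one inside the local energy survives Fubini and a
translation to rebuild the integral of `F` against the measure. The ball volume cancels against the
weight, and the factor 2 is the sum of the 2⁻ⁿ. -/
theorem lintegral_penalty_le (hW : Measurable W) (hF : Measurable F) (hχ : Measurable χ)
    {b : ℝ≥0∞} (hb : ∀ x, W x ≤ b) (ε : ℝ) :
    ∫⁻ x, penalty χ W ε F x ∂(volume.withDensity W) ≤
      ∫⁻ x, χ x ∂(volume.withDensity W) + 2 * (b * ∫⁻ x, F x ∂(volume.withDensity W)) := by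
  unfold penalty
  rw [lintegral_add_left hχ, lintegral_tsum fun n =>
    ((measurable_localEnergy hW hF ε _).const_mul _).aemeasurable]
  gcongr
  have hn : ∀ n : ℕ, ∫⁻ x, penaltyWeight n * (∫⁻ l in Metric.closedBall (0 : Plane) ((n : ℝ) + 1),
      W (x + ε • l) * F (x + ε • l)) ∂(volume.withDensity W) ≤
      (2⁻¹ : ℝ≥0∞) ^ n * (b * ∫⁻ x, F x ∂(volume.withDensity W)) := by
    intro n
    have hv0 : volume (Metric.closedBall (0 : Plane) ((n : ℝ) + 1)) ≠ 0 :=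
      volume_closedBall_ne_zero' (by positivity)
    rw [lintegral_const_mul _ (measurable_localEnergy hW hF ε _), penaltyWeight, mul_assoc]
    refine mul_le_mul' le_rfl ?_
    rw [lintegral_withDensity_eq_lintegral_mul _ hW (measurable_localEnergy hW hF ε _),
      lintegral_withDensity_eq_lintegral_mul _ hW hF]
    calc _ ≤ (volume (Metric.closedBall (0 : Plane) ((n : ℝ) + 1)))⁻¹ *
          ∫⁻ x, b * (∫⁻ l in Metric.closedBall (0 : Plane) ((n : ℝ) + 1),
            W (x + ε • l) * F (x + ε • l)) := by
          gcongr with x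
          exact mul_le_mul_left (hb x) _
      _ = (volume (Metric.closedBall (0 : Plane) ((n : ℝ) + 1)))⁻¹ *
          (b * ∫⁻ l in Metric.closedBall (0 : Plane) ((n : ℝ) + 1),
            (∫⁻ x, W (x + ε • l) * F (x + ε • l))) := by
          rw [lintegral_const_mul _ (measurable_localEnergy hW hF ε _), lintegral_lintegral_swap]
          exact (measurable_shift hW hF ε).aemeasurable
      _ = (volume (Metric.closedBall (0 : Plane) ((n : ℝ) + 1)))⁻¹ *
          (b * ((∫⁻ x, W x * F x) * volume (Metric.closedBall (0 : Plane) ((n : ℝ) + 1)))) := by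
          simp_rw [fun l : Plane => lintegral_add_right_eq_self (μ := (volume : Measure Plane))
            (fun x => W x * F x) (ε • l)]
          rw [setLIntegral_const]
      _ = b * ∫⁻ x, W x * F x := by
          rw [mul_comm (∫⁻ x, W x * F x), mul_left_comm b, ← mul_assoc, ENNReal.inv_mul_cancel hv0
            volume_closedBall_ne_top', one_mul]
      _ ≤ _ := le_rfl
  refine (ENNReal.tsum_le_tsum hn).trans ?_
  rw [ENNReal.tsum_mul_right, ENNReal.tsum_geometric, ENNReal.one_sub_inv_two, inv_inv]

theorem le_penalty_left (x : Plane) : χ x ≤ penalty χ W ε F x := le_self_add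

theorem localEnergy_le_of_penalty_le {M : ℝ≥0∞} {x : Plane} (h : penalty χ W ε F x ≤ M) (n : ℕ) :
    ∫⁻ l in Metric.closedBall (0 : Plane) ((n : ℝ) + 1), W (x + ε • l) * F (x + ε • l) ≤
      (penaltyWeight n)⁻¹ * M := by
  have h1 := (ENNReal.le_tsum (f := fun n : ℕ => penaltyWeight n *
    ∫⁻ l in Metric.closedBall (0 : Plane) ((n : ℝ) + 1), W (x + ε • l) * F (x + ε • l)) n).trans
    (le_add_self.trans h)
  rw [← ENNReal.mul_le_iff_le_inv (penaltyWeight_ne_zero n)]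
  · exact h1
  · exact ENNReal.mul_ne_top (by finiteness)
      (ENNReal.inv_ne_top.2 (volume_closedBall_ne_zero' (by positivity)))

end Penalty

/-! ### Compactness of the blow-ups -/

section BlowUp

open scoped ENNReal

variable {X : Type*} [TopologicalSpace X] [PolishSpace X] [MeasurableSpace X] [BorelSpace X]
  [AddAction Plane X] [ContinuousVAdd Plane X]

/-- The point `(x, θ_{x/ε} u)`. -/
def blowUpPoint (ε : ℝ) (u : X) (x : Plane) : Plane × X := (x, (ε⁻¹ • x) +ᵥ u)

omit [PolishSpace X] [MeasurableSpace X] [BorelSpace X] in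
theorem continuous_blowUpPoint (ε : ℝ) (u : X) : Continuous (blowUpPoint ε u) := by
  unfold blowUpPoint
  fun_prop

theorem measurable_blowUpPoint (ε : ℝ) (u : X) : Measurable (blowUpPoint ε u) :=
  (continuous_blowUpPoint ε u).measurable

theorem blowUpLaw_toMeasure (μ : ProbabilityMeasure Plane) (ε : ℝ) (u : X) :
    (blowUpLaw μ ε u : Measure (Plane × X)) = (μ : Measure Plane).map (blowUpPoint ε u) := rfl

/-- The energy density `f_ε(x, θ_{x/ε} u) + h(x)`, which is nonnegative. -/
def blowUpEnergy (f : ℝ → Plane → X → EReal) (h : Plane → ℝ) (ε : ℝ) (u : X) (x : Plane) : ℝ≥0∞ :=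
  (f ε x ((ε⁻¹ • x) +ᵥ u) + (h x : EReal)).toENNReal

theorem measurable_comp_blowUpPoint {f : ℝ → Plane → X → EReal} {ε : ℝ}
    (hf : Measurable fun p : Plane × X => f ε p.1 p.2) (u : X) :
    Measurable fun x => f ε x ((ε⁻¹ • x) +ᵥ u) :=
  hf.comp (measurable_blowUpPoint ε u)

theorem measurable_blowUpEnergy {f : ℝ → Plane → X → EReal} {h : Plane → ℝ} {ε : ℝ}
    (hf : Measurable fun p : Plane × X => f ε p.1 p.2) (hh : Measurable h) (u : X) :
    Measurable (blowUpEnergy f h ε u) :=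
  ((measurable_comp_blowUpPoint hf u).add hh.coe_real_ereal).ereal_toENNReal

omit [TopologicalSpace X] [PolishSpace X] [MeasurableSpace X] [BorelSpace X]
  [ContinuousVAdd Plane X] in
-- Translating the blow-up at x by l gives the blow-up at x + εl. Hence the integrals in the
-- coercivity hypothesis are the local energies of the penalization, up to the negative part of h.
theorem toENNReal_le_blowUpEnergy_add (f : ℝ → Plane → X → EReal) (h : Plane → ℝ) {ε : ℝ}
    (hε : ε ≠ 0) (u : X) (x l : Plane) :
    (f ε (x + ε • l) (l +ᵥ ((ε⁻¹ • x) +ᵥ u))).toENNReal ≤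
      blowUpEnergy f h ε u (x + ε • l) + ENNReal.ofReal (-h (x + ε • l)) := by
  have h1 : l +ᵥ ((ε⁻¹ • x) +ᵥ u) = (ε⁻¹ • (x + ε • l)) +ᵥ u := by
    rw [smul_add, smul_smul, inv_mul_cancel₀ hε, one_smul, add_comm, add_vadd]
  rw [h1]
  unfold blowUpEnergy
  exact EReal.toENNReal_le_add_ofReal_neg _ _

omit [TopologicalSpace X] [PolishSpace X] [MeasurableSpace X] [BorelSpace X]
  [ContinuousVAdd Plane X] in
/-- A bound on the penalization bounds the local energies around a limit point in the open set
where the density is positive. -/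
theorem limsup_localEnergy_lt_top {f : ℝ → Plane → X → EReal} {h : Plane → ℝ}
    (hcont : Continuous h) {U : Set Plane} (hU : IsOpen U) {w : Plane → ℝ} (hw : Continuous w)
    (hw0 : ∀ x, 0 < w x) {χ : Plane → ℝ≥0∞} {M : ℝ≥0∞} (hM : M ≠ ∞) {ε : ℕ → ℝ}
    (hε0 : ∀ j, ε j ≠ 0) (hε : Tendsto ε atTop (𝓝 0)) {u : ℕ → X} {x : ℕ → Plane} {x₀ : Plane}
    (hx₀ : x₀ ∈ U) (hx : Tendsto x atTop (𝓝 x₀))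
    (hpen : ∀ j, penalty χ (U.indicator fun y => ENNReal.ofReal (w y)) (ε j)
      (blowUpEnergy f h (ε j) (u j)) (x j) ≤ M) (R : ℝ) :
    limsup (fun j => eintegral (volume.restrict (Metric.closedBall (0 : Plane) R))
      (fun l => f (ε j) (x j + ε j • l) (l +ᵥ (((ε j)⁻¹ • x j) +ᵥ u j)))) atTop < ⊤ := by
  set W : Plane → ℝ≥0∞ := U.indicator fun y => ENNReal.ofReal (w y)
  set c := w x₀ / 2
  have hc : 0 < c := half_pos (hw0 x₀)
  have hc0 : ENNReal.ofReal c ≠ 0 := by simpa using hc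
  set H := |h x₀| + 1
  -- Near a point of `U` the density is at least c, so weighted local energies dominate unweighted
  -- ones. The points x_j + ε_j l enter this neighbourhood uniformly for l in a fixed ball.
  have hev : ∀ᶠ y in 𝓝 x₀, y ∈ U ∧ c < w y ∧ -h y < H := by
    refine (hU.eventually_mem hx₀).and ((hw.continuousAt.eventually_const_lt
      (half_lt_self (hw0 x₀))).and (hcont.neg.continuousAt.eventually_lt_const ?_))
    exact (neg_le_abs _).trans_lt (lt_add_one _)
  obtain ⟨δ, hδ, hball⟩ := Metric.eventually_nhds_iff.1 hev
  obtain ⟨n, hn⟩ := exists_nat_ge R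
  set B := Metric.closedBall (0 : Plane) ((n : ℝ) + 1)
  set D : ℝ≥0∞ := (ENNReal.ofReal c)⁻¹ * ((penaltyWeight n)⁻¹ * M) + ENNReal.ofReal H * volume B
  have hBt : volume B ≠ ∞ := volume_closedBall_ne_top'
  have hDt : D ≠ ∞ := by
    have h1 : (penaltyWeight n)⁻¹ ≠ ∞ := ENNReal.inv_ne_top.2 (penaltyWeight_ne_zero n)
    have h2 : (ENNReal.ofReal c)⁻¹ ≠ ∞ := ENNReal.inv_ne_top.2 hc0
    finiteness
  have hclose : ∀ᶠ j in atTop, ∀ l ∈ B, dist (x j + ε j • l) x₀ < δ := by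
    have h1 := (Metric.tendsto_nhds.1 hx) _ (half_pos hδ)
    have h2 : Tendsto (fun j => |ε j| * ((n : ℝ) + 1)) atTop (𝓝 0) := by
      simpa using hε.abs.mul_const ((n : ℝ) + 1)
    filter_upwards [h1, h2.eventually (gt_mem_nhds (half_pos hδ))] with j hj1 hj2 l hl
    have hl' : ‖l‖ ≤ n + 1 := mem_closedBall_zero_iff.1 hl
    calc dist (x j + ε j • l) x₀ ≤ dist (x j + ε j • l) (x j) + dist (x j) x₀ :=
          dist_triangle _ _ _
      _ < δ / 2 + δ / 2 := by
          refine add_lt_add (lt_of_le_of_lt ?_ hj2) hj1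
          rw [dist_eq_norm, add_sub_cancel_left, norm_smul, Real.norm_eq_abs]
          gcongr
      _ = δ := add_halves δ
  refine lt_of_le_of_lt (limsup_le_of_le (h := ?_))
    (show (D : EReal) < ⊤ from lt_top_iff_ne_top.2 (by simpa using hDt))
  filter_upwards [hclose] with j hj
  refine (eintegral_le_lintegral _).trans (EReal.coe_ennreal_le_coe_ennreal_iff.2 ?_)
  calc ∫⁻ l in Metric.closedBall (0 : Plane) R,
        (f (ε j) (x j + ε j • l) (l +ᵥ (((ε j)⁻¹ • x j) +ᵥ u j))).toENNReal
      ≤ ∫⁻ l in B, (f (ε j) (x j + ε j • l) (l +ᵥ (((ε j)⁻¹ • x j) +ᵥ u j))).toENNReal :=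
        lintegral_mono_set (Metric.closedBall_subset_closedBall (by linarith))
    _ ≤ ∫⁻ l in B, ((ENNReal.ofReal c)⁻¹ * (W (x j + ε j • l) *
          blowUpEnergy f h (ε j) (u j) (x j + ε j • l)) + ENNReal.ofReal H) := by
        refine setLIntegral_mono' Metric.isClosed_closedBall.measurableSet fun l hl => ?_
        obtain ⟨hyU, hyw, hyh⟩ := hball (hj l hl)
        refine (toENNReal_le_blowUpEnergy_add f h (hε0 j) (u j) (x j) l).trans ?_
        refine add_le_add ?_ (ENNReal.ofReal_le_ofReal hyh.le)
        rw [← ENNReal.mul_le_iff_le_inv hc0 ENNReal.ofReal_ne_top]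
        refine mul_le_mul' ?_ le_rfl
        rw [show W (x j + ε j • l) = ENNReal.ofReal (w (x j + ε j • l)) from
          indicator_of_mem hyU _]
        exact ENNReal.ofReal_le_ofReal hyw.le
    _ = (ENNReal.ofReal c)⁻¹ * (∫⁻ l in B, W (x j + ε j • l) *
          blowUpEnergy f h (ε j) (u j) (x j + ε j • l)) + ENNReal.ofReal H * volume B := by
        rw [lintegral_add_right _ measurable_const, setLIntegral_const,
          lintegral_const_mul' _ _ (ENNReal.inv_ne_top.2 hc0)]
    _ ≤ D :=
        add_le_add (mul_le_mul_right (localEnergy_le_of_penalty_le (hpen j) n) _) le_rfl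

variable {E : Set ℝ} {f : ℝ → Plane → X → EReal} {f₀ : Plane → X → EReal} {h : Plane → ℝ}
  {U : Set Plane} {w : Plane → ℝ} {χ : Plane → ℝ≥0∞}

omit [PolishSpace X] [MeasurableSpace X] [BorelSpace X] [ContinuousVAdd Plane X] in
-- The term χ keeps the base points in a compact subset of `U`; after extraction, the local energies
-- provide the hypothesis of coercivity.
theorem exists_subseq_tendsto_blowUpPoint (hE : E ⊆ Ioi 0) (hcoer : IsCoerciveGammaLiminf E f f₀)
    (hcont : Continuous h) (hU : IsOpen U) (hw : Continuous w) (hw0 : ∀ x, 0 < w x)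
    (hχ : ∀ M : ℝ≥0∞, M ≠ ∞ → ∃ K, IsCompact K ∧ K ⊆ U ∧ ∀ x, χ x ≤ M → x ∈ K)
    {M : ℝ≥0∞} (hM : M ≠ ∞) {ε : ℕ → ℝ} (hεE : ∀ j, ε j ∈ E) (hε : Tendsto ε atTop (𝓝 0))
    {u : ℕ → X} {x : ℕ → Plane}
    (hpen : ∀ j, penalty χ (U.indicator fun y => ENNReal.ofReal (w y)) (ε j)
      (blowUpEnergy f h (ε j) (u j)) (x j) ≤ M) :
    ∃ (φ : ℕ → ℕ) (p : Plane × X), StrictMono φ ∧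
      Tendsto (fun j => blowUpPoint (ε (φ j)) (u (φ j)) (x (φ j))) atTop (𝓝 p) := by
  obtain ⟨K, hK, hKU, hχK⟩ := hχ M hM
  obtain ⟨x₀, hx₀, φ, hφ, hlim⟩ := hK.tendsto_subseq
    fun j => hχK _ ((le_penalty_left (x j)).trans (hpen j))
  have hεφ := hε.comp hφ.tendsto_atTop
  obtain ⟨ψ, v₀, hψ, hv⟩ := (hcoer (ε ∘ φ) (x ∘ φ)
    (fun j => ((ε (φ j))⁻¹ • x (φ j)) +ᵥ u (φ j)) x₀ (fun j => hεE _) hεφ hlim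
    (fun R _ => limsup_localEnergy_lt_top hcont hU hw hw0 hM (fun j => (hE (hεE (φ j))).ne') hεφ
      (hKU hx₀) hlim (fun j => hpen (φ j)) R)).1
  exact ⟨φ ∘ ψ, (x₀, v₀), hφ.comp hψ, (hlim.comp hψ.tendsto_atTop).prodMk_nhds hv⟩

omit [PolishSpace X] [MeasurableSpace X] [BorelSpace X] [ContinuousVAdd Plane X] in
theorem le_liminf_of_tendsto_blowUpPoint (hE : E ⊆ Ioi 0) (hcoer : IsCoerciveGammaLiminf E f f₀)
    (hcont : Continuous h) (hU : IsOpen U) (hw : Continuous w) (hw0 : ∀ x, 0 < w x)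
    (hχ : ∀ M : ℝ≥0∞, M ≠ ∞ → ∃ K, IsCompact K ∧ K ⊆ U ∧ ∀ x, χ x ≤ M → x ∈ K)
    {M : ℝ≥0∞} (hM : M ≠ ∞) {ε : ℕ → ℝ} (hεE : ∀ j, ε j ∈ E) (hε : Tendsto ε atTop (𝓝 0))
    {u : ℕ → X} {x : ℕ → Plane}
    (hpen : ∀ j, penalty χ (U.indicator fun y => ENNReal.ofReal (w y)) (ε j)
      (blowUpEnergy f h (ε j) (u j)) (x j) ≤ M) {p : Plane × X}
    (hp : Tendsto (fun j => blowUpPoint (ε j) (u j) (x j)) atTop (𝓝 p)) :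
    f₀ p.1 p.2 ≤ liminf (fun j => f (ε j) (x j) (((ε j)⁻¹ • x j) +ᵥ u j)) atTop := by
  obtain ⟨K, hK, hKU, hχK⟩ := hχ M hM
  have hx : Tendsto x atTop (𝓝 p.1) := (continuous_fst.tendsto p).comp hp
  have hx₀ : p.1 ∈ K := hK.isClosed.mem_of_tendsto hx
    (Eventually.of_forall fun j => hχK _ ((le_penalty_left (x j)).trans (hpen j)))
  exact (hcoer ε x (fun j => ((ε j)⁻¹ • x j) +ᵥ u j) p.1 hεE hε hx
    (fun R _ => limsup_localEnergy_lt_top hcont hU hw hw0 hM (fun j => (hE (hεE j)).ne') hε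
      (hKU hx₀) hx hpen R)).2 p.2 ((continuous_snd.tendsto p).comp hp)

theorem lintegral_blowUpEnergy_le {μ : ProbabilityMeasure Plane}
    (hf : ∀ ε ∈ E, Measurable fun p : Plane × X => f ε p.1 p.2)
    (hint : Integrable h (μ : Measure Plane))
    (hbelow : ∀ ε ∈ E, ∀ (x : Plane) (v : X), ((-h x : ℝ) : EReal) ≤ f ε x v)
    {ε : ℝ} (hεE : ε ∈ E) {u : X} {C : ℝ} (hu : rescaledFunctional μ f ε u ≤ C) :
    ∫⁻ x, blowUpEnergy f h ε u x ∂(μ : Measure Plane) ≤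
      ENNReal.ofReal (C + ∫ x, h x ∂(μ : Measure Plane)) := by
  unfold rescaledFunctional at hu
  rw [eintegral_eq_lintegral_add_sub (measurable_comp_blowUpPoint (hf ε hεE) u) hint
    (fun x => hbelow ε hεE x _), EReal.sub_le_iff_le_add (Or.inl (EReal.coe_ne_bot _))
    (Or.inl (EReal.coe_ne_top _)), ← EReal.coe_add] at hu
  have := EReal.toENNReal_le_toENNReal hu
  rwa [EReal.toENNReal_coe, EReal.real_coe_toENNReal] at this

theorem isTightMeasureSet_blowUpLaw {μ : ProbabilityMeasure Plane}
    (hE : E ⊆ Ioi 0) (hcoer : IsCoerciveGammaLiminf E f f₀)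
    (hcont : Continuous h) (hU : IsOpen U) (hw : Continuous w) (hw0 : ∀ x, 0 < w x)
    (hχ : ∀ M : ℝ≥0∞, M ≠ ∞ → ∃ K, IsCompact K ∧ K ⊆ U ∧ ∀ x, χ x ≤ M → x ∈ K)
    {ε : ℕ → ℝ} (hεE : ∀ j, ε j ∈ E) (hε : Tendsto ε atTop (𝓝 0)) {u : ℕ → X} {D : ℝ≥0∞}
    (hD : D ≠ ∞) (hχm : Measurable χ) (hf : ∀ ε ∈ E, Measurable fun p : Plane × X => f ε p.1 p.2)
    (hpen : ∀ k, ∫⁻ x, penalty χ (U.indicator fun y => ENNReal.ofReal (w y)) (ε k)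
      (blowUpEnergy f h (ε k) (u k)) x ∂(μ : Measure Plane) ≤ D) :
    IsTightMeasureSet (range fun k => (blowUpLaw μ (ε k) (u k) : Measure (Plane × X))) := by
  let _ := TopologicalSpace.metrizableSpaceMetric X
  rw [isTightMeasureSet_iff_exists_isCompact_measure_compl_le]
  intro δ hδ
  set Ψ : ℕ → Plane → ℝ≥0∞ := fun k => penalty χ (U.indicator fun y => ENNReal.ofReal (w y)) (ε k)
      (blowUpEnergy f h (ε k) (u k)) with hΨ
  have hΨm : ∀ k, Measurable (Ψ k) := fun k => measurable_penalty hχm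
    (hw.measurable.ennreal_ofReal.indicator hU.measurableSet)
    (measurable_blowUpEnergy (hf _ (hεE k)) hcont.measurable _) _
  by_cases hδt : δ = ∞
  · exact ⟨∅, isCompact_empty, fun _ _ => hδt ▸ le_top⟩
  -- Markov's inequality needs D/M ≤ δ; the added 1 keeps M nonzero when D = 0.
  set M : ℝ≥0∞ := (D + 1) / δ with hMdef
  have hM0 : M ≠ 0 := ENNReal.div_ne_zero.2 ⟨by simp, hδt⟩
  have hMt : M ≠ ∞ := ENNReal.div_ne_top (by finiteness) hδ.ne'
  set A : Set (Plane × X) := ⋃ k, blowUpPoint (ε k) (u k) '' {x | Ψ k x ≤ M} with hA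
  refine ⟨closure A, isCompact_closure_of_forall_seq fun z hz => ?_, ?_⟩
  · have hch : ∀ n, ∃ (k : ℕ) (x : Plane), Ψ k x ≤ M ∧ blowUpPoint (ε k) (u k) x = z n :=
      fun n => by
        obtain ⟨k, x, hx, he⟩ := mem_iUnion.1 (hz n)
        exact ⟨k, x, hx, he⟩
    choose k x hx hxz using hch
    -- Coercivity only concerns parameters tending to 0. If the indices do not tend to infinity, one
    -- value recurs infinitely often, and compactness comes from the continuity of a single blow-up
    -- map.
    by_cases hk : Tendsto k atTop atTop
    · obtain ⟨φ, p, hφ, hp⟩ := exists_subseq_tendsto_blowUpPoint (ε := ε ∘ k) (u := u ∘ k)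
        (x := x) hE hcoer hcont hU hw hw0 hχ hMt (fun j => hεE _) (hε.comp hk) hx
      exact ⟨φ, p, hφ, hp.congr fun j => hxz _⟩
    · have hfreq : ∃ k₀, ∃ᶠ n in atTop, k n = k₀ := by
        by_contra! hnot
        refine hk (tendsto_atTop.2 fun b => ?_)
        have h1 : ∀ᶠ n in atTop, ∀ k₀ ∈ Finset.range b, k n ≠ k₀ :=
          (Finset.eventually_all _).2 fun k₀ _ => hnot k₀
        filter_upwards [h1] with n hn
        by_contra hlt
        exact hn (k n) (Finset.mem_range.2 (not_le.1 hlt)) rfl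
      obtain ⟨k₀, hk₀⟩ := hfreq
      obtain ⟨φ, hφ, hφk⟩ := extraction_of_frequently_atTop hk₀
      obtain ⟨K, hK, -, hχK⟩ := hχ M hMt
      obtain ⟨x₀, -, ψ, hψ, hlim⟩ := hK.tendsto_subseq
        fun j => hχK (x (φ j)) ((le_penalty_left _).trans (hx (φ j)))
      refine ⟨φ ∘ ψ, blowUpPoint (ε k₀) (u k₀) x₀, hφ.comp hψ, ?_⟩
      refine (((continuous_blowUpPoint (ε k₀) (u k₀)).tendsto x₀).comp hlim).congr fun j => ?_
      have := hxz (φ (ψ j))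
      rw [hφk] at this
      exact this
  · rintro _ ⟨k, rfl⟩
    have hmeas : MeasurableSet (closure A)ᶜ := isClosed_closure.measurableSet.compl
    change (blowUpLaw μ (ε k) (u k) : Measure (Plane × X)) (closure A)ᶜ ≤ δ
    rw [blowUpLaw_toMeasure, Measure.map_apply (measurable_blowUpPoint _ _) hmeas]
    calc _ ≤ (μ : Measure Plane) {x | M ≤ Ψ k x} := by
          refine measure_mono fun x hx => ?_
          by_contra hlt
          exact hx (subset_closure (mem_iUnion.2 ⟨k, x, show Ψ k x ≤ M from (not_le.1 hlt).le, rfl⟩))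
      _ ≤ (∫⁻ x, Ψ k x ∂(μ : Measure Plane)) / M :=
          meas_ge_le_lintegral_div (hΨm k).aemeasurable hM0 hMt
      _ ≤ D / M := ENNReal.div_le_div_right (hpen k) _
      _ ≤ δ := by
          refine ENNReal.div_le_of_le_mul ?_
          rw [hMdef, ENNReal.mul_div_cancel hδ.ne' hδt]
          exact le_self_add

end BlowUp

/-! ### Invariance of the limits -/

section Invariance

open scoped ENNReal BoundedContinuousFunction

theorem tendsto_integral_norm_sub_translate {g : Plane → ℝ} (hg : Integrable g)
    {c : ℕ → Plane} (hc : Tendsto c atTop (𝓝 0)) :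
    Tendsto (fun k => ∫ x, ‖g (x - c k) - g x‖) atTop (𝓝 0) := by
  set G : Lp ℝ 1 (volume : Measure Plane) := hg.toL1 g with hG
  set τ : Plane → C(Plane, Plane) := fun a => ⟨fun x => x - a, by fun_prop⟩
  have hτ : Continuous τ := ContinuousMap.continuous_of_continuous_uncurry _
    (by unfold Function.uncurry; exact continuous_snd.sub continuous_fst)
  have hmp : ∀ a, MeasurePreserving (τ a) (volume : Measure Plane) volume := fun a =>
    measurePreserving_sub_right volume a
  have h1 : Tendsto (fun k => Lp.compMeasurePreserving (τ (c k)) (hmp (c k)) G) atTop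
      (𝓝 (Lp.compMeasurePreserving (τ 0) (hmp 0) G)) :=
    Tendsto.compMeasurePreservingLp tendsto_const_nhds ((hτ.tendsto 0).comp hc) _ _
      ENNReal.one_ne_top
  have hG0 : ∀ a, Lp.compMeasurePreserving (τ a) (hmp a) G =ᵐ[volume] fun x => g (x - a) :=
    fun a => (Lp.coeFn_compMeasurePreserving G (hmp a)).trans
      ((hmp a).quasiMeasurePreserving.ae_eq hg.coeFn_toL1)
  have h2 := tendsto_iff_norm_sub_tendsto_zero.1 h1
  refine h2.congr fun k => ?_
  rw [L1.norm_eq_integral_norm]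
  refine integral_congr_ae ?_
  filter_upwards [Lp.coeFn_sub (Lp.compMeasurePreserving (τ (c k)) (hmp (c k)) G)
    (Lp.compMeasurePreserving (τ 0) (hmp 0) G), hG0 (c k), hG0 0] with x hx1 hx2 hx3
  rw [hx1, Pi.sub_apply, hx2, hx3, sub_zero]

variable {X : Type*} [TopologicalSpace X] [PolishSpace X] [MeasurableSpace X] [BorelSpace X]
  [AddAction Plane X] [ContinuousVAdd Plane X]

omit [PolishSpace X] [MeasurableSpace X] [BorelSpace X] in
-- The action of a amounts to shifting x by εa. A change of variables transfers this shift to g,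
-- leaving an error of at most ‖ψ‖ times the L¹ distance between g and its translate.
theorem tendsto_integral_blowUp_sub {g : Plane → ℝ} (hg : Integrable g) (ψ : X →ᵇ ℝ)
    {ε : ℕ → ℝ} (hε0 : ∀ k, ε k ≠ 0) (hε : Tendsto ε atTop (𝓝 0)) (u : ℕ → X) (a : Plane) :
    Tendsto (fun k => (∫ x, g x * ψ (a +ᵥ (((ε k)⁻¹ • x) +ᵥ u k))) -
      ∫ x, g x * ψ (((ε k)⁻¹ • x) +ᵥ u k)) atTop (𝓝 0) := by
  have hc : Tendsto (fun k => ε k • a) atTop (𝓝 0) := by simpa using hε.smul_const a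
  have h1 := (tendsto_integral_norm_sub_translate hg hc).const_mul ‖ψ‖
  rw [mul_zero] at h1
  refine squeeze_zero_norm (fun k => ?_) h1
  set S : Plane → ℝ := fun x => ψ (((ε k)⁻¹ • x) +ᵥ u k) with hS
  have hSc : Continuous S := ψ.continuous.comp (by fun_prop)
  have hSb : ∀ x, ‖S x‖ ≤ ‖ψ‖ := fun x => ψ.norm_coe_le_norm _
  have hshift : ∀ x, ψ (a +ᵥ (((ε k)⁻¹ • x) +ᵥ u k)) = S (x + ε k • a) := fun x => by
    simp only [hS]
    rw [smul_add, smul_smul, inv_mul_cancel₀ (hε0 k), one_smul, add_comm, add_vadd]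
  have hgk : Integrable fun x => g (x - ε k • a) := hg.comp_sub_right _
  have h2 : ∫ x, g x * ψ (a +ᵥ (((ε k)⁻¹ • x) +ᵥ u k)) = ∫ x, g (x - ε k • a) * S x := by
    simp_rw [hshift]
    rw [← integral_sub_right_eq_self (fun x => g x * S (x + ε k • a)) (ε k • a)]
    simp
  have hm : ∀ {q : Plane → ℝ}, Integrable q → Integrable fun x => q x * S x := fun hq =>
    hq.mul_bdd (c := ‖ψ‖) hSc.aestronglyMeasurable (Eventually.of_forall hSb)
  rw [h2, ← integral_sub (hm hgk) (hm hg), ← integral_const_mul]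
  refine (norm_integral_le_integral_norm _).trans (integral_mono_of_nonneg
    (Eventually.of_forall fun x => norm_nonneg _) ((hgk.sub hg).norm.const_mul _)
    (Eventually.of_forall fun x => ?_))
  change ‖g (x - ε k • a) * S x - g x * S x‖ ≤ ‖ψ‖ * ‖g (x - ε k • a) - g x‖
  rw [← sub_mul, norm_mul, mul_comm]
  gcongr
  exact hSb x

/-- A weak limit of the laws of the blow-ups is invariant under each translation. -/
theorem map_vadd_eq_of_tendsto_blowUpLaw {μ : ProbabilityMeasure Plane} {W : Plane → ℝ≥0∞}
    (hW : Measurable W) (hWt : ∀ x, W x < ∞) (hμ : (μ : Measure Plane) = volume.withDensity W)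
    {ε : ℕ → ℝ} (hε0 : ∀ k, ε k ≠ 0) (hε : Tendsto ε atTop (𝓝 0)) {u : ℕ → X}
    {P : ProbabilityMeasure (Plane × X)}
    (hP : Tendsto (fun k => blowUpLaw μ (ε k) (u k)) atTop (𝓝 P)) (a : Plane) :
    (P : Measure (Plane × X)).map (fun p => (p.1, a +ᵥ p.2)) = P := by
  have hTc : Continuous fun p : Plane × X => (p.1, a +ᵥ p.2) := by fun_prop
  have hprob := Measure.isProbabilityMeasure_map (μ := (P : Measure (Plane × X)))
    hTc.aemeasurable
  refine Measure.ext_of_integral_mul_boundedContinuousFunction fun φ ψ => ?_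
  rw [integral_map hTc.aemeasurable (by
    refine Continuous.aestronglyMeasurable ?_
    fun_prop)]
  set Φ : Plane × X →ᵇ ℝ := φ.compContinuous ⟨Prod.fst, continuous_fst⟩ *
    ψ.compContinuous ⟨Prod.snd, continuous_snd⟩ with hΦ
  set Φa : Plane × X →ᵇ ℝ := Φ.compContinuous ⟨_, hTc⟩ with hΦa
  have hlim := ProbabilityMeasure.tendsto_iff_forall_integral_tendsto.1 hP
  have h1 := hlim Φa
  have h2 := hlim Φ
  -- A measure on the product is determined by test functions φ(x)ψ(u). The translation does not
  -- move x, so φ can be absorbed into the density.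
  set g : Plane → ℝ := fun x => (W x).toReal * φ x with hg
  have hWi : Integrable fun x => (W x).toReal := by
    refine integrable_toReal_of_lintegral_ne_top hW.aemeasurable ?_
    rw [← setLIntegral_univ, ← withDensity_apply _ MeasurableSet.univ, ← hμ, measure_univ]
    exact ENNReal.one_ne_top
  have hgi : Integrable g := hWi.mul_bdd (c := ‖φ‖) φ.continuous.aestronglyMeasurable
    (Eventually.of_forall fun x => φ.norm_coe_le_norm x)
  have hint : ∀ (k : ℕ) (Ξ : Plane × X →ᵇ ℝ),
      ∫ p, Ξ p ∂(blowUpLaw μ (ε k) (u k) : Measure (Plane × X)) =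
        ∫ x, (W x).toReal * Ξ (blowUpPoint (ε k) (u k) x) := by
    intro k Ξ
    rw [blowUpLaw_toMeasure, integral_map (measurable_blowUpPoint _ _).aemeasurable
      Ξ.continuous.aestronglyMeasurable, hμ, integral_withDensity_eq_integral_toReal_smul hW
      (Eventually.of_forall hWt)]
    rfl
  have h3 : Tendsto (fun k => ∫ p, Φa p ∂(blowUpLaw μ (ε k) (u k) : Measure (Plane × X)) -
      ∫ p, Φ p ∂(blowUpLaw μ (ε k) (u k) : Measure (Plane × X))) atTop (𝓝 0) := by
    refine (tendsto_integral_blowUp_sub hgi ψ hε0 hε u a).congr fun k => ?_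
    rw [hint, hint]
    congr 1
    · refine integral_congr_ae (Eventually.of_forall fun x => ?_)
      exact mul_assoc _ _ _
    · refine integral_congr_ae (Eventually.of_forall fun x => ?_)
      exact mul_assoc _ _ _
  have h4 := tendsto_nhds_unique (h1.sub h2) h3
  exact sub_eq_zero.1 h4

/-- Invariance under each translation implies invariance under translations depending on the base
point. -/
theorem map_vadd_fst_eq_of_forall {P : Measure (Plane × X)} [IsProbabilityMeasure P]
    (hP : ∀ a : Plane, P.map (fun p => (p.1, a +ᵥ p.2)) = P) {l : Plane → Plane}
    (hl : Measurable l) : P.map (fun p => (p.1, l p.1 +ᵥ p.2)) = P := by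
  have hjm : ∀ {s : Plane → Plane}, Measurable s →
      Measurable fun p : Plane × X => (p.1, s p.1 +ᵥ p.2) := fun hs => by
    have hv : Continuous fun q : Plane × X => q.1 +ᵥ q.2 := by fun_prop
    exact measurable_fst.prodMk
      (hv.measurable.comp ((hs.comp measurable_fst).prodMk measurable_snd))
  -- On each level set of s the translation is constant, and the level set, depending on x alone, is
  -- preserved by it. The general case follows by dominated convergence.
  have hsimple : ∀ s : SimpleFunc Plane Plane, P.map (fun p => (p.1, s p.1 +ᵥ p.2)) = P := by
    intro s
    ext A hA
    have hfib : ∀ c, MeasurableSet ((fun p : Plane × X => s p.1) ⁻¹' {c}) := fun c =>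
      (s.measurable.comp measurable_fst) (measurableSet_singleton c)
    have hsum : ∀ B : Set (Plane × X), P B =
        ∑ c ∈ s.range, P ((fun p : Plane × X => s p.1) ⁻¹' {c} ∩ B) := by
      intro B
      have h1 := sum_measure_preimage_singleton (μ := P.restrict B) s.range
        (f := fun p : Plane × X => s p.1) (fun c _ => hfib c)
      simp_rw [fun c => Measure.restrict_apply (μ := P) (s := B) (hfib c)] at h1
      rw [h1]
      have : (fun p : Plane × X => s p.1) ⁻¹' (s.range : Set Plane) = univ := by
        ext p
        simp
      rw [this, Measure.restrict_apply_univ]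
    rw [Measure.map_apply (hjm s.measurable) hA, hsum, hsum A]
    refine Finset.sum_congr rfl fun c _ => ?_
    have hcm : Measurable fun p : Plane × X => (p.1, c +ᵥ p.2) := hjm (s := fun _ => c)
      measurable_const
    rw [← hP c, Measure.map_apply hcm ((hfib c).inter hA), hP c]
    congr 1
    ext p
    simp only [mem_inter_iff, mem_preimage, mem_singleton_iff]
    exact and_congr_right fun hp => by rw [hp]
  have hprob : ∀ {s : Plane → Plane}, Measurable s →
      IsProbabilityMeasure (P.map (fun p => (p.1, s p.1 +ᵥ p.2))) := fun hs =>
    Measure.isProbabilityMeasure_map (hjm hs).aemeasurable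
  have := hprob hl
  refine ext_of_forall_integral_eq_of_IsFiniteMeasure fun Φ => ?_
  rw [integral_map (hjm hl).aemeasurable Φ.continuous.aestronglyMeasurable]
  have hlim : Tendsto (fun n => ∫ p, Φ (p.1, hl.stronglyMeasurable.approx n p.1 +ᵥ p.2) ∂P) atTop
      (𝓝 (∫ p, Φ (p.1, l p.1 +ᵥ p.2) ∂P)) := by
    refine tendsto_integral_of_dominated_convergence (fun _ => ‖Φ‖)
      (fun n => (Φ.continuous.measurable.comp
        (hjm (hl.stronglyMeasurable.approx n).measurable)).aestronglyMeasurable)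
      (integrable_const _)
      (fun n => Eventually.of_forall fun p => Φ.norm_coe_le_norm _)
      (Eventually.of_forall fun p => ?_)
    have h1 := hl.stronglyMeasurable.tendsto_approx p.1
    have hv : Continuous fun a : Plane => Φ (p.1, a +ᵥ p.2) := Φ.continuous.comp (by fun_prop)
    exact (hv.tendsto _).comp h1
  refine tendsto_nhds_unique hlim (tendsto_const_nhds.congr fun n => ?_)
  conv_lhs => rw [← hsimple (hl.stronglyMeasurable.approx n)]
  rw [integral_map (hjm (hl.stronglyMeasurable.approx n).measurable).aemeasurable
    Φ.continuous.aestronglyMeasurable]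

end Invariance

/-! ### The lower bound and the ergodic averages -/

section LowerBound

open scoped ENNReal

variable {X : Type*} [TopologicalSpace X] [PolishSpace X] [MeasurableSpace X] [BorelSpace X]
  [AddAction Plane X] [ContinuousVAdd Plane X]
  {E : Set ℝ} {f : ℝ → Plane → X → EReal} {f₀ : Plane → X → EReal} {h : Plane → ℝ}
  {U : Set Plane} {w : Plane → ℝ} {χ : Plane → ℝ≥0∞}

theorem EReal.toENNReal_add_le_of_le_liminf {a : EReal} {b : ℕ → EReal} {c : ℕ → ℝ} {c₀ : ℝ}
    {t : ℝ≥0∞} (ht : t ≠ ∞) (hc : Tendsto c atTop (𝓝 c₀)) (ha : a ≤ liminf b atTop)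
    (hb : ∀ j, (b j + (c j : EReal)).toENNReal ≤ t) : (a + (c₀ : EReal)).toENNReal ≤ t := by
  lift t to NNReal using ht
  have hbt : ∀ j, b j ≤ (((t : ℝ) - c j : ℝ) : EReal) := fun j => by
    have h1 : b j + (c j : EReal) ≤ ((t : ℝ) : EReal) := by
      refine (le_max_right 0 _).trans ?_
      rw [← EReal.coe_toENNReal_eq_max]
      exact EReal.coe_ennreal_le_coe_ennreal_iff.2 (hb j)
    have h2 := EReal.le_sub_iff_add_le (Or.inl (EReal.coe_ne_bot (c j)))
      (Or.inl (EReal.coe_ne_top (c j))) |>.2 h1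
    rwa [← EReal.coe_sub] at h2
  have hlim : Tendsto (fun j => (((t : ℝ) - c j : ℝ) : EReal)) atTop
      (𝓝 (((t : ℝ) - c₀ : ℝ) : EReal)) :=
    (continuous_coe_real_ereal.tendsto _).comp (hc.const_sub _)
  have ha' : a ≤ (((t : ℝ) - c₀ : ℝ) : EReal) :=
    (ha.trans (liminf_le_liminf (Eventually.of_forall hbt))).trans hlim.liminf_eq.le
  have h3 : a + (c₀ : EReal) ≤ ((t : ℝ) : EReal) := by
    refine (add_le_add_left ha' _).trans ?_
    rw [← EReal.coe_add]
    exact EReal.coe_le_coe_iff.2 (_root_.sub_add_cancel (t : ℝ) c₀).le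
  refine (EReal.toENNReal_le_toENNReal h3).trans ?_
  rw [EReal.real_coe_toENNReal, ENNReal.ofReal_coe_nnreal]

/-- The Γ-liminf inequality is available only where the penalization is bounded. Adding η times the
penalization turns a bound t on the sum into a bound t/η on it, at the cost of at most ηD in the
integral; then η → 0. -/
theorem lintegral_le_liminf_lintegral_blowUpEnergy {μ : ProbabilityMeasure Plane}
    (hE : E ⊆ Ioi 0) (hcoer : IsCoerciveGammaLiminf E f f₀)
    (hcont : Continuous h) (hU : IsOpen U) (hw : Continuous w) (hw0 : ∀ x, 0 < w x)
    (hχ : ∀ M : ℝ≥0∞, M ≠ ∞ → ∃ K, IsCompact K ∧ K ⊆ U ∧ ∀ x, χ x ≤ M → x ∈ K)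
    {ε : ℕ → ℝ} (hεE : ∀ j, ε j ∈ E) (hε : Tendsto ε atTop (𝓝 0)) {u : ℕ → X} {D : ℝ≥0∞}
    (hD : D ≠ ∞) (hχm : Measurable χ) (hf : ∀ ε ∈ E, Measurable fun p : Plane × X => f ε p.1 p.2)
    (hf₀ : Measurable fun p : Plane × X => f₀ p.1 p.2)
    (hpen : ∀ k, ∫⁻ x, penalty χ (U.indicator fun y => ENNReal.ofReal (w y)) (ε k)
      (blowUpEnergy f h (ε k) (u k)) x ∂(μ : Measure Plane) ≤ D)
    {P : ProbabilityMeasure (Plane × X)}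
    (hP : Tendsto (fun k => blowUpLaw μ (ε k) (u k)) atTop (𝓝 P)) :
    ∫⁻ p, (f₀ p.1 p.2 + (h p.1 : EReal)).toENNReal ∂(P : Measure (Plane × X)) ≤
      liminf (fun k => ∫⁻ x, blowUpEnergy f h (ε k) (u k) x ∂(μ : Measure Plane)) atTop := by
  set Ψ : ℕ → Plane → ℝ≥0∞ := fun k => penalty χ (U.indicator fun y => ENNReal.ofReal (w y)) (ε k)
      (blowUpEnergy f h (ε k) (u k)) with hΨ
  have hFm : ∀ k, Measurable (blowUpEnergy f h (ε k) (u k)) := fun k =>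
    measurable_blowUpEnergy (hf _ (hεE k)) hcont.measurable _
  have hΨm : ∀ k, Measurable (Ψ k) := fun k => measurable_penalty hχm
    (hw.measurable.ennreal_ofReal.indicator hU.measurableSet) (hFm k) _
  have hGm : Measurable fun p : Plane × X => (f₀ p.1 p.2 + (h p.1 : EReal)).toENNReal :=
    (hf₀.add (hcont.measurable.comp measurable_fst).coe_real_ereal).ereal_toENNReal
  have key : ∀ η : ℝ≥0∞, η ≠ 0 → η ≠ ∞ →
      ∫⁻ p, (f₀ p.1 p.2 + (h p.1 : EReal)).toENNReal ∂(P : Measure (Plane × X)) ≤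
      liminf (fun k => ∫⁻ x, blowUpEnergy f h (ε k) (u k) x ∂(μ : Measure Plane)) atTop +
        η * D := by
    intro η hη hηt
    refine (lintegral_le_liminf_lintegral_of_forall_seq (μ := (μ : Measure Plane))
      (fun k => measurable_blowUpPoint (ε k) (u k)) (fun k => blowUpLaw_toMeasure μ (ε k) (u k)) hP
      (g := fun k x => blowUpEnergy f h (ε k) (u k) x + η * Ψ k x)
      (fun k => (hFm k).add ((hΨm k).const_mul η)) hGm ?_).trans ?_
    · intro k x p t ht hk hle hlim
      have hpt : ∀ j, penalty χ (U.indicator fun y => ENNReal.ofReal (w y)) (ε (k j))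
          (blowUpEnergy f h (ε (k j)) (u (k j))) (x j) ≤ η⁻¹ * t := fun j => by
        rw [← ENNReal.mul_le_iff_le_inv hη hηt]
        exact le_add_self.trans (hle j)
      have hlow := le_liminf_of_tendsto_blowUpPoint (ε := ε ∘ k) (u := u ∘ k) (x := x) hE hcoer
        hcont hU hw hw0 hχ (ENNReal.mul_ne_top (ENNReal.inv_ne_top.2 hη) ht)
        (fun j => hεE _) (hε.comp hk) hpt hlim
      refine EReal.toENNReal_add_le_of_le_liminf (c := fun j => h (x j)) ht ?_ hlow
        fun j => le_self_add.trans (hle j)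
      exact (hcont.tendsto _).comp ((continuous_fst.tendsto p).comp hlim)
    · rw [← liminf_add_const atTop _ _ (by isBoundedDefault) (by isBoundedDefault)]
      refine liminf_le_liminf (Eventually.of_forall fun k => ?_)
      change ∫⁻ x, _ ∂_ ≤ _
      rw [lintegral_add_left (hFm k), lintegral_const_mul _ (hΨm k)]
      gcongr
      exact hpen k
  refine ENNReal.le_of_forall_pos_le_add fun δ hδ _ => ?_
  have hD1 : D + 1 ≠ 0 := by simp
  refine (key (δ / (D + 1)) (ENNReal.div_ne_zero.2 ⟨by simpa using hδ.ne', by finiteness⟩)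
    (ENNReal.div_ne_top ENNReal.coe_ne_top hD1)).trans ?_
  gcongr
  rw [mul_comm, ← mul_div_assoc]
  refine ENNReal.div_le_of_le_mul ?_
  rw [mul_comm]
  gcongr
  exact le_self_add

theorem liminf_rescaledFunctional {μ : ProbabilityMeasure Plane}
    (hf : ∀ ε ∈ E, Measurable fun p : Plane × X => f ε p.1 p.2)
    (hint : Integrable h (μ : Measure Plane))
    (hbelow : ∀ ε ∈ E, ∀ (x : Plane) (v : X), ((-h x : ℝ) : EReal) ≤ f ε x v)
    {ε : ℕ → ℝ} (hεE : ∀ j, ε j ∈ E) (u : ℕ → X) :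
    liminf (fun k => rescaledFunctional μ f (ε k) (u k)) atTop =
      ((liminf (fun k => ∫⁻ x, blowUpEnergy f h (ε k) (u k) x ∂(μ : Measure Plane)) atTop
        : ℝ≥0∞) : EReal) - ((∫ x, h x ∂(μ : Measure Plane) : ℝ) : EReal) := by
  set r : ℝ := ∫ x, h x ∂(μ : Measure Plane)
  have hmono : Monotone fun a : ℝ≥0∞ => (a : EReal) - (r : EReal) := fun a b hab =>
    EReal.sub_le_sub (EReal.coe_ennreal_le_coe_ennreal_iff.2 hab) le_rfl
  have hcts : Continuous fun a : ℝ≥0∞ => (a : EReal) - (r : EReal) := by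
    refine continuous_iff_continuousAt.2 fun a => ?_
    simp_rw [sub_eq_add_neg, ← EReal.coe_neg]
    exact (EReal.continuousAt_add (p := ((a : EReal), ((-r : ℝ) : EReal)))
      (Or.inr (EReal.coe_ne_bot _)) (Or.inr (EReal.coe_ne_top _))).tendsto.comp
      ((continuous_coe_ennreal_ereal.tendsto a).prodMk_nhds tendsto_const_nhds)
  rw [hmono.map_liminf_of_continuousAt _ hcts.continuousAt]
  congr 1
  ext k
  exact eintegral_eq_lintegral_add_sub (measurable_comp_blowUpPoint (hf _ (hεE k)) _) hint
    fun x => hbelow _ (hεE k) x _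

theorem eaverage_closedBall_eq {Y : Type*} (T : Plane → Y → Y) (g : Y → EReal) (R : ℝ) (y : Y) :
    eaverage (volume : Measure Plane) (Metric.closedBall (0 : Plane) R) (fun l => g (T l y)) =
      (ballAverage T R (fun y => (g y).toENNReal) y : EReal) -
        (ballAverage T R (fun y => (-g y).toENNReal) y : EReal) := by
  unfold eaverage eintegral ballAverage
  rw [lintegral_smul_measure, lintegral_smul_measure, smul_eq_mul, smul_eq_mul]

/-- The ergodic theorem for functions whose positive part is integrable. -/
theorem exists_tendsto_eaverage {Y : Type*} [MeasurableSpace Y] {T : Plane → Y → Y}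
    {P : Measure Y} [IsProbabilityMeasure P] (hT : IsMeasurePreservingFlow T P) {g : Y → EReal}
    (hg : Measurable g) (hfin : ∫⁻ y, (g y).toENNReal ∂P ≠ ∞) :
    ∃ g' : Y → EReal, Measurable g' ∧ (∀ᵐ y ∂P, Tendsto (fun R : ℝ =>
      eaverage (volume : Measure Plane) (Metric.closedBall (0 : Plane) R) (fun l => g (T l y)))
      atTop (𝓝 (g' y))) ∧ eintegral P g = eintegral P g' := by
  -- The two parts are treated separately, the second possibly with infinite integral. Almost
  -- everywhere the limit of the first is finite, so the difference never meets ∞ − ∞.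
  obtain ⟨a, ha, haint, halim⟩ := exists_tendsto_ballAverage hT hg.ereal_toENNReal
  obtain ⟨b, hb, hbint, hblim⟩ := exists_tendsto_ballAverage hT hg.neg.ereal_toENNReal
  have hafin : ∫⁻ y, a y ∂P ≠ ∞ := haint ▸ hfin
  refine ⟨fun y => (a y : EReal) - b y, ha.coe_ereal_ennreal.sub hb.coe_ereal_ennreal, ?_, ?_⟩
  · filter_upwards [halim, hblim, ae_lt_top ha hafin] with y hya hyb hlt
    simp_rw [eaverage_closedBall_eq, sub_eq_add_neg]
    have h1 : ((a y : ℝ≥0∞) : EReal) ≠ ⊤ := by simpa using hlt.ne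
    have h2 : ((a y : ℝ≥0∞) : EReal) ≠ ⊥ := EReal.coe_ennreal_ne_bot _
    exact (EReal.continuousAt_add (p := ((a y : EReal), -(b y : EReal))) (Or.inl h1)
      (Or.inl h2)).tendsto.comp
      (((continuous_coe_ennreal_ereal.tendsto _).comp hya).prodMk_nhds
        ((continuous_neg.tendsto _).comp
          ((continuous_coe_ennreal_ereal.tendsto _).comp hyb)))
  · rw [eintegral_coe_sub_coe ha hb hafin, haint, hbint]
    rfl

end LowerBound

/-! ### Properties of the blow-up laws -/

section Limits

open scoped ENNReal

variable {X : Type*} [TopologicalSpace X] [PolishSpace X] [MeasurableSpace X] [BorelSpace X]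
  [AddAction Plane X] [ContinuousVAdd Plane X]

theorem exists_subseq_tendsto_of_isTightMeasureSet {Z : Type*} [TopologicalSpace Z] [PolishSpace Z]
    [MeasurableSpace Z] [BorelSpace Z] {Q : ℕ → ProbabilityMeasure Z}
    (hQ : IsTightMeasureSet (range fun k => (Q k : Measure Z))) :
    ∃ (φ : ℕ → ℕ) (P : ProbabilityMeasure Z), StrictMono φ ∧
      Tendsto (fun k => Q (φ k)) atTop (𝓝 P) := by
  have hset : {((ν : ProbabilityMeasure Z) : Measure Z) | ν ∈ range Q} =
      range fun k => (Q k : Measure Z) := by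
    ext ν
    simp
  have hc : IsCompact (closure (range Q)) :=
    isCompact_closure_of_isTightMeasureSet (by rwa [hset])
  obtain ⟨P, -, φ, hφ, hlim⟩ := hc.tendsto_subseq fun k => subset_closure (mem_range_self k)
  exact ⟨φ, P, hφ, hlim⟩

theorem map_fst_eq_of_tendsto_blowUpLaw {μ : ProbabilityMeasure Plane} {ε : ℕ → ℝ} {u : ℕ → X}
    {P : ProbabilityMeasure (Plane × X)}
    (hP : Tendsto (fun k => blowUpLaw μ (ε k) (u k)) atTop (𝓝 P)) :
    (P : Measure (Plane × X)).map Prod.fst = (μ : Measure Plane) := by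
  have h1 := ProbabilityMeasure.tendsto_map_of_tendsto_of_continuous _ _ hP
    (continuous_fst : Continuous (Prod.fst : Plane × X → Plane))
  have h2 : ∀ k, (blowUpLaw μ (ε k) (u k)).map
      (continuous_fst : Continuous (Prod.fst : Plane × X → Plane)).aemeasurable = μ := fun k => by
    refine Subtype.ext ?_
    change ((μ : Measure Plane).map (blowUpPoint (ε k) (u k))).map Prod.fst = μ
    rw [Measure.map_map measurable_fst (measurable_blowUpPoint _ _)]
    exact Measure.map_id
  simp_rw [h2] at h1
  have h3 : P.map (continuous_fst : Continuous (Prod.fst : Plane × X → Plane)).aemeasurable = μ :=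
    tendsto_nhds_unique h1 tendsto_const_nhds
  exact congrArg (fun ν : ProbabilityMeasure Plane => (ν : Measure Plane)) h3

theorem isMeasurePreservingFlow_vadd_snd {P : Measure (Plane × X)}
    (hP : ∀ a : Plane, P.map (fun p => (p.1, a +ᵥ p.2)) = P) :
    IsMeasurePreservingFlow (fun (a : Plane) (p : Plane × X) => (p.1, a +ᵥ p.2)) P where
  measurable := by
    have : Continuous fun q : Plane × (Plane × X) => (q.2.1, q.1 +ᵥ q.2.2) := by fun_prop
    exact this.measurable
  map_add a b p := by rw [add_vadd]
  measurePreserving a := by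
    have : Continuous fun p : Plane × X => (p.1, a +ᵥ p.2) := by fun_prop
    exact ⟨this.measurable, hP a⟩

end Limits

end

/-! ### Assembly of the theorem -/

theorem mainTheorem4 {X : Type*} [TopologicalSpace X] [PolishSpace X] [MeasurableSpace X]
    [BorelSpace X] [AddAction Plane X] [ContinuousVAdd Plane X]
    (V : Plane → ℝ) (hV : IsAdmissible V)
    (μ : ProbabilityMeasure Plane) (hμ : IsEquilibriumMeasure (fun x => (V x : EReal)) μ)
    (E : Set ℝ) (hE : E ⊆ Ioi 0)
    (f : ℝ → Plane → X → EReal) (f₀ : Plane → X → EReal)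
    (hf : ∀ ε ∈ E, Measurable (fun p : Plane × X => f ε p.1 p.2))
    (hf₀ : Measurable (fun p : Plane × X => f₀ p.1 p.2))
    (h : Plane → ℝ) (hcont : Continuous h) (hint : Integrable h (μ : Measure Plane))
    (hbelow : ∀ ε ∈ E, ∀ (x : Plane) (v : X), ((-h x : ℝ) : EReal) ≤ f ε x v)
    (hcoer : IsCoerciveGammaLiminf E f f₀)
    (u : ℝ → X) (C : ℝ) (hu : ∀ ε ∈ E, rescaledFunctional μ f ε (u ε) ≤ (C : EReal)) :
    -- compactness, along every sequence of parameters tending to zero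
    (∀ ε : ℕ → ℝ, (∀ k, ε k ∈ E) → Tendsto ε atTop (𝓝 0) →
      IsTightMeasureSet
        (range fun k => ((blowUpLaw μ (ε k) (u (ε k))) : Measure (Plane × X))) ∧
      ∃ (φ : ℕ → ℕ) (P : ProbabilityMeasure (Plane × X)), StrictMono φ ∧
        Tendsto (fun k => blowUpLaw μ (ε (φ k)) (u (ε (φ k)))) atTop (𝓝 P)) ∧
    -- properties of every limit
    (∀ (ε : ℕ → ℝ) (P : ProbabilityMeasure (Plane × X)), (∀ k, ε k ∈ E) →
      Tendsto ε atTop (𝓝 0) →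
      Tendsto (fun k => blowUpLaw μ (ε k) (u (ε k))) atTop (𝓝 P) →
      Measure.map Prod.fst (P : Measure (Plane × X)) = (μ : Measure Plane) ∧
      IsTranslationInvariant (P : Measure (Plane × X)) ∧
      (∀ᵐ p ∂(P : Measure (Plane × X)), ∃ y : ℕ → Plane,
        Tendsto (fun k => (y k, ((ε k)⁻¹ • y k) +ᵥ u (ε k))) atTop (𝓝 p)) ∧
      eintegral (P : Measure (Plane × X)) (fun p => f₀ p.1 p.2) ≤
        liminf (fun k => rescaledFunctional μ f (ε k) (u (ε k))) atTop ∧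
      ∃ g : Plane × X → EReal, Measurable g ∧
        (∀ᵐ p ∂(P : Measure (Plane × X)),
          Tendsto (fun R : ℝ => eaverage (volume : Measure Plane)
            (Metric.closedBall (0 : Plane) R) (fun l => f₀ p.1 (l +ᵥ p.2))) atTop (𝓝 (g p))) ∧
        eintegral (P : Measure (Plane × X)) (fun p => f₀ p.1 p.2) =
          eintegral (P : Measure (Plane × X)) g) := by
  obtain ⟨U, w, b, hU, hw, hw0, hwb, hdens⟩ := hV.exists_density hμ
  set W : Plane → ENNReal := U.indicator fun y => ENNReal.ofReal (w y)
  have hwm : Measurable fun y => ENNReal.ofReal (w y) := hw.measurable.ennreal_ofReal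
  have hWm : Measurable W := hwm.indicator hU.measurableSet
  have hWb : ∀ x, W x ≤ ENNReal.ofReal b := fun x =>
    (indicator_le_self _ _ x).trans (ENNReal.ofReal_le_ofReal (hwb x))
  have hμW : (μ : Measure Plane) = volume.withDensity W := by
    rw [hdens, withDensity_indicator hU.measurableSet]
  have hμU : (μ : Measure Plane) Uᶜ = 0 := by
    rw [hdens]
    refine withDensity_absolutelyContinuous _ _ ?_
    rw [Measure.restrict_apply hU.measurableSet.compl, compl_inter_self, measure_empty]
  obtain ⟨χ, hχm, hχint, hχ⟩ := exists_exhaustion hU.measurableSet hμU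
  set A : ENNReal := ENNReal.ofReal (C + ∫ x, h x ∂(μ : Measure Plane))
  set D : ENNReal := ∫⁻ x, χ x ∂(μ : Measure Plane) + 2 * (ENNReal.ofReal b * A)
  have hD : D ≠ ⊤ := by finiteness
  have hA : ∀ ε ∈ E, ∫⁻ x, blowUpEnergy f h ε (u ε) x ∂(μ : Measure Plane) ≤ A := fun ε hε =>
    lintegral_blowUpEnergy_le hf hint hbelow hε (hu ε hε)
  have hpen : ∀ ε ∈ E, ∫⁻ x, penalty χ W ε (blowUpEnergy f h ε (u ε)) x ∂(μ : Measure Plane) ≤ D :=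
    fun ε hε => by
      have h1 := lintegral_penalty_le hWm (measurable_blowUpEnergy (hf ε hε) hcont.measurable (u ε))
        hχm hWb ε
      rw [← hμW] at h1
      exact h1.trans (add_le_add le_rfl (mul_le_mul' le_rfl (mul_le_mul' le_rfl (hA ε hε))))
  refine ⟨fun ε hεE hε => ?_, fun ε P hεE hε hP => ?_⟩
  · have htight := isTightMeasureSet_blowUpLaw (u := fun k => u (ε k)) hE hcoer hcont hU hw hw0 hχ
      hεE hε hD hχm hf fun k => hpen _ (hεE k)
    exact ⟨htight, exists_subseq_tendsto_of_isTightMeasureSet htight⟩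
  have hfst := map_fst_eq_of_tendsto_blowUpLaw hP
  have hinv := map_vadd_eq_of_tendsto_blowUpLaw hWm
    (fun x => (hWb x).trans_lt ENNReal.ofReal_lt_top) hμW (fun k => (hE (hεE k)).ne') hε hP
  have hhm : Measurable fun p : Plane × X => h p.1 := hcont.measurable.comp measurable_fst
  -- As the first marginal of `P` is `μ`, the correction h has the same integral before and in the
  -- limit, and it cancels in the lower bound.
  have hhint : Integrable (fun p : Plane × X => h p.1) (P : Measure (Plane × X)) := by
    rw [← hfst] at hint
    exact hint.comp_measurable measurable_fst
  have hhP : ∫ p, h p.1 ∂(P : Measure (Plane × X)) = ∫ x, h x ∂(μ : Measure Plane) := by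
    rw [← hfst, integral_map measurable_fst.aemeasurable hcont.aestronglyMeasurable]
  have hlow := lintegral_le_liminf_lintegral_blowUpEnergy (u := fun k => u (ε k)) hE hcoer hcont
    hU hw hw0 hχ hεE hε hD hχm hf hf₀ (fun k => hpen _ (hεE k)) hP
  refine ⟨hfst, fun l hl => map_vadd_fst_eq_of_forall hinv hl.continuous.measurable,
    ae_exists_tendsto_of_tendsto_map (fun k => measurable_blowUpPoint (ε k) (u (ε k)))
      (fun k => blowUpLaw_toMeasure μ (ε k) (u (ε k))) hP, ?_, ?_⟩
  · rw [liminf_rescaledFunctional hf hint hbelow hεE fun k => u (ε k), ← hhP]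
    refine (eintegral_le_lintegral_add_sub hf₀ hhm hhint).trans ?_
    exact EReal.sub_le_sub (EReal.coe_ennreal_le_coe_ennreal_iff.2 hlow) le_rfl
  -- The lower bound together with the uniform energy bound makes the positive part of the limit
  -- energy integrable, up to h⁻. This is what makes its integral meaningful and the ergodic theorem
  -- applicable.
  · have hfin : ∫⁻ p, (f₀ p.1 p.2).toENNReal ∂(P : Measure (Plane × X)) ≠ ⊤ := by
      have hlim : liminf (fun k => ∫⁻ x, blowUpEnergy f h (ε k) (u (ε k)) x ∂(μ : Measure Plane))
          atTop ≤ A :=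
        (liminf_le_liminf (Eventually.of_forall fun k => hA _ (hεE k))).trans (liminf_const A).le
      refine ne_top_of_le_ne_top (b := A + ∫⁻ p, ENNReal.ofReal (-h p.1) ∂(P : Measure (Plane × X)))
        (ENNReal.add_ne_top.2 ⟨ENNReal.ofReal_ne_top, hhint.neg.lintegral_lt_top.ne⟩) ?_
      refine (lintegral_mono fun p : Plane × X =>
        EReal.toENNReal_le_add_ofReal_neg (f₀ p.1 p.2) (h p.1)).trans ?_
      have hneg : Measurable fun p : Plane × X => ENNReal.ofReal (-h p.1) := hhm.neg.ennreal_ofReal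
      rw [lintegral_add_right _ hneg]
      gcongr
      exact hlow.trans hlim
    obtain ⟨g, hg, hlim, hg_int⟩ :=
      exists_tendsto_eaverage (isMeasurePreservingFlow_vadd_snd hinv) hf₀ hfin
    exact ⟨g, hg, hlim, hg_int⟩
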